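/- Let $\mathbb S^1=\mathbb R/\mathbb Z$ with its uniform measure $\lambda$, and let $\Phi:\mathbb S^1\to\mathbb S^1$ be a $C^2$ expanding map, i.e. $|\Phi'|>1$ everywhere. Let $\mu$ be its absolutely continuous invariant probability measure, and set $m=\min|\Phi'|$ (so $m=\min\Phi'$ when $\Phi$ preserves orientation). For a probability measure $\nu$ on $\mathbb S^1$ let $L^2_0(\nu)\subset L^2(\nu)$ be the closure of the set of gradients (derivatives) of smooth functions $\mathbb S^1\to\mathbb R$; for $v\in L^2_0(\nu)$ write $\nu+tv=(\mathrm{Id}+tv)_\#\nu$, and let $W$ be the quadratic Wasserstein distance. A continuous linear operator $L:L^2_0(\mu)\to L^2_0(\mu)$ is a Gâteaux derivative of $\Phi_\#$ at $\mu=\Phi_\#\mu$ if $\mu$ has no atom and $W(\Phi_\#(\mu+tv),\mu+tLv)=o(t)$ as $t\to0$, for every $v\in L^2_0(\mu)$. Then $\mu=\rho\lambda$ for a continuous positive function $\rho$, and $\Phi_\#$ has exactly one Gâteaux derivative $\mathscr L$ at $\rho\lambda$. Moreover: 1. Let $\tilde{\mathscr L}f(x)=\sum_{y\in\Phi^{-1}(x)}\frac{\rho(y)}{\rho(x)}f(y)$.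 The suprema $\sup\tilde{\mathscr L}^n1$ are finite, the limit $R_g=\lim_n(\sup\tilde{\mathscr L}^n 1)^{1/n}$ exists, and $R_g\ge m>1$. 2. There is an infinite linearly independent family $(v_i)_{i\in\mathbb N}$ of continuous functions in $L^2_0(\rho\lambda)$ such that $\mathscr L v_i=v_i$ for all $i$. 3. More generally, for every real $\alpha$ with $|\alpha|<m$ there is an infinite linearly independent family of continuous functions $v_i\in L^2_0(\rho\lambda)$ with $\mathscr L v_i=\alpha v_i$; and for every complex $z$ with $|z|<m$ there is an infinite family, linearly independent over $\mathbb C$, of continuous functions $c_i:\mathbb S^1\to\mathbb C$ whose real and imaginary parts lie in $L^2_0(\rho\lambda)$ and such that $\mathscr L c_i=z c_i$ for the complexified operator. -/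

import Mathlib

open MeasureTheory Filter Topology Asymptotics
open scoped ENNReal ContDiff

noncomputable section

/-- The quadratic Wasserstein distance on the circle `ℝ/ℤ`: the square root of the infimum of the
cost `∫ d(x,y)² dπ` over all transport plans `π` with marginals `μ` and `ν`. -/
def wasserstein (μ ν : Measure UnitAddCircle) : ℝ :=
  ((⨅ (π : Measure (UnitAddCircle × UnitAddCircle))
      (_ : π.map Prod.fst = μ ∧ π.map Prod.snd = ν),
      ∫⁻ p, edist p.1 p.2 ^ 2 ∂π) ^ (1 / 2 : ℝ)).toReal

/-- `g` is the gradient (derivative) of a smooth function on the circle. Smooth functions on the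
circle are given as smooth `1`-periodic functions on the line. -/
def IsSmoothGradient (g : UnitAddCircle → ℝ) : Prop :=
  ∃ f : ℝ → ℝ, ContDiff ℝ ∞ f ∧ Function.Periodic f 1 ∧ ∀ x : ℝ, g (x : UnitAddCircle) = deriv f x

/-- The tangent space `L²₀(μ)`: all vector fields in `L²(μ)` that are limits in `L²(μ)` of
gradients of smooth functions. (The classes of gradients already form a linear subspace, so that
taking their span adds nothing.) -/
def tangentL2 (μ : Measure UnitAddCircle) : Submodule ℝ (Lp ℝ 2 μ) :=
  (Submodule.span ℝ {w : Lp ℝ 2 μ |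
    ∃ g : UnitAddCircle → ℝ, IsSmoothGradient g ∧ w =ᵐ[μ] g}).topologicalClosure

/-- The exponential map: `μ + t v = (Id + t v)_# μ`. -/
def pushAlong (μ : Measure UnitAddCircle) (t : ℝ) (v : UnitAddCircle → ℝ) :
    Measure UnitAddCircle :=
  μ.map (fun x => x + ((t * v x : ℝ) : UnitAddCircle))

/-- The map `f`, acting on probability measures on the circle, sends `μ` to the atomless measure
`ν`, and the continuous linear operator `L : L²₀(μ) → L²₀(ν)` is a Gâteaux derivative of `f` at
`μ`: for every `v`, `W(f(μ + t v), f(μ) + t L v) = o(t)` as `t → 0`. -/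
structure HasGateauxDeriv (f : Measure UnitAddCircle → Measure UnitAddCircle)
    (μ ν : Measure UnitAddCircle) (L : tangentL2 μ →L[ℝ] tangentL2 ν) : Prop where
  map_eq : f μ = ν
  noAtoms : ∀ x, ν {x} = 0
  isLittleO : ∀ v : tangentL2 μ,
    (fun t : ℝ => wasserstein (f (pushAlong μ t (v : Lp ℝ 2 μ)))
      (pushAlong ν t (L v : Lp ℝ 2 ν))) =o[𝓝 0] fun t : ℝ => t

/-- The weighted transfer operator
`f ↦ (x ↦ ∑_{y ∈ Φ⁻¹(x)} (ρ(y) / ρ(x)) f(y))`, of weight `ρ / ρ ∘ Φ`. -/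
def transferOp (Φ : UnitAddCircle → UnitAddCircle) (ρ f : UnitAddCircle → ℝ) :
    UnitAddCircle → ℝ :=
  fun x => ∑ᶠ y ∈ Φ ⁻¹' {x}, ρ y / ρ x * f y

/-- `R = lim_n (sup 𝓛̃ⁿ 1)^{1/n}`, where `𝓛̃` is the weighted transfer operator `transferOp Φ ρ`;
the suprema are finite and the limit exists. -/
def IsTransferRadius (Φ : UnitAddCircle → UnitAddCircle) (ρ : UnitAddCircle → ℝ) (R : ℝ) : Prop :=
  ∃ s : ℕ → ℝ,
    (∀ n, IsLUB (Set.range ((transferOp Φ ρ)^[n] fun _ => 1)) (s n)) ∧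
      Tendsto (fun n : ℕ => s n ^ (1 / (n : ℝ))) atTop (𝓝 R)

end

/-! Since `(φ ∘ Φ)' = Φ' · (φ' ∘ Φ)` for a test function `φ`, the derivative of `Φ_#` at `μ` has to
be the adjoint, on the tangent space, of `c ↦ Φ' · (c ∘ Φ)`; this is `tangentDual`. On a continuous
zero-mean field `u` a change of variables gives its value as the zero-mean `w` with `ρ w = s ∑ ρ u -
b`, where the sum is over a fibre, `s` is the sign of `Φ'`, and `b` is a constant that gradients do
not see (`tangentDual_toLp`).

Density. The transfer operator maps a cone of log-Lipschitz functions strictly into itself, and all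
normalized images share a constant part; removing it at each step gives exponential convergence to
`ρ` (`exists_invariant_density`). Approximating the density of `μ` in `L¹` by Lipschitz functions
then identifies it with `ρ` (`eq_withDensity_of_invariant`).

Gâteaux derivative. For uniqueness, `W` controls differences of integrals of Lipschitz functions, so
two derivatives have the same inner products with gradients (`HasGateauxDeriv.unique`). For
existence, let `u` be a smooth gradient. Then `Φ ∘ (Id + t u)` is still a covering, and rearranging
the image of `μ` monotonically into `μ` yields a `μ`-preserving map `Θ` with `Θ + t w(Θ)` uniformly
`o(t)`-close to `Φ ∘ (Id + t u)`. This is a transport plan of cost `o(t)²`; density of gradients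
handles general `v` (`hasGateauxDeriv_tangentDual`).

Spectrum. Put `A u = (s / ρ) ∑ ρ u` and `B f = (f ∘ Φ) / Φ'`. Invariance of `ρ` says exactly `A B =
1`, and `‖B‖ ≤ 1 / m`. For `|α| < m`, `(1 - α B)⁻¹` therefore maps `ker A` injectively into `ker (A
- α)`. As the degree is at least two, `ker A` is infinite-dimensional, and the zero-mean condition
removes only a hyperplane; zero-mean eigenfunctions of `A` are eigenvectors of the derivative, with
`b = 0` (`exists_linearIndependent_eigenfunctions`).

Radius. Invariance of `ρ` bounds the weighted operator applied to `1` below by `m`, and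
submultiplicativity of the suprema gives the limit (`exists_tendsto_isLUB_iterate`). -/

/-! ### Covering lifts, sums over fibres and change of variables -/

/-- `F` is a `C¹` diffeomorphism of the line, with inverse `G`, that lifts a covering of the circle
`ℝ/ℤ` of degree `s * N`, where `s` is the sign of the derivative of `F`. -/
structure IsCoveringLift (F G : ℝ → ℝ) (s : ℝ) (N : ℕ) : Prop where
  contDiff : ContDiff ℝ 1 F
  sign : s = 1 ∨ s = -1
  pos : ∀ x, 0 < s * deriv F x
  map_add : ∀ x, F (x + s) = F x + N
  left_inv : ∀ x, G (F x) = x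
  right_inv : ∀ x, F (G x) = x

/-- The sum of `g` over the points of a fundamental domain that a covering lift with inverse `G`
maps to `x` modulo `1`. -/
def branchSum {E : Type*} [AddCommMonoid E] (G : ℝ → ℝ) (N : ℕ) (g : ℝ → E) (x : ℝ) : E :=
  ∑ k ∈ Finset.range N, g (G (x + k))

theorem contDiff_one_of_hasDerivAt {f f' : ℝ → ℝ} (h : ∀ x, HasDerivAt f (f' x) x)
    (hc : Continuous f') : ContDiff ℝ 1 f :=
  contDiff_one_iff_deriv.2 ⟨fun x => (h x).differentiableAt, by
    rwa [show deriv f = f' from funext fun x => (h x).deriv]⟩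

theorem Function.Periodic.comp_add_eq_of_sign {E : Type*} {g : ℝ → E} (hg : Function.Periodic g 1)
    {s : ℝ} (hs : s = 1 ∨ s = -1) (x : ℝ) : g (x + s) = g x := by
  rcases hs with rfl | rfl
  · exact hg x
  · simpa using (hg (x + -1)).symm

theorem Function.Periodic.exists_norm_le {E : Type*} [NormedAddCommGroup E] {g : ℝ → E}
    (hg : Function.Periodic g 1) (hc : Continuous g) : ∃ C, 0 < C ∧ ∀ x, ‖g x‖ ≤ C := by
  obtain ⟨C, hC⟩ := isCompact_Icc.exists_bound_of_continuousOn (s := Set.Icc (0 : ℝ) 1)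
    hc.continuousOn
  refine ⟨max C 1, by positivity, fun x => ?_⟩
  obtain ⟨y, hy, h⟩ := hg.exists_mem_Ico₀ one_pos x
  rw [h]
  exact (hC y ⟨hy.1, hy.2.le⟩).trans (le_max_left _ _)

theorem Function.Periodic.exists_pos_le {g : ℝ → ℝ} (hg : Function.Periodic g 1)
    (hc : Continuous g) (hpos : ∀ x, 0 < g x) : ∃ c, 0 < c ∧ ∀ x, c ≤ g x := by
  obtain ⟨z, -, hz⟩ := isCompact_Icc.exists_isMinOn (s := Set.Icc (0 : ℝ) 1) ⟨0, by simp⟩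
    hc.continuousOn
  refine ⟨g z, hpos z, fun x => ?_⟩
  obtain ⟨y, hy, h⟩ := hg.exists_mem_Ico₀ one_pos x
  rw [h]
  exact hz ⟨hy.1, hy.2.le⟩

theorem Function.Periodic.deriv {f : ℝ → ℝ} {T : ℝ} (hf : Function.Periodic f T) :
    Function.Periodic (deriv f) T := fun x => by
  rw [← deriv_comp_add_const]
  exact congrArg (fun g => _root_.deriv g x) (funext hf)

theorem exists_continuousMap_of_periodic {X : Type*} [TopologicalSpace X] {g : ℝ → X}
    (hg : Function.Periodic g 1) (hc : Continuous g) :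
    ∃ c : C(UnitAddCircle, X), ∀ x : ℝ, c (x : UnitAddCircle) = g x :=
  ⟨⟨hg.lift, continuous_coinduced_dom.2 hc⟩, fun x => hg.lift_coe x⟩

theorem periodic_comp_coe {X : Type*} (f : UnitAddCircle → X) :
    Function.Periodic (fun x : ℝ => f (x : UnitAddCircle)) 1 := fun x => by
  simp

theorem Function.Periodic.intervalIntegral_eq_of_sign {g : ℝ → ℝ} (hg : Function.Periodic g 1)
    {s : ℝ} (hs : s = 1 ∨ s = -1) (a : ℝ) :
    s * ∫ x in a..a + s, g x = ∫ x in (0 : ℝ)..1, g x := by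
  rcases hs with rfl | rfl
  · simpa using hg.intervalIntegral_add_eq a 0
  · rw [intervalIntegral.integral_symm]
    simpa using hg.intervalIntegral_add_eq (a + -1) 0

namespace IsCoveringLift

variable {F G : ℝ → ℝ} {s : ℝ} {N : ℕ}

theorem sign_sq (h : IsCoveringLift F G s N) : s * s = 1 := by
  rcases h.sign with rfl | rfl <;> norm_num

theorem deriv_ne (h : IsCoveringLift F G s N) (x : ℝ) : deriv F x ≠ 0 := fun h0 => by
  simpa [h0] using h.pos x

theorem hasDerivAt (h : IsCoveringLift F G s N) (x : ℝ) : HasDerivAt F (deriv F x) x :=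
  (h.contDiff.differentiable one_ne_zero x).hasDerivAt

theorem continuous_deriv (h : IsCoveringLift F G s N) : Continuous (deriv F) :=
  h.contDiff.continuous_deriv le_rfl

theorem weight_eq (h : IsCoveringLift F G s N) (x : ℝ) : s / deriv F x = |deriv F x|⁻¹ := by
  have := h.pos x
  rcases h.sign with rfl | rfl
  · rw [abs_of_pos (by linarith), one_div]
  · rw [abs_of_neg (by linarith), neg_div, one_div, inv_neg]

theorem weight_pos (h : IsCoveringLift F G s N) (x : ℝ) : 0 < s / deriv F x := by
  rw [h.weight_eq]
  exact inv_pos.2 (abs_pos.2 (h.deriv_ne x))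

theorem continuous_weight (h : IsCoveringLift F G s N) : Continuous fun x => s / deriv F x :=
  continuous_const.div h.continuous_deriv h.deriv_ne

theorem strictMono (h : IsCoveringLift F G s N) : StrictMono fun x => s * F x :=
  strictMono_of_deriv_pos fun x => by
    rw [((h.hasDerivAt x).const_mul s).deriv]
    exact h.pos x

/-- `s * F` is an increasing bijection of the line, hence an order isomorphism and a homeomorphism.
-/
theorem continuous_inv (h : IsCoveringLift F G s N) : Continuous G := by
  have hsurj : Function.Surjective fun x => s * F x := fun y => ⟨G (s * y), by
    simp only [h.right_inv, ← mul_assoc, h.sign_sq, one_mul]⟩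
  have : G = fun x => (h.strictMono.orderIsoOfSurjective _ hsurj).toHomeomorph.symm (s * x) := by
    funext x
    symm
    rw [Homeomorph.symm_apply_eq]
    simp [h.right_inv]
  rw [this]
  fun_prop

theorem hasDerivAt_inv (h : IsCoveringLift F G s N) (x : ℝ) :
    HasDerivAt G (deriv F (G x))⁻¹ x :=
  HasDerivAt.of_local_left_inverse h.continuous_inv.continuousAt (h.hasDerivAt _) (h.deriv_ne _)
    (Eventually.of_forall h.right_inv)

/-- Because the period of `F` is written with `s`, the points `x, x + 1, …, x + (N - 1)` are pulled
back into a single fundamental domain for both orientations. -/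
theorem inv_add (h : IsCoveringLift F G s N) (x : ℝ) : G (x + N) = G x + s := by
  conv_lhs => rw [← h.right_inv x, ← h.map_add, h.left_inv]

theorem inv_add_int_mul (h : IsCoveringLift F G s N) (x : ℝ) (n : ℤ) :
    G (x + n * N) = G x + n * s := by
  induction n using Int.induction_on with
  | zero => simp
  | succ n ih =>
    have := h.inv_add (x + n * N)
    push_cast at ih ⊢
    rw [ih] at this
    rw [show x + ((n : ℝ) + 1) * N = x + n * N + N by ring, this]
    ring
  | pred n ih =>
    have := h.inv_add (x + (-n - 1) * N)
    push_cast at ih ⊢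
    rw [show x + (-(n : ℝ) - 1) * N + N = x + -n * N by ring, ih] at this
    linarith

theorem map_add_int_mul (h : IsCoveringLift F G s N) (x : ℝ) (n : ℤ) :
    F (x + n * s) = F x + n * N := by
  conv_lhs => rw [← h.left_inv x, ← h.inv_add_int_mul, h.right_inv]

theorem sign_mul_coe (h : IsCoveringLift F G s N) (n : ℤ) :
    ((n * s : ℝ) : UnitAddCircle) = 0 := by
  rw [AddCircle.coe_eq_zero_iff]
  rcases h.sign with rfl | rfl
  · exact ⟨n, by simp⟩
  · exact ⟨-n, by simp⟩

theorem map_add_one (h : IsCoveringLift F G s N) (x : ℝ) : F (x + 1) = F x + s * N := by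
  rcases h.sign with rfl | rfl
  · simpa using h.map_add x
  · have := h.map_add (x + 1)
    simp only [neg_mul, one_mul, add_neg_cancel_right] at this ⊢
    linarith

theorem coe_map_periodic (h : IsCoveringLift F G s N) :
    Function.Periodic (fun x => (F x : UnitAddCircle)) 1 := fun x => by
  simp only [h.map_add_one]
  rw [AddCircle.coe_add, mul_comm s, show ((N : ℝ) * s) = ((N : ℤ) : ℝ) * s by simp,
    h.sign_mul_coe, add_zero]

theorem deriv_periodic (h : IsCoveringLift F G s N) : Function.Periodic (deriv F) 1 := fun x => by
  rw [← deriv_comp_add_const]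
  simp [h.map_add_one]

theorem periodic_comp (h : IsCoveringLift F G s N) {E : Type*} {g : ℝ → E}
    (hg : Function.Periodic g 1) : Function.Periodic (fun x => g (F x)) 1 := fun x => by
  have := h.coe_map_periodic x
  simpa using congrArg hg.lift this

theorem weight_periodic (h : IsCoveringLift F G s N) :
    Function.Periodic (fun x => s / deriv F x) 1 := fun x => by
  simp only [h.deriv_periodic x]

/-- Moving `x` by one replaces the branch `G x` by `G (x + N) = G x + s`, which `g` does not
distinguish from it. -/
theorem branchSum_periodic (h : IsCoveringLift F G s N) {E : Type*} [AddCommGroup E] {g : ℝ → E}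
    (hg : Function.Periodic g 1) : Function.Periodic (branchSum G N g) 1 := fun x => by
  have h1 := Finset.sum_range_succ' (fun k : ℕ => g (G (x + k))) N
  rw [Finset.sum_range_succ, h.inv_add, hg.comp_add_eq_of_sign h.sign, Nat.cast_zero, add_zero,
    add_left_inj] at h1
  rw [branchSum, branchSum, h1]
  refine Finset.sum_congr rfl fun k _ => ?_
  push_cast
  congr 2
  ring

theorem branchSum_continuous (h : IsCoveringLift F G s N) {E : Type*} [AddCommMonoid E]
    [TopologicalSpace E] [ContinuousAdd E] {g : ℝ → E} (hg : Continuous g) :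
    Continuous (branchSum G N g) :=
  continuous_finsetSum _ fun _ _ =>
    hg.comp (h.continuous_inv.comp (continuous_id.add continuous_const))

theorem branchSum_comp_mul (h : IsCoveringLift F G s N) {𝕜 : Type*} [Semiring 𝕜] {φ : ℝ → 𝕜}
    (hφ : Function.Periodic φ 1) (g : ℝ → 𝕜) (x : ℝ) :
    branchSum G N (fun y => φ (F y) * g y) x = φ x * branchSum G N g x := by
  simp only [branchSum, h.right_inv, Finset.mul_sum]
  refine Finset.sum_congr rfl fun k _ => ?_
  have : φ (x + k) = φ x := by simpa using hφ.nat_mul k x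
  rw [this]

/-- `G (x + j)` and `G (x + k)` agree modulo one exactly when `j` and `k` agree modulo `N`, so
`Finset.range N` labels each preimage once. -/
theorem bijOn_fiber (h : IsCoveringLift F G s N) (hN : 0 < N) {Φ : UnitAddCircle → UnitAddCircle}
    (hΦ : ∀ x : ℝ, Φ (x : UnitAddCircle) = (F x : UnitAddCircle)) (x : ℝ) :
    Set.BijOn (fun k : ℕ => (G (x + k) : UnitAddCircle)) (Finset.range N : Set ℕ)
      (Φ ⁻¹' {(x : UnitAddCircle)}) := by
  have hcoe : ∀ a b : ℝ, (a : UnitAddCircle) = b → ∃ n : ℤ, a = b + n := fun a b hab => by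
    rw [← sub_eq_zero, ← AddCircle.coe_sub, AddCircle.coe_eq_zero_iff] at hab
    obtain ⟨n, hn⟩ := hab
    exact ⟨n, by simp at hn; linarith⟩
  have hs := h.sign_sq
  refine ⟨fun k _ => ?_, fun j hj k hk hjk => ?_, fun y hy => ?_⟩
  · simp only [Set.mem_preimage, hΦ, h.right_inv, Set.mem_singleton_iff]
    simpa using (periodic_comp_coe (fun z : UnitAddCircle => z)).nat_mul k x
  · obtain ⟨n, hn⟩ := hcoe _ _ hjk
    obtain ⟨n', hn'⟩ : ∃ n' : ℤ, (n : ℝ) = n' * s := by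
      rcases h.sign with rfl | rfl
      · exact ⟨n, by simp⟩
      · exact ⟨-n, by simp⟩
    have h2 := congrArg F hn
    rw [hn', h.map_add_int_mul, h.right_inv, h.right_inv] at h2
    have h3 : (j : ℤ) = k + n' * N := by
      have : (j : ℝ) = k + n' * N := by linarith
      exact_mod_cast this
    simp only [Finset.coe_range, Set.mem_Iio] at hj hk
    have h4 : (j : ℤ) % N = (k : ℤ) % N := by rw [h3]; simp
    rw [Int.emod_eq_of_lt (by positivity) (by exact_mod_cast hj),
      Int.emod_eq_of_lt (by positivity) (by exact_mod_cast hk)] at h4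
    exact_mod_cast h4
  · obtain ⟨z, rfl⟩ := QuotientAddGroup.mk_surjective y
    change Φ ((z : ℝ) : UnitAddCircle) = x at hy
    rw [hΦ] at hy
    obtain ⟨n, hn⟩ := hcoe _ _ hy
    have hN' : (0 : ℤ) < N := by exact_mod_cast hN
    -- The remainder selects the branch; the quotient `n / N` only translates by whole fundamental
    -- domains.
    refine ⟨(n % N).toNat, ?_, ?_⟩
    · have := Int.emod_lt_of_pos n hN'
      have := Int.emod_nonneg n hN'.ne'
      simp only [Finset.coe_range, Set.mem_Iio]
      omega
    · have h1 : (((n % N).toNat : ℕ) : ℝ) = ((n % N : ℤ) : ℝ) := by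
        have := Int.toNat_of_nonneg (Int.emod_nonneg n hN'.ne')
        exact_mod_cast congrArg (fun t : ℤ => (t : ℝ)) this
      have h2 : z = G (x + ((n % N).toNat : ℕ)) + (n / N : ℤ) * s := by
        rw [← h.inv_add_int_mul, ← h.left_inv z, hn, h1]
        congr 1
        have : (n : ℝ) = ((n % N + n / N * N : ℤ) : ℝ) := by rw [Int.emod_add_ediv_mul]
        rw [this]
        push_cast
        ring
      change ((G _ : ℝ) : UnitAddCircle) = (z : ℝ)
      conv_rhs => rw [h2]
      rw [AddCircle.coe_add, h.sign_mul_coe, add_zero]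

theorem finsum_fiber (h : IsCoveringLift F G s N) (hN : 0 < N) {Φ : UnitAddCircle → UnitAddCircle}
    (hΦ : ∀ x : ℝ, Φ (x : UnitAddCircle) = (F x : UnitAddCircle)) {E : Type*} [AddCommMonoid E]
    (g : UnitAddCircle → E) (x : ℝ) :
    ∑ᶠ y ∈ Φ ⁻¹' {(x : UnitAddCircle)}, g y = branchSum G N (fun y => g (y : UnitAddCircle)) x := by
  rw [← finsum_mem_eq_of_bijOn _ (h.bijOn_fiber hN hΦ x) fun k _ => rfl, finsum_mem_coe_finset]
  rfl

/-- Change of variables along a covering of the circle. -/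
theorem integral_comp_mul (h : IsCoveringLift F G s N) {φ g : ℝ → ℝ}
    (hφ : Function.Periodic φ 1) (hφc : Continuous φ) (hg : Function.Periodic g 1)
    (hgc : Continuous g) :
    ∫ y in (0 : ℝ)..1, φ (F y) * g y =
      ∫ x in (0 : ℝ)..1, φ x * branchSum G N (fun y => g y * (s / deriv F y)) x := by
  have hc : Continuous fun y => φ (F y) * (g y * (s / deriv F y)) :=
    (hφc.comp h.contDiff.continuous).mul (hgc.mul h.continuous_weight)
  have hG := h.continuous_inv
  -- The `N` branches over `[0, 1]` are glued into one integral over `[0, N]`, where `x = F y` is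
  -- then substituted.
  have h1 : ∫ x in (0 : ℝ)..1, φ x * branchSum G N (fun y => g y * (s / deriv F y)) x =
      ∫ x in (0 : ℝ)..N, φ (F (G x)) * (g (G x) * (s / deriv F (G x))) := by
    have h0 : ∀ x, φ x * branchSum G N (fun y => g y * (s / deriv F y)) x =
        ∑ k ∈ Finset.range N,
          φ (F (G (x + k))) * (g (G (x + k)) * (s / deriv F (G (x + k)))) := fun x => by
      rw [← h.branchSum_comp_mul hφ, branchSum]
    simp only [h0]
    have hi : ∀ k : ℕ, IntervalIntegrable (fun x : ℝ =>
        φ (F (G (x + k))) * (g (G (x + k)) * (s / deriv F (G (x + k))))) volume 0 1 := fun k =>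
      (hc.comp (hG.comp (continuous_id.add continuous_const))).intervalIntegrable _ _
    rw [intervalIntegral.integral_finsetSum fun k _ => hi k]
    have h2 := intervalIntegral.sum_integral_adjacent_intervals (n := N) (a := fun k : ℕ => (k : ℝ))
      (μ := volume) fun k _ => (hc.comp hG).intervalIntegrable _ _
    simp only [Nat.cast_zero, Function.comp_def] at h2
    rw [← h2]
    refine Finset.sum_congr rfl fun k _ => ?_
    rw [intervalIntegral.integral_comp_add_right
      (fun x => φ (F (G x)) * (g (G x) * (s / deriv F (G x))))]
    push_cast
    simp [add_comm]
  have h3 := intervalIntegral.integral_comp_mul_deriv (a := G 0) (b := G N) (f := F)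
    (f' := deriv F) (fun x _ => h.hasDerivAt x) h.continuous_deriv.continuousOn (hc.comp hG)
  simp only [h.right_inv, Function.comp_def] at h3
  rw [h1]
  simp only [h.right_inv]
  rw [← h3]
  have h5 : ∀ x, φ (F x) * (g (G (F x)) * (s / deriv F (G (F x)))) * deriv F x =
      s * (φ (F x) * g x) := fun x => by
    rw [h.left_inv]
    field_simp [h.deriv_ne x]
  have hper : Function.Periodic (fun x => φ (F x) * g x) 1 := (h.periodic_comp hφ).mul hg
  simp only [h5]
  -- The interval from `G 0` to `G 0 + s` is one period, run backwards if `s = -1`; the factor `s`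
  -- restores the orientation.
  have h6 : G N = G 0 + s := by simpa using h.inv_add 0
  rw [h6, intervalIntegral.integral_const_mul, hper.intervalIntegral_eq_of_sign h.sign]

end IsCoveringLift

/-- Monotonicity gives injectivity, and the relation under translation by `s` makes `F` unbounded on
both sides, hence surjective. -/
theorem exists_isCoveringLift {F : ℝ → ℝ} {s : ℝ} {N : ℕ} (hN : 0 < N) (hF : ContDiff ℝ 1 F)
    (hs : s = 1 ∨ s = -1) (hpos : ∀ x, 0 < s * deriv F x) (hadd : ∀ x, F (x + s) = F x + N) :
    ∃ G, IsCoveringLift F G s N := by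
  have hss : s * s = 1 := by rcases hs with rfl | rfl <;> norm_num
  have hmono : StrictMono fun x => s * F x := strictMono_of_deriv_pos fun x => by
    rw [deriv_const_mul _ (hF.differentiable one_ne_zero x)]
    exact hpos x
  have hinj : Function.Injective F := fun x y hxy => hmono.injective (by simp [hxy])
  have hup : ∀ n : ℕ, F (n * s) = F 0 + n * N := fun n => by
    induction n with
    | zero => simp
    | succ n ih =>
      have := hadd (n * s)
      push_cast
      rw [show ((n : ℝ) + 1) * s = n * s + s by ring, this, ih]
      ring
  have hdown : ∀ n : ℕ, F (-(n * s)) = F 0 - n * N := fun n => by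
    induction n with
    | zero => simp
    | succ n ih =>
      have := hadd (-((n + 1) * s))
      push_cast
      rw [show -(((n : ℝ) + 1) * s) + s = -(n * s) by ring, ih] at this
      linarith
  have hN1 : (1 : ℝ) ≤ N := by exact_mod_cast hN
  have hsurj : Function.Surjective F := fun y => by
    obtain ⟨n, hn⟩ := exists_nat_ge (|y - F 0|)
    have hn0 : (n : ℝ) ≤ n * N := le_mul_of_one_le_right (by positivity) hN1
    refine mem_range_of_exists_le_of_exists_ge hF.continuous ⟨-(n * s), ?_⟩ ⟨n * s, ?_⟩
    · rw [hdown]; linarith [neg_abs_le (y - F 0)]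
    · rw [hup]; linarith [le_abs_self (y - F 0)]
  obtain ⟨G, hG⟩ := hsurj.hasRightInverse
  exact ⟨G, hF, hs, hpos, hadd, fun x => hinj (hG _), hG⟩

/-! ### The cone of log-Lipschitz functions -/

/-- A positive periodic function whose logarithm is `K`-Lipschitz. -/
structure LogLipschitz (K : ℝ) (f : ℝ → ℝ) : Prop where
  pos : ∀ x, 0 < f x
  periodic : Function.Periodic f 1
  le : ∀ x y, f x ≤ Real.exp (K * |x - y|) * f y

theorem Real.exp_sub_one_le_mul_exp (a : ℝ) : Real.exp a - 1 ≤ a * Real.exp a := by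
  have h1 := Real.add_one_le_exp (-a)
  have h2 := mul_le_mul_of_nonneg_right h1 (Real.exp_pos a).le
  rw [← Real.exp_add, neg_add_cancel, Real.exp_zero] at h2
  linarith

namespace LogLipschitz

variable {K : ℝ} {f : ℝ → ℝ}

/-- By periodicity the two points may be taken at distance at most one. -/
theorem le_exp_mul (h : LogLipschitz K f) (hK : 0 ≤ K) (x y : ℝ) : f x ≤ Real.exp K * f y := by
  obtain ⟨n, hn⟩ : ∃ n : ℤ, |x - n - y| ≤ 1 := by
    refine ⟨⌊x - y⌋, abs_le.2 ⟨?_, ?_⟩⟩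
    · linarith [Int.floor_le (x - y)]
    · linarith [Int.lt_floor_add_one (x - y)]
  have h1 : f (x - n) = f x := by simpa using h.periodic.sub_int_mul_eq n (x := x)
  rw [← h1]
  refine (h.le _ y).trans (mul_le_mul_of_nonneg_right (Real.exp_le_exp.2 ?_) (h.pos y).le)
  exact mul_le_of_le_one_right hK hn

theorem exists_abs_sub_le (h : LogLipschitz K f) (hK : 0 ≤ K) :
    ∃ C, 0 ≤ C ∧ ∀ x y, |f x - f y| ≤ C * |x - y| := by
  set A := Real.exp K * f 0
  have hA : ∀ x, f x ≤ A := fun x => h.le_exp_mul hK x 0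
  have hA0 : 0 < A := mul_pos (Real.exp_pos K) (h.pos 0)
  have hC : 0 ≤ K * Real.exp K := mul_nonneg hK (Real.exp_pos K).le
  have key : ∀ x y, f x - f y ≤ (K * Real.exp K + 1) * A * |x - y| := fun x y => by
    rcases le_total |x - y| 1 with h1 | h1
    · have h2 := h.le x y
      have h3 := Real.exp_sub_one_le_mul_exp (K * |x - y|)
      have h4 : Real.exp (K * |x - y|) ≤ Real.exp K :=
        Real.exp_le_exp.2 (mul_le_of_le_one_right hK h1)
      have h5 : Real.exp (K * |x - y|) - 1 ≤ K * Real.exp K * |x - y| := by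
        refine h3.trans ?_
        rw [mul_right_comm K (Real.exp K)]
        exact mul_le_mul_of_nonneg_left h4 (mul_nonneg hK (abs_nonneg _))
      calc f x - f y ≤ (Real.exp (K * |x - y|) - 1) * f y := by linarith
        _ ≤ K * Real.exp K * |x - y| * f y := mul_le_mul_of_nonneg_right h5 (h.pos y).le
        _ ≤ K * Real.exp K * |x - y| * A :=
          mul_le_mul_of_nonneg_left (hA y) (mul_nonneg hC (abs_nonneg _))
        _ ≤ _ := by nlinarith [mul_nonneg hA0.le (abs_nonneg (x - y))]
    · have h6 : A ≤ A * |x - y| := le_mul_of_one_le_right hA0.le h1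
      have h7 := h.pos y
      have h8 := mul_nonneg hC (mul_nonneg hA0.le (abs_nonneg (x - y)))
      linarith [hA x]
  refine ⟨_, by positivity, fun x y => abs_sub_le_iff.2 ⟨key x y, ?_⟩⟩
  rw [abs_sub_comm]
  exact key y x

theorem continuous (h : LogLipschitz K f) (hK : 0 ≤ K) : Continuous f := by
  obtain ⟨C, hC, hl⟩ := h.exists_abs_sub_le hK
  exact (LipschitzWith.of_dist_le_mul (K := ⟨C, hC⟩) fun x y => hl x y).continuous

theorem const {c : ℝ} (hc : 0 < c) (hK : 0 ≤ K) : LogLipschitz K fun _ => c :=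
  ⟨fun _ => hc, fun _ => rfl, fun _ _ =>
    le_mul_of_one_le_left hc.le (Real.one_le_exp (mul_nonneg hK (abs_nonneg _)))⟩

theorem mono {K' : ℝ} (h : LogLipschitz K f) (hK : K ≤ K') : LogLipschitz K' f :=
  ⟨h.pos, h.periodic, fun x y => (h.le x y).trans <| mul_le_mul_of_nonneg_right
    (Real.exp_le_exp.2 (mul_le_mul_of_nonneg_right hK (abs_nonneg _))) (h.pos y).le⟩

theorem const_mul (h : LogLipschitz K f) {c : ℝ} (hc : 0 < c) :
    LogLipschitz K fun x => c * f x :=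
  ⟨fun x => mul_pos hc (h.pos x), fun x => by simp only [h.periodic x], fun x y => by
    rw [mul_left_comm]
    exact mul_le_mul_of_nonneg_left (h.le x y) hc.le⟩

theorem le_of_integral_eq_one (h : LogLipschitz K f) (hK : 0 ≤ K)
    (h1 : ∫ x in (0 : ℝ)..1, f x = 1) (x : ℝ) : f x ≤ Real.exp K := by
  have h2 : ∫ y in (0 : ℝ)..1, f x ≤ ∫ y in (0 : ℝ)..1, Real.exp K * f y :=
    intervalIntegral.integral_mono zero_le_one (by simp)
      (((h.continuous hK).const_mul _).intervalIntegrable _ _) fun y => h.le_exp_mul hK x y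
  simpa [h1] using h2

theorem le_of_integral_eq_one' (h : LogLipschitz K f) (hK : 0 ≤ K)
    (h1 : ∫ x in (0 : ℝ)..1, f x = 1) (x : ℝ) : Real.exp (-K) ≤ f x := by
  have h2 : ∫ y in (0 : ℝ)..1, f y ≤ ∫ y in (0 : ℝ)..1, Real.exp K * f x :=
    intervalIntegral.integral_mono zero_le_one ((h.continuous hK).intervalIntegrable _ _)
      (by simp) fun y => h.le_exp_mul hK y x
  rw [Real.exp_neg, inv_le_iff_one_le_mul₀ (Real.exp_pos K), mul_comm]
  simpa [h1] using h2

/-- Subtracting a small constant from a function of a small log-Lipschitz constant. -/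
theorem sub_const {K' ε : ℝ} (h : LogLipschitz K' f) (hK' : 0 ≤ K') (hK : K' < K)
    (h1 : ∫ x in (0 : ℝ)..1, f x = 1) (hε : ε = (K - K') / (K * Real.exp (2 * K))) :
    LogLipschitz K fun x => f x - ε := by
  have hK0 : 0 < K := by linarith
  -- This is the balance that dictates `ε`: with `r = |x - y| ≤ 1`, the loss `ε (exp (K r) - 1)` is
  -- at most `ε K r exp K`, while the slack `(exp (K r) - exp (K' r)) * f y` is at least `(K - K') r
  -- exp (-K)`.
  have hε1 : ε * (K * Real.exp K) = (K - K') * Real.exp (-K) := by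
    rw [hε, Real.exp_neg, two_mul, Real.exp_add]
    field_simp
  have hε0 : 0 ≤ ε := by rw [hε]; have := sub_pos.2 hK; positivity
  have hlow : ∀ x, Real.exp (-K) ≤ f x := fun x =>
    (Real.exp_le_exp.2 (by linarith)).trans (h.le_of_integral_eq_one' hK' h1 x)
  have hεlt : ε < Real.exp (-K) := by
    rw [hε, div_lt_iff₀ (by positivity), Real.exp_neg, two_mul, Real.exp_add]
    have h3 : 1 < Real.exp K := Real.one_lt_exp_iff.2 hK0
    have : (Real.exp K)⁻¹ * (K * (Real.exp K * Real.exp K)) = K * Real.exp K := by field_simp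
    rw [this]
    nlinarith
  have hpos : ∀ x, 0 < f x - ε := fun x => by linarith [hlow x]
  have hper : Function.Periodic (fun x => f x - ε) 1 := fun x => by simp only [h.periodic x]
  have key : ∀ x y, |x - y| ≤ 1 → f x - ε ≤ Real.exp (K * |x - y|) * (f y - ε) := fun x y hr => by
    set r := |x - y|
    have hr0 : 0 ≤ r := abs_nonneg _
    have h2 : Real.exp (K * r) - 1 ≤ K * r * Real.exp K :=
      (Real.exp_sub_one_le_mul_exp _).trans <| mul_le_mul_of_nonneg_left
        (Real.exp_le_exp.2 (mul_le_of_le_one_right hK0.le hr)) (by positivity)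
    have h3 : (K - K') * r ≤ Real.exp (K * r) - Real.exp (K' * r) := by
      have h4 := Real.add_one_le_exp ((K - K') * r)
      have h5 : Real.exp (K * r) = Real.exp ((K - K') * r) * Real.exp (K' * r) := by
        rw [← Real.exp_add]; ring_nf
      have h6 : 1 ≤ Real.exp (K' * r) := Real.one_le_exp (by positivity)
      have h7 : 0 ≤ (K - K') * r := mul_nonneg (by linarith) hr0
      rw [h5]
      nlinarith
    have h8 : ε * (Real.exp (K * r) - 1) ≤ (Real.exp (K * r) - Real.exp (K' * r)) * f y :=
      calc ε * (Real.exp (K * r) - 1) ≤ ε * (K * r * Real.exp K) :=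
            mul_le_mul_of_nonneg_left h2 hε0
        _ = (K - K') * r * Real.exp (-K) := by linear_combination r * hε1
        _ ≤ (K - K') * r * f y :=
          mul_le_mul_of_nonneg_left (hlow y) (mul_nonneg (by linarith) hr0)
        _ ≤ _ := mul_le_mul_of_nonneg_right h3 (h.pos y).le
    linarith [h.le x y]
  refine ⟨hpos, hper, fun x y => ?_⟩
  rcases le_total |x - y| 1 with hr | hr
  · exact key x y hr
  · obtain ⟨n, hn⟩ : ∃ n : ℤ, |x - n - y| ≤ 1 := by
      refine ⟨⌊x - y⌋, abs_le.2 ⟨?_, ?_⟩⟩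
      · linarith [Int.floor_le (x - y)]
      · linarith [Int.lt_floor_add_one (x - y)]
    have h9 : f (x - n) = f x := by simpa using h.periodic.sub_int_mul_eq n (x := x)
    have h10 := key (x - n) y hn
    rw [h9] at h10
    refine h10.trans (mul_le_mul_of_nonneg_right (Real.exp_le_exp.2 ?_) (hpos y).le)
    exact mul_le_mul_of_nonneg_left (hn.trans hr) hK0.le

end LogLipschitz

/-! ### The transfer operator and its invariant density -/

/-- The transfer operator of a covering lift: the density of the image of the measure of
density `f`. -/
noncomputable def transfer (F G : ℝ → ℝ) (s : ℝ) (N : ℕ) (f : ℝ → ℝ) : ℝ → ℝ :=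
  branchSum G N fun y => f y * (s / deriv F y)

namespace IsCoveringLift

variable {F G : ℝ → ℝ} {s : ℝ} {N : ℕ}

theorem abs_inv_sub_le (h : IsCoveringLift F G s N) {m : ℝ} (hm : 0 < m)
    (hF : ∀ x, m ≤ |deriv F x|) (x y : ℝ) : |G x - G y| ≤ |x - y| / m := by
  have := Convex.norm_image_sub_le_of_norm_deriv_le (f := G) (s := Set.univ) (C := m⁻¹)
    (x := y) (y := x) (fun z _ => (h.hasDerivAt_inv z).differentiableAt) (fun z _ => by
      rw [(h.hasDerivAt_inv z).deriv, norm_inv]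
      exact inv_anti₀ hm (hF _)) convex_univ trivial trivial
  simpa [div_eq_inv_mul] using this

theorem transfer_continuous (h : IsCoveringLift F G s N) {f : ℝ → ℝ} (hf : Continuous f) :
    Continuous (transfer F G s N f) :=
  h.branchSum_continuous (hf.mul h.continuous_weight)

theorem transfer_periodic (h : IsCoveringLift F G s N) {f : ℝ → ℝ} (hf : Function.Periodic f 1) :
    Function.Periodic (transfer F G s N f) 1 :=
  h.branchSum_periodic (hf.mul h.weight_periodic)

theorem integral_transfer (h : IsCoveringLift F G s N) {f : ℝ → ℝ} (hf : Function.Periodic f 1)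
    (hc : Continuous f) :
    ∫ x in (0 : ℝ)..1, transfer F G s N f x = ∫ x in (0 : ℝ)..1, f x := by
  simpa [transfer] using (h.integral_comp_mul (φ := fun _ => 1) (fun _ => rfl) continuous_const hf hc).symm

/-- Inverse branches contract distances by `m`, and the weight adds its own log-Lipschitz constant
`D` before the contraction. -/
theorem transfer_logLipschitz (h : IsCoveringLift F G s N) (hN : 0 < N) {m D K : ℝ} (hm : 0 < m)
    (hF : ∀ x, m ≤ |deriv F x|) (hDK : 0 ≤ K + D)
    (hD : ∀ x y, s / deriv F x ≤ Real.exp (D * |x - y|) * (s / deriv F y)) {f : ℝ → ℝ}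
    (hf : LogLipschitz K f) : LogLipschitz ((K + D) / m) (transfer F G s N f) := by
  have hpos : ∀ y, 0 < f y * (s / deriv F y) := fun y => mul_pos (hf.pos y) (h.weight_pos y)
  refine ⟨fun x => by
      rw [transfer, branchSum]
      exact Finset.sum_pos (fun k _ => hpos _) (Finset.nonempty_range_iff.2 hN.ne'),
    h.transfer_periodic hf.periodic, fun x y => ?_⟩
  simp only [transfer, branchSum, Finset.mul_sum]
  refine Finset.sum_le_sum fun k _ => ?_
  set a := G (x + k)
  set b := G (y + k)
  have hab : |a - b| ≤ |x - y| / m := by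
    simpa using h.abs_inv_sub_le hm hF (x + k) (y + k)
  calc f a * (s / deriv F a)
      ≤ (Real.exp (K * |a - b|) * f b) * (Real.exp (D * |a - b|) * (s / deriv F b)) :=
        mul_le_mul (hf.le a b) (hD a b) (h.weight_pos a).le
          (mul_pos (Real.exp_pos _) (hf.pos b)).le
    _ = Real.exp ((K + D) * |a - b|) * (f b * (s / deriv F b)) := by
        rw [add_mul, Real.exp_add]; ring
    _ ≤ Real.exp ((K + D) / m * |x - y|) * (f b * (s / deriv F b)) := by
        refine mul_le_mul_of_nonneg_right (Real.exp_le_exp.2 ?_) (hpos b).le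
        rw [div_mul_eq_mul_div, ← mul_div_assoc']
        exact mul_le_mul_of_nonneg_left hab hDK

/-- Bounded distortion: `log (s * F')` has derivative `F'' / F'`, which is continuous and periodic
because `F` is `C²`. -/
theorem exists_weight_le (h : IsCoveringLift F G s N) (hF : ContDiff ℝ 2 F) :
    ∃ D, 0 ≤ D ∧ ∀ x y, s / deriv F x ≤ Real.exp (D * |x - y|) * (s / deriv F y) := by
  have hF' : ContDiff ℝ 1 (deriv F) := (contDiff_succ_iff_deriv (n := 1)).1 hF |>.2.2
  have hd : ∀ x, HasDerivAt (fun x => Real.log (s * deriv F x))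
      (s * deriv (deriv F) x / (s * deriv F x)) x := fun x =>
    (((hF'.differentiable one_ne_zero x).hasDerivAt).const_mul s).log (h.pos x).ne'
  have hcont : Continuous fun x => s * deriv (deriv F) x / (s * deriv F x) :=
    ((hF'.continuous_deriv le_rfl).const_mul s).div (h.continuous_deriv.const_mul s)
      fun x => (h.pos x).ne'
  have hper : Function.Periodic (fun x => s * deriv (deriv F) x / (s * deriv F x)) 1 := fun x => by
    simp only [h.deriv_periodic x, h.deriv_periodic.deriv x]
  obtain ⟨D, hD0, hD⟩ := hper.exists_norm_le hcont
  refine ⟨D, hD0.le, fun x y => ?_⟩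
  have h1 := Convex.norm_image_sub_le_of_norm_deriv_le (s := Set.univ) (C := D)
    (x := x) (y := y) (fun z _ => (hd z).differentiableAt) (fun z _ => by
      rw [(hd z).deriv]; exact hD z) convex_univ trivial trivial
  have h2 : Real.log (s * deriv F y) ≤ D * |x - y| + Real.log (s * deriv F x) := by
    have := (le_abs_self _).trans h1
    rw [Real.norm_eq_abs, abs_sub_comm] at this
    linarith
  have h3 := Real.exp_le_exp.2 h2
  rw [Real.exp_add, Real.exp_log (h.pos x), Real.exp_log (h.pos y)] at h3
  have hw : ∀ x, s / deriv F x = (s * deriv F x)⁻¹ := fun x => by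
    rw [mul_inv, div_eq_mul_inv, inv_eq_of_mul_eq_one_left h.sign_sq]
  rw [hw, hw, inv_le_iff_one_le_mul₀ (h.pos x)]
  have h4 := h.pos y
  have : Real.exp (D * |x - y|) * (s * deriv F y)⁻¹ * (s * deriv F x) =
    (Real.exp (D * |x - y|) * (s * deriv F x)) / (s * deriv F y) := by ring
  rw [this, le_div_iff₀ h4, one_mul]
  exact h3

end IsCoveringLift

namespace IsCoveringLift

variable {F G : ℝ → ℝ} {s : ℝ} {N : ℕ}

theorem transfer_iterate_linear (F G : ℝ → ℝ) (s : ℝ) (N : ℕ) (a b : ℝ) (f g : ℝ → ℝ) (n : ℕ) :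
    (transfer F G s N)^[n] (fun x => a * f x + b * g x) =
      fun x => a * (transfer F G s N)^[n] f x + b * (transfer F G s N)^[n] g x := by
  induction n with
  | zero => rfl
  | succ n ih =>
    simp only [Function.iterate_succ_apply', ih]
    funext x
    simp only [transfer, branchSum, Finset.mul_sum, ← Finset.sum_add_distrib]
    exact Finset.sum_congr rfl fun k _ => by ring

/-- A Doeblin argument. The image of a normalized `f` in the cone is `ε + (1 - ε) f'` with `f'`
again normalized and in the cone. The common `ε` cancels in differences, so each step gains a factor
`1 - ε`. -/
theorem transfer_iterate_contract (h : IsCoveringLift F G s N) {K K' : ℝ} (hK' : 0 ≤ K')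
    (hK : K' < K)
    (hP : ∀ f, LogLipschitz K f → LogLipschitz K' (transfer F G s N f)) :
    ∃ q, 0 ≤ q ∧ q < 1 ∧ ∀ f g, LogLipschitz K f → LogLipschitz K g →
      ∫ x in (0 : ℝ)..1, f x = 1 → ∫ x in (0 : ℝ)..1, g x = 1 → ∀ n x,
        |(transfer F G s N)^[n] f x - (transfer F G s N)^[n] g x| ≤ Real.exp K * q ^ n := by
  have hK0 : 0 < K := hK'.trans_lt hK
  obtain ⟨ε, hε⟩ : ∃ ε, ε = (K - K') / (K * Real.exp (2 * K)) := ⟨_, rfl⟩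
  have hε0 : 0 < ε := by rw [hε]; have := sub_pos.2 hK; positivity
  have hε1 : ε < 1 := by
    have h2 : 1 < Real.exp (2 * K) := Real.one_lt_exp_iff.2 (by linarith)
    rw [hε, div_lt_one (by positivity)]
    nlinarith
  have hq : 0 < 1 - ε := by linarith
  have step : ∀ f, LogLipschitz K f → ∫ x in (0 : ℝ)..1, f x = 1 →
      ∃ f', LogLipschitz K f' ∧ ∫ x in (0 : ℝ)..1, f' x = 1 ∧
        ∀ x, transfer F G s N f x = ε + (1 - ε) * f' x := fun f hf hf1 => by
    have h1 : ∫ x in (0 : ℝ)..1, transfer F G s N f x = 1 := by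
      rw [h.integral_transfer hf.periodic (hf.continuous hK0.le), hf1]
    refine ⟨fun x => (1 - ε)⁻¹ * (transfer F G s N f x - ε),
      ((hP f hf).sub_const hK' hK h1 hε).const_mul (inv_pos.2 hq), ?_, fun x => ?_⟩
    · rw [intervalIntegral.integral_const_mul, intervalIntegral.integral_sub
        (((hP f hf).continuous hK').intervalIntegrable _ _) (by simp), h1]
      simp [hq.ne']
    · field_simp
      ring
  have main : ∀ n, ∀ f g, LogLipschitz K f → LogLipschitz K g →
      ∫ x in (0 : ℝ)..1, f x = 1 → ∫ x in (0 : ℝ)..1, g x = 1 →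
      ∃ f' g', LogLipschitz K f' ∧ LogLipschitz K g' ∧
        ∫ x in (0 : ℝ)..1, f' x = 1 ∧ ∫ x in (0 : ℝ)..1, g' x = 1 ∧
        ∀ x, (transfer F G s N)^[n] f x - (transfer F G s N)^[n] g x =
          (1 - ε) ^ n * (f' x - g' x) := fun n => by
    induction n with
    | zero => exact fun f g hf hg hf1 hg1 => ⟨f, g, hf, hg, hf1, hg1, fun x => by simp⟩
    | succ n ih =>
      intro f g hf hg hf1 hg1
      obtain ⟨f₁, hf₁, hf₁1, hfe⟩ := step f hf hf1
      obtain ⟨g₁, hg₁, hg₁1, hge⟩ := step g hg hg1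
      obtain ⟨f₂, g₂, hf₂, hg₂, hf₂1, hg₂1, he⟩ := ih f₁ g₁ hf₁ hg₁ hf₁1 hg₁1
      refine ⟨f₂, g₂, hf₂, hg₂, hf₂1, hg₂1, fun x => ?_⟩
      -- Both images are written with the same multiple of `1`, whose later iterates cancel by
      -- linearity.
      have e1 : transfer F G s N f = fun x => ε * (fun _ => (1 : ℝ)) x + (1 - ε) * f₁ x :=
        funext fun x => by rw [hfe, mul_one]
      have e2 : transfer F G s N g = fun x => ε * (fun _ => (1 : ℝ)) x + (1 - ε) * g₁ x :=
        funext fun x => by rw [hge, mul_one]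
      rw [Function.iterate_succ_apply, Function.iterate_succ_apply, e1, e2,
        transfer_iterate_linear, transfer_iterate_linear, pow_succ]
      linear_combination (1 - ε) * he x
  refine ⟨1 - ε, hq.le, by linarith, fun f g hf hg hf1 hg1 n x => ?_⟩
  obtain ⟨f', g', hf', hg', hf'1, hg'1, he⟩ := main n f g hf hg hf1 hg1
  rw [he, abs_mul, abs_of_nonneg (pow_nonneg hq.le n), mul_comm]
  refine mul_le_mul_of_nonneg_right (abs_sub_le_iff.2 ⟨?_, ?_⟩) (pow_nonneg hq.le n)
  · linarith [hf'.le_of_integral_eq_one hK0.le hf'1 x, (hg'.pos x)]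
  · linarith [hg'.le_of_integral_eq_one hK0.le hg'1 x, (hf'.pos x)]

/-- An expanding covering lift of class `C²` has a log-Lipschitz invariant density, to which the
iterates of the transfer operator converge. -/
theorem exists_invariant_density (h : IsCoveringLift F G s N) (hN : 0 < N) {m : ℝ} (hm : 1 < m)
    (hFm : ∀ x, m ≤ |deriv F x|) (hF : ContDiff ℝ 2 F) :
    ∃ K ρ, 0 ≤ K ∧ LogLipschitz K ρ ∧ ∫ x in (0 : ℝ)..1, ρ x = 1 ∧ transfer F G s N ρ = ρ ∧
      ∀ g ℓ, Function.Periodic g 1 → (∀ x y, |g x - g y| ≤ ℓ * |x - y|) → ∃ C q, 0 ≤ q ∧ q < 1 ∧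
        ∀ n x, |(transfer F G s N)^[n] g x - (∫ x in (0 : ℝ)..1, g x) * ρ x| ≤ C * q ^ n := by
  obtain ⟨D, hD0, hD⟩ := h.exists_weight_le hF
  -- Any `K` with `K (m - 1) > D` gives `(K + D) / m < K`, so that the cone is strictly contracted.
  set K := (D + 1) / (m - 1) with hKdef
  have hm1 : 0 < m - 1 := by linarith
  have hK0 : 0 < K := by positivity
  have hKm : K * (m - 1) = D + 1 := by rw [hKdef]; field_simp
  have hK'0 : 0 ≤ (K + D) / m := by positivity
  have hK' : (K + D) / m < K := by
    rw [div_lt_iff₀ (by linarith)]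
    linarith
  have hP : ∀ f, LogLipschitz K f → LogLipschitz ((K + D) / m) (transfer F G s N f) := fun f hf =>
    h.transfer_logLipschitz hN (by linarith) hFm (by positivity) hD hf
  obtain ⟨q, hq0, hq1, hq⟩ := h.transfer_iterate_contract hK'0 hK' hP
  set P := transfer F G s N
  have hcone : ∀ f, LogLipschitz K f → ∫ x in (0 : ℝ)..1, f x = 1 → ∀ n,
      LogLipschitz K (P^[n] f) ∧ ∫ x in (0 : ℝ)..1, P^[n] f x = 1 := fun f hf hf1 n => by
    induction n with
    | zero => exact ⟨hf, hf1⟩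
    | succ n ih =>
      rw [Function.iterate_succ_apply']
      exact ⟨(hP _ ih.1).mono hK'.le, by
        rw [h.integral_transfer ih.1.periodic (ih.1.continuous hK0.le), ih.2]⟩
  have h1 : LogLipschitz K fun _ => (1 : ℝ) := LogLipschitz.const one_pos hK0.le
  have h1' : ∫ x in (0 : ℝ)..1, (fun _ => (1 : ℝ)) x = 1 := by simp
  -- Consecutive iterates of `1` are the `n`-th iterates of `1` and of its image, two normalized
  -- elements of the cone; hence they form a Cauchy sequence.
  have hstep : ∀ x n, dist (P^[n] (fun _ => 1) x) (P^[n + 1] (fun _ => 1) x) ≤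
      Real.exp K * q ^ n := fun x n => by
    rw [Function.iterate_succ_apply, Real.dist_eq]
    exact hq _ _ h1 (hcone _ h1 h1' 1).1 h1' (hcone _ h1 h1' 1).2 n x
  have hlim : ∀ x, ∃ l, Tendsto (fun n => P^[n] (fun _ => 1) x) atTop (𝓝 l) := fun x =>
    cauchySeq_tendsto_of_complete (cauchySeq_of_le_geometric q _ hq1 (hstep x))
  choose ρ hρ using hlim
  have hρpos : ∀ x, Real.exp (-K) ≤ ρ x := fun x => ge_of_tendsto' (hρ x) fun n =>
    (hcone _ h1 h1' n).1.le_of_integral_eq_one' hK0.le (hcone _ h1 h1' n).2 x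
  have hρL : LogLipschitz K ρ := ⟨fun x => (Real.exp_pos _).trans_le (hρpos x), fun x => by
      refine tendsto_nhds_unique (hρ (x + 1)) ?_
      simp only [(hcone _ h1 h1' _).1.periodic x]
      exact hρ x, fun x y => le_of_tendsto_of_tendsto' (hρ x) ((hρ y).const_mul _) fun n =>
      (hcone _ h1 h1' n).1.le x y⟩
  have hρ1 : ∫ x in (0 : ℝ)..1, ρ x = 1 := by
    have := intervalIntegral.tendsto_integral_filter_of_dominated_convergence (μ := volume)
      (a := 0) (b := 1) (l := atTop) (F := fun n => P^[n] fun _ => 1) (f := ρ)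
      (fun _ => Real.exp K)
      (Eventually.of_forall fun n =>
        ((hcone _ h1 h1' n).1.continuous hK0.le).aestronglyMeasurable)
      (Eventually.of_forall fun n => Eventually.of_forall fun x _ => by
        rw [Real.norm_of_nonneg ((hcone _ h1 h1' n).1.pos x).le]
        exact (hcone _ h1 h1' n).1.le_of_integral_eq_one hK0.le (hcone _ h1 h1' n).2 x)
      (by simp) (Eventually.of_forall fun x _ => hρ x)
    simp only [(hcone _ h1 h1' _).2] at this
    exact (tendsto_nhds_unique this tendsto_const_nhds)
  have hinv : P ρ = ρ := funext fun x => by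
    refine tendsto_nhds_unique ?_ ((tendsto_add_atTop_iff_nat 1).2 (hρ x))
    simp only [Function.iterate_succ_apply']
    change Tendsto (fun n => ∑ k ∈ Finset.range N,
      P^[n] (fun _ => 1) (G (x + k)) * (s / deriv F (G (x + k)))) atTop
      (𝓝 (∑ k ∈ Finset.range N, ρ (G (x + k)) * (s / deriv F (G (x + k)))))
    exact tendsto_finsetSum _ fun k _ => (hρ _).mul_const _
  have hiter : ∀ n, P^[n] ρ = ρ := fun n => Function.iterate_fixed hinv n
  refine ⟨K, ρ, hK0.le, hρL, hρ1, hinv, fun g ℓ hg hℓ => ?_⟩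
  have hℓ0 : 0 ≤ ℓ := by simpa using (abs_nonneg _).trans (hℓ 1 0)
  have hgc : Continuous g :=
    (LipschitzWith.of_dist_le_mul (K := ⟨ℓ, hℓ0⟩) fun x y => hℓ x y).continuous
  obtain ⟨B, hB0, hB⟩ := hg.exists_norm_le hgc
  -- Adding `A` puts `g` into the cone, since then `ℓ ≤ K (g + A)`. The contraction applies to the
  -- normalized `g + A` and to `1`, and `g` is recovered by linearity.
  set A := B + ℓ / K + 1 with hA
  have hgA : ∀ x, ℓ / K + 1 ≤ g x + A := fun x => by linarith [neg_abs_le (g x), hB x, Real.norm_eq_abs (g x)]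
  have hℓK : 0 ≤ ℓ / K := by positivity
  have hfL : LogLipschitz K fun x => g x + A := by
    refine ⟨fun x => by linarith [hgA x], fun x => by simp only [hg x], fun x y => ?_⟩
    have h2 := Real.add_one_le_exp (K * |x - y|)
    have h3 : ℓ ≤ K * (g y + A) := by
      have := mul_le_mul_of_nonneg_left (hgA y) hK0.le
      rw [mul_add, mul_div_cancel₀ _ hK0.ne'] at this
      linarith
    have h4 := mul_le_mul_of_nonneg_right h3 (abs_nonneg (x - y))
    have h5 := mul_le_mul_of_nonneg_right h2 (show 0 ≤ g y + A by linarith [hgA y])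
    linarith [(le_abs_self _).trans (hℓ x y)]
  set I := ∫ x in (0 : ℝ)..1, (g x + A)
  have hIe : I = (∫ x in (0 : ℝ)..1, g x) + A := by
    simp only [I]
    rw [intervalIntegral.integral_add (hgc.intervalIntegrable _ _) (by simp)]
    simp
  have hI : 0 < I := intervalIntegral.intervalIntegral_pos_of_pos
    ((hfL.continuous hK0.le).intervalIntegrable _ _) hfL.pos one_pos
  have hfI := hfL.const_mul (inv_pos.2 hI)
  have hfI1 : ∫ x in (0 : ℝ)..1, I⁻¹ * (g x + A) = 1 := by
    rw [intervalIntegral.integral_const_mul]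
    exact inv_mul_cancel₀ hI.ne'
  refine ⟨I * Real.exp K + A * Real.exp K, q, hq0, hq1, fun n x => ?_⟩
  have e1 := hq _ _ hfI hρL hfI1 hρ1 n x
  have e2 := hq _ _ h1 hρL h1' hρ1 n x
  rw [hiter] at e1 e2
  have e3 : g = fun x => I * (fun x => I⁻¹ * (g x + A)) x + (-A) * (fun _ => (1 : ℝ)) x := by
    funext x
    field_simp
    ring
  have e4 : P^[n] g x = I * P^[n] (fun x => I⁻¹ * (g x + A)) x + -A * P^[n] (fun _ => 1) x := by
    conv_lhs => rw [e3]
    exact congrFun (transfer_iterate_linear F G s N I (-A) _ _ n) x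
  have e5 : P^[n] g x - (∫ x in (0 : ℝ)..1, g x) * ρ x =
      I * (P^[n] (fun x => I⁻¹ * (g x + A)) x - ρ x) - A * (P^[n] (fun _ => 1) x - ρ x) := by
    rw [e4, eq_sub_of_add_eq hIe.symm]
    ring
  rw [e5]
  refine (abs_sub _ _).trans ?_
  have hA0 : 0 < A := by positivity
  rw [abs_mul, abs_mul, abs_of_pos hI, abs_of_pos hA0]
  have := mul_le_mul_of_nonneg_left e1 hI.le
  have := mul_le_mul_of_nonneg_left e2 hA0.le
  linarith

end IsCoveringLift

/-! ### Identification of the absolutely continuous invariant measure -/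

theorem norm_coe_unitAddCircle_le (r : ℝ) : ‖(r : UnitAddCircle)‖ ≤ |r| :=
  QuotientAddGroup.norm_mk_le_norm

theorem dist_coe_unitAddCircle_le (a b : ℝ) : dist (a : UnitAddCircle) b ≤ |a - b| := by
  rw [dist_eq_norm, ← AddCircle.coe_sub]
  exact norm_coe_unitAddCircle_le _

theorem volume_singleton_unitAddCircle (x : UnitAddCircle) :
    (volume : Measure UnitAddCircle) {x} = 0 := by
  have := AddCircle.volume_closedBall (T := 1) (x := x) 0
  simpa using this

instance isProbabilityMeasure_volume_unitAddCircle :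
    IsProbabilityMeasure (volume : Measure UnitAddCircle) :=
  ⟨by simp⟩

/-- The integral of a function on the circle against a measure with a continuous density. -/
theorem integral_withDensity_unitAddCircle {ρ : C(UnitAddCircle, ℝ)} (hρ : ∀ x, 0 < ρ x)
    (f : UnitAddCircle → ℝ) :
    ∫ x, f x ∂(volume.withDensity fun x => ENNReal.ofReal (ρ x)) =
      ∫ x in (0 : ℝ)..1, f (x : UnitAddCircle) * ρ (x : UnitAddCircle) := by
  rw [integral_withDensity_eq_integral_toReal_smul (by fun_prop) (by simp)]
  have := UnitAddCircle.intervalIntegral_preimage 0 fun x => f x * ρ x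
  rw [zero_add] at this
  rw [this]
  congr with x
  rw [ENNReal.toReal_ofReal (hρ x).le, smul_eq_mul, mul_comm]

theorem uniformContinuous_of_periodic {g : ℝ → ℝ} (hg : Function.Periodic g 1)
    (hc : Continuous g) : UniformContinuous g := by
  obtain ⟨c, hc'⟩ := exists_continuousMap_of_periodic hg hc
  have h1 := CompactSpace.uniformContinuous_of_continuous c.continuous
  have h2 : LipschitzWith 1 fun x : ℝ => (x : UnitAddCircle) :=
    LipschitzWith.of_dist_le_mul fun x y => by
      simpa [Real.dist_eq] using dist_coe_unitAddCircle_le x y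
  rw [show g = c ∘ fun x : ℝ => (x : UnitAddCircle) from funext fun x => (hc' x).symm]
  exact h1.comp h2.uniformContinuous

/-- The average over a window `[x, x + r]` has derivative `(g (x + r) - g x) / r`, which is bounded,
and is uniformly close to `g` for small `r`. -/
theorem exists_lipschitz_periodic_approx {g : ℝ → ℝ} (hg : Function.Periodic g 1)
    (hc : Continuous g) {δ : ℝ} (hδ : 0 < δ) :
    ∃ f ℓ, Function.Periodic f 1 ∧ (∀ x y, |f x - f y| ≤ ℓ * |x - y|) ∧
      ∀ x, |g x - f x| ≤ δ := by
  obtain ⟨B, -, hB⟩ := hg.exists_norm_le hc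
  obtain ⟨η, hη0, hη⟩ := Metric.uniformContinuous_iff.1 (uniformContinuous_of_periodic hg hc) δ hδ
  set r := η / 2
  have hr : 0 < r := by positivity
  have hd : ∀ x, HasDerivAt (fun x => r⁻¹ * ∫ u in x..x + r, g u) (r⁻¹ * (g (x + r) - g x)) x := by
    intro x
    have h1 := (hc.integral_hasStrictDerivAt 0 x).hasDerivAt
    have h2 := ((hc.integral_hasStrictDerivAt 0 (x + r)).hasDerivAt).comp_add_const x r
    have h3 : (fun x => r⁻¹ * ∫ u in x..x + r, g u) =
        fun x => r⁻¹ * ((∫ u in (0 : ℝ)..x + r, g u) - ∫ u in (0 : ℝ)..x, g u) := funext fun x => by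
      rw [intervalIntegral.integral_interval_sub_left (hc.intervalIntegrable _ _)
        (hc.intervalIntegrable _ _)]
    rw [h3]
    exact (h2.sub h1).const_mul r⁻¹
  refine ⟨fun x => r⁻¹ * ∫ u in x..x + r, g u, r⁻¹ * (B + B), fun x => ?_, fun x y => ?_,
    fun x => ?_⟩
  · have := intervalIntegral.integral_comp_add_right (a := x) (b := x + r) g 1
    simp only [hg _] at this
    change r⁻¹ * ∫ u in x + 1..x + 1 + r, g u = r⁻¹ * ∫ u in x..x + r, g u
    rw [this, add_right_comm]
  · exact Convex.norm_image_sub_le_of_norm_deriv_le (s := Set.univ) (x := y) (y := x)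
      (fun z _ => (hd z).differentiableAt) (fun z _ => by
        rw [(hd z).deriv, norm_mul, Real.norm_of_nonneg (inv_pos.2 hr).le]
        exact mul_le_mul_of_nonneg_left ((norm_sub_le _ _).trans (add_le_add (hB _) (hB _)))
          (inv_pos.2 hr).le) convex_univ trivial trivial
  · have h1 : g x - r⁻¹ * ∫ u in x..x + r, g u = r⁻¹ * ∫ u in x..x + r, (g x - g u) := by
      rw [intervalIntegral.integral_sub (by simp) (hc.intervalIntegrable _ _)]
      simp
      field_simp
    have h2 : ‖∫ u in x..x + r, (g x - g u)‖ ≤ δ * |x + r - x| :=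
      intervalIntegral.norm_integral_le_of_norm_le_const fun u hu => by
        rw [Set.uIoc_of_le (by linarith)] at hu
        refine (hη ?_).le
        rw [Real.dist_eq, abs_sub_comm, abs_lt]
        constructor <;> linarith [hu.1, hu.2, show r = η / 2 from rfl]
    rw [h1, abs_mul, abs_of_pos (inv_pos.2 hr), inv_mul_le_iff₀ hr, mul_comm r]
    simpa [abs_of_pos hr] using h2

namespace IsCoveringLift

variable {F G : ℝ → ℝ} {s : ℝ} {N : ℕ}

theorem integral_iterate_comp_mul (h : IsCoveringLift F G s N) {φ : ℝ → ℝ}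
    (hφ : Function.Periodic φ 1) (hφc : Continuous φ) (n : ℕ) : ∀ g : ℝ → ℝ,
    Function.Periodic g 1 → Continuous g →
    ∫ y in (0 : ℝ)..1, φ (F^[n] y) * g y =
      ∫ x in (0 : ℝ)..1, φ x * (transfer F G s N)^[n] g x := by
  have hper : ∀ n, Function.Periodic (fun y => φ (F^[n] y)) 1 := fun n => by
    induction n with
    | zero => exact hφ
    | succ n ih => exact h.periodic_comp ih
  have hcont : ∀ n, Continuous (fun y => φ (F^[n] y)) := fun n =>
    hφc.comp (h.contDiff.continuous.iterate n)
  induction n with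
  | zero => exact fun g _ _ => rfl
  | succ n ih =>
    intro g hg hgc
    rw [Function.iterate_succ_apply, ← ih _ (h.transfer_periodic hg)
      (h.transfer_continuous hgc)]
    exact h.integral_comp_mul (hper n) (hcont n) hg hgc

theorem coe_iterate {Φ : UnitAddCircle → UnitAddCircle}
    (hΦ : ∀ x : ℝ, Φ (x : UnitAddCircle) = (F x : UnitAddCircle)) (n : ℕ) (x : ℝ) :
    Φ^[n] (x : UnitAddCircle) = (F^[n] x : UnitAddCircle) := by
  induction n generalizing x with
  | zero => rfl
  | succ n ih => rw [Function.iterate_succ_apply, hΦ, ih, Function.iterate_succ_apply]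

theorem continuous_of_lift (h : IsCoveringLift F G s N) {Φ : UnitAddCircle → UnitAddCircle}
    (hΦ : ∀ x : ℝ, Φ (x : UnitAddCircle) = (F x : UnitAddCircle)) : Continuous Φ :=
  continuous_coinduced_dom.2 (by
    have : Φ ∘ (QuotientAddGroup.mk : ℝ → UnitAddCircle) = fun x => (F x : UnitAddCircle) :=
      funext hΦ
    change Continuous (Φ ∘ (QuotientAddGroup.mk : ℝ → UnitAddCircle))
    rw [this]
    exact (AddCircle.continuous_mk' 1).comp h.contDiff.continuous)

/-- If the iterates of the transfer operator, applied to Lipschitz functions, converge to multiples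
of `ρ`, then `ρ` is the density of every absolutely continuous invariant probability measure. -/
theorem eq_withDensity_of_invariant (h : IsCoveringLift F G s N)
    {Φ : UnitAddCircle → UnitAddCircle}
    (hΦ : ∀ x : ℝ, Φ (x : UnitAddCircle) = (F x : UnitAddCircle)) {ρ : C(UnitAddCircle, ℝ)}
    (hρ : ∀ x, 0 < ρ x) (hρ1 : ∫ x in (0 : ℝ)..1, ρ (x : UnitAddCircle) = 1)
    (hconv : ∀ g ℓ, Function.Periodic g 1 → (∀ x y, |g x - g y| ≤ ℓ * |x - y|) →
      ∃ C q, 0 ≤ q ∧ q < 1 ∧ ∀ n (x : ℝ), |(transfer F G s N)^[n] g x -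
        (∫ x in (0 : ℝ)..1, g x) * ρ (x : UnitAddCircle)| ≤ C * q ^ n)
    {μ : Measure UnitAddCircle} [IsProbabilityMeasure μ]
    (hac : μ ≪ (volume : Measure UnitAddCircle)) (hinv : μ.map Φ = μ) :
    μ = volume.withDensity fun x => ENNReal.ofReal (ρ x) := by
  have hΦc := h.continuous_of_lift hΦ
  have : IsFiniteMeasure (volume.withDensity fun x => ENNReal.ofReal (ρ x)) :=
    isFiniteMeasure_withDensity_ofReal (ρ.continuous.integrable_of_hasCompactSupport
      (HasCompactSupport.of_compactSpace _)).2
  refine ext_of_forall_integral_eq_of_IsFiniteMeasure fun φ => ?_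
  rw [integral_withDensity_unitAddCircle hρ]
  obtain ⟨B, hB0, hB⟩ : ∃ B, 0 < B ∧ ∀ x, ‖φ x‖ ≤ B :=
    ⟨‖φ‖ + 1, by positivity, fun x => (φ.norm_coe_le_norm x).trans (by linarith)⟩
  set w : UnitAddCircle → ℝ := fun x => (μ.rnDeriv volume x).toReal
  have hw : Integrable w := Measure.integrable_toReal_rnDeriv
  -- Invariance allows `φ` to be replaced by `φ ∘ Φ^[n]`, whose duality with the transfer operator
  -- brings in the convergence to `ρ`.
  have hiter : ∀ n, ∫ x, φ (Φ^[n] x) ∂μ = ∫ x, φ x ∂μ := fun n => by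
    have hmap : μ.map Φ^[n] = μ :=
      ((MeasurePreserving.mk hΦc.measurable hinv).iterate n).map_eq
    conv_rhs => rw [← hmap]
    rw [integral_map (hΦc.iterate n).aemeasurable φ.continuous.aestronglyMeasurable]
  have hint : ∀ f : UnitAddCircle → ℝ, ∫ x, f x ∂μ = ∫ x, w x * f x := fun f =>
    (integral_rnDeriv_smul hac).symm
  set J := ∫ x in (0 : ℝ)..1, φ (x : UnitAddCircle) * ρ (x : UnitAddCircle)
  have hcoe : Continuous fun x : ℝ => (x : UnitAddCircle) := AddCircle.continuous_mk' 1
  have hφρ : |J| ≤ B := by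
    have h1 : ‖J‖ ≤ ∫ x in (0 : ℝ)..1, B * ρ (x : UnitAddCircle) :=
      intervalIntegral.norm_integral_le_of_norm_le zero_le_one (Eventually.of_forall fun x _ => by
        rw [norm_mul, Real.norm_of_nonneg (hρ _).le]
        exact mul_le_mul_of_nonneg_right (hB _) (hρ _).le)
        ((continuous_const.mul (ρ.continuous.comp hcoe)).intervalIntegrable _ _)
    rwa [intervalIntegral.integral_const_mul, hρ1, mul_one] at h1
  have key : ∀ δ > 0, |∫ x, φ x ∂μ - J| ≤ 4 * B * δ := fun δ hδ => by
    -- The density `w` is only integrable: it is approximated in `L¹` by a continuous function, then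
    -- uniformly by a Lipschitz one, with total error `2 * δ`.
    obtain ⟨g₀, hg₀, -⟩ := hw.exists_boundedContinuous_integral_sub_le hδ
    obtain ⟨g₁, ℓ, hper, hlip, happ⟩ := exists_lipschitz_periodic_approx
      (periodic_comp_coe g₀) (g₀.continuous.comp hcoe) hδ
    have hℓ0 : 0 ≤ ℓ := by simpa using (abs_nonneg _).trans (hlip 1 0)
    have hg₁c : Continuous g₁ :=
      (LipschitzWith.of_dist_le_mul (K := ⟨ℓ, hℓ0⟩) fun x y => hlip x y).continuous
    obtain ⟨g, hg⟩ := exists_continuousMap_of_periodic hper hg₁c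
    have hgi : Integrable (fun x => g x) (volume : Measure UnitAddCircle) :=
      g.continuous.integrable_of_hasCompactSupport (HasCompactSupport.of_compactSpace _)
    have hg₀i : Integrable (fun x => g₀ x) (volume : Measure UnitAddCircle) :=
      g₀.continuous.integrable_of_hasCompactSupport (HasCompactSupport.of_compactSpace _)
    have hgw : ∫ x, ‖w x - g x‖ ≤ 2 * δ := by
      have h1 : ∀ x, ‖g₀ x - g x‖ ≤ δ := fun x => by
        obtain ⟨z, rfl⟩ := QuotientAddGroup.mk_surjective x
        rw [hg]
        exact happ z
      calc ∫ x, ‖w x - g x‖ ≤ ∫ x, (‖w x - g₀ x‖ + δ) :=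
            integral_mono (hw.sub hgi).norm ((hw.sub hg₀i).norm.add (integrable_const _))
              fun x => (norm_sub_le_norm_sub_add_norm_sub _ (g₀ x) _).trans
                (by simpa using h1 x)
        _ ≤ 2 * δ := by
            rw [integral_add (f := fun x => ‖w x - g₀ x‖) (hw.sub hg₀i).norm (integrable_const _),
              integral_const, probReal_univ, one_smul]
            linarith
    have hbound : ∀ f : UnitAddCircle → ℝ, Continuous f → (∀ x, ‖f x‖ ≤ B) →
        |(∫ x, w x * f x) - ∫ x, g x * f x| ≤ B * (2 * δ) := fun f hf hfB => by
      rw [← integral_sub (hw.mul_bdd (c := B) hf.aestronglyMeasurable (Eventually.of_forall hfB))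
        (hgi.mul_bdd (c := B) hf.aestronglyMeasurable (Eventually.of_forall hfB))]
      rw [← Real.norm_eq_abs]
      refine (norm_integral_le_integral_norm _).trans ?_
      refine le_trans ?_ (mul_le_mul_of_nonneg_left hgw hB0.le)
      rw [← integral_const_mul]
      refine integral_mono_of_nonneg (Eventually.of_forall fun x => norm_nonneg _)
        ((hw.sub hgi).norm.const_mul _) (Eventually.of_forall fun x => ?_)
      simp only
      rw [← sub_mul, norm_mul, mul_comm]
      exact mul_le_mul_of_nonneg_right (hfB x) (norm_nonneg _)
    -- The error of replacing `w` by `g₁` is uniform in `n`, because `φ ∘ Φ^[n]` keeps the bound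
    -- `B`.
    have h1 : ∀ n, |∫ x, φ x ∂μ - ∫ x in (0 : ℝ)..1,
        φ (x : UnitAddCircle) * (transfer F G s N)^[n] g₁ x| ≤ B * (2 * δ) := fun n => by
      have h2 := hbound (fun x => φ (Φ^[n] x)) (φ.continuous.comp (hΦc.iterate n))
        fun x => hB _
      have h3 := UnitAddCircle.intervalIntegral_preimage 0 fun x => g x * φ (Φ^[n] x)
      rw [zero_add] at h3
      rw [← hint, hiter, ← h3] at h2
      rw [← h.integral_iterate_comp_mul (φ := fun x => φ (x : UnitAddCircle))
        (periodic_comp_coe _) (φ.continuous.comp hcoe) n g₁ hper hg₁c]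
      simpa only [coe_iterate hΦ, hg, mul_comm] using h2
    obtain ⟨C, q, hq0, hq1, hCq⟩ := hconv g₁ ℓ hper hlip
    have h2 : ∀ n, |∫ x, φ x ∂μ - (∫ x in (0 : ℝ)..1, g₁ x) * J| ≤
        B * (2 * δ) + B * (C * q ^ n) := fun n => by
      have hPc : Continuous ((transfer F G s N)^[n] g₁) := by
        have : ∀ n, Continuous ((transfer F G s N)^[n] g₁) := fun n => by
          induction n with
          | zero => exact hg₁c
          | succ n ih =>
            rw [Function.iterate_succ_apply']
            exact h.transfer_continuous ih
        exact this n
      have hφc : Continuous fun x : ℝ => φ (x : UnitAddCircle) := φ.continuous.comp hcoe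
      have hρc : Continuous fun x : ℝ => ρ (x : UnitAddCircle) := ρ.continuous.comp hcoe
      have h3 : |(∫ x in (0 : ℝ)..1, φ (x : UnitAddCircle) * (transfer F G s N)^[n] g₁ x) -
          (∫ x in (0 : ℝ)..1, g₁ x) * J| ≤ B * (C * q ^ n) := by
        simp only [J]
        have i1 : IntervalIntegrable (fun x : ℝ => φ (x : UnitAddCircle) *
            (transfer F G s N)^[n] g₁ x) volume 0 1 := (hφc.mul hPc).intervalIntegrable _ _
        have i2 : IntervalIntegrable (fun x : ℝ => (∫ x in (0 : ℝ)..1, g₁ x) *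
            (φ (x : UnitAddCircle) * ρ (x : UnitAddCircle))) volume 0 1 :=
          (continuous_const.mul (hφc.mul hρc)).intervalIntegrable _ _
        rw [← intervalIntegral.integral_const_mul, ← intervalIntegral.integral_sub i1 i2]
        have := intervalIntegral.norm_integral_le_of_norm_le_const (a := 0) (b := 1)
          (f := fun x : ℝ => φ (x : UnitAddCircle) * (transfer F G s N)^[n] g₁ x -
            (∫ x in (0 : ℝ)..1, g₁ x) * (φ (x : UnitAddCircle) * ρ (x : UnitAddCircle)))
          (C := B * (C * q ^ n)) fun x _ => by
            rw [mul_left_comm, ← mul_sub, norm_mul]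
            exact mul_le_mul (hB _) (hCq n x) (norm_nonneg _) hB0.le
        simpa using this
      exact (abs_sub_le _ _ _).trans (add_le_add (h1 n) h3)
    have h3 : |∫ x, φ x ∂μ - (∫ x in (0 : ℝ)..1, g₁ x) * J| ≤ B * (2 * δ) := by
      have ht : Tendsto (fun n : ℕ => B * (2 * δ) + B * (C * q ^ n)) atTop
          (𝓝 (B * (2 * δ) + B * (C * 0))) :=
        tendsto_const_nhds.add (((tendsto_pow_atTop_nhds_zero_of_lt_one hq0 hq1).const_mul _).const_mul _)
      simpa using ge_of_tendsto' ht h2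
    -- The multiple of `ρ` in the limit is `∫ g₁`, which is close to `∫ w = 1`.
    have h4 : |(∫ x in (0 : ℝ)..1, g₁ x) - 1| ≤ 2 * δ := by
      have e1 : ∫ x in (0 : ℝ)..1, g₁ x = ∫ x, g x := by
        have := UnitAddCircle.intervalIntegral_preimage 0 fun x => g x
        rw [zero_add] at this
        simpa only [hg] using this
      have e2 : ∀ r : ℝ, r - 1 = r - ∫ x, w x := fun r => by
        have := hint fun _ => 1
        rw [← show (1 : ℝ) = ∫ x, w x by simpa using this]
      rw [e1, e2, ← integral_sub hgi hw]
      rw [← Real.norm_eq_abs]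
      refine (norm_integral_le_integral_norm _).trans ?_
      simpa only [norm_sub_rev] using hgw
    calc |∫ x, φ x ∂μ - J| = |(∫ x, φ x ∂μ - (∫ x in (0 : ℝ)..1, g₁ x) * J) +
          ((∫ x in (0 : ℝ)..1, g₁ x) - 1) * J| := by ring_nf
      _ ≤ B * (2 * δ) + (2 * δ) * B := (abs_add_le _ _).trans (add_le_add h3 (by
          rw [abs_mul]
          exact mul_le_mul h4 hφρ (abs_nonneg _) (by positivity)))
      _ = 4 * B * δ := by ring
  by_contra hne
  have hpos : 0 < |∫ x, φ x ∂μ - J| := abs_pos.2 (sub_ne_zero.2 hne)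
  have := key (|∫ x, φ x ∂μ - J| / (8 * B)) (by positivity)
  rw [show 4 * B * (|∫ x, φ x ∂μ - J| / (8 * B)) = |∫ x, φ x ∂μ - J| / 2 by field_simp; norm_num]
    at this
  linarith

end IsCoveringLift

/-! ### The tangent space and zero-mean functions -/

/-- Integration over the circle of continuous functions. -/
noncomputable def integralUnitAddCircle (𝕜 : Type*) [RCLike 𝕜] : C(UnitAddCircle, 𝕜) →L[𝕜] 𝕜 :=
  LinearMap.mkContinuous
    { toFun := fun f => ∫ x, f x
      map_add' := fun f g => by
        simp only [ContinuousMap.add_apply]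
        exact integral_add
          (f.continuous.integrable_of_hasCompactSupport (HasCompactSupport.of_compactSpace _))
          (g.continuous.integrable_of_hasCompactSupport (HasCompactSupport.of_compactSpace _))
      map_smul' := fun a f => by
        simp only [ContinuousMap.smul_apply, integral_smul, RingHom.id_apply] } 1 fun f => by
    have := norm_integral_le_of_norm_le_const (μ := (volume : Measure UnitAddCircle))
      (Eventually.of_forall fun x => f.norm_coe_le_norm x)
    simpa using this

theorem integralUnitAddCircle_apply {𝕜 : Type*} [RCLike 𝕜] (f : C(UnitAddCircle, 𝕜)) :
    integralUnitAddCircle 𝕜 f = ∫ x in (0 : ℝ)..1, f (x : UnitAddCircle) := by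
  have := UnitAddCircle.intervalIntegral_preimage 0 fun x => f x
  rw [zero_add] at this
  rw [this]
  rfl

section Tangent

variable {μ : Measure UnitAddCircle} [IsFiniteMeasure μ]

theorem toLp_mem_tangentL2_of_isSmoothGradient {c : C(UnitAddCircle, ℝ)} (hc : IsSmoothGradient c) :
    ContinuousMap.toLp 2 μ ℝ c ∈ tangentL2 μ :=
  Submodule.le_topologicalClosure _ (Submodule.subset_span ⟨c, hc, ContinuousMap.coeFn_toLp μ c⟩)

theorem integral_eq_zero_of_isSmoothGradient {c : C(UnitAddCircle, ℝ)} (hc : IsSmoothGradient c) :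
    integralUnitAddCircle ℝ c = 0 := by
  obtain ⟨f, hf, hper, hfc⟩ := hc
  rw [integralUnitAddCircle_apply]
  simp only [hfc]
  rw [intervalIntegral.integral_deriv_eq_sub (fun x _ => hf.differentiable (by simp) x)
    ((hf.continuous_deriv (by simp)).intervalIntegrable _ _)]
  have := hper 0
  rw [zero_add] at this
  rw [this, sub_self]

theorem isSmoothGradient_re_fourier {n : ℤ} (hn : n ≠ 0) :
    IsSmoothGradient fun x => (fourier n x : ℂ).re := by
  have hp : 2 * Real.pi * n ≠ 0 := by positivity
  refine ⟨fun x => Real.sin (2 * Real.pi * n * x) / (2 * Real.pi * n), by fun_prop, fun x => ?_,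
    fun x => ?_⟩
  · simp only
    rw [mul_add, mul_one, mul_comm (2 * Real.pi) (n : ℝ), Real.sin_add_int_mul_two_pi]
  · have h1 : HasDerivAt (fun x => Real.sin (2 * Real.pi * n * x) / (2 * Real.pi * n))
        (Real.cos (2 * Real.pi * n * x) * (2 * Real.pi * n * 1) / (2 * Real.pi * n)) x :=
      (((hasDerivAt_id x).const_mul _).sin).div_const _
    simp only
    rw [h1.deriv, fourier_coe_apply, mul_one, mul_div_cancel_right₀ _ hp,
      show 2 * (Real.pi : ℂ) * Complex.I * n * x / (1 : ℝ) =
        ((2 * Real.pi * n * x : ℝ) : ℂ) * Complex.I by push_cast; ring,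
      Complex.exp_ofReal_mul_I_re]

theorem isSmoothGradient_im_fourier {n : ℤ} (hn : n ≠ 0) :
    IsSmoothGradient fun x => (fourier n x : ℂ).im := by
  have hp : 2 * Real.pi * n ≠ 0 := by positivity
  refine ⟨fun x => -Real.cos (2 * Real.pi * n * x) / (2 * Real.pi * n), by fun_prop, fun x => ?_,
    fun x => ?_⟩
  · simp only
    rw [mul_add, mul_one, mul_comm (2 * Real.pi) (n : ℝ), Real.cos_add_int_mul_two_pi]
  · have h1 : HasDerivAt (fun x => -Real.cos (2 * Real.pi * n * x) / (2 * Real.pi * n))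
        (-(-Real.sin (2 * Real.pi * n * x) * (2 * Real.pi * n * 1)) / (2 * Real.pi * n)) x :=
      ((((hasDerivAt_id x).const_mul _).cos).neg).div_const _
    simp only
    rw [h1.deriv, fourier_coe_apply, mul_one, neg_mul, neg_neg, mul_div_cancel_right₀ _ hp,
      show 2 * (Real.pi : ℂ) * Complex.I * n * x / (1 : ℝ) =
        ((2 * Real.pi * n * x : ℝ) : ℂ) * Complex.I by push_cast; ring,
      Complex.exp_ofReal_mul_I_im]

/-- Continuous functions of zero mean are tangent vectors. -/
theorem toLp_mem_tangentL2 {w : C(UnitAddCircle, ℝ)} (hw : integralUnitAddCircle ℝ w = 0) :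
    ContinuousMap.toLp 2 μ ℝ w ∈ tangentL2 μ := by
  -- Centring takes place in the space of continuous functions, where the Lebesgue mean is
  -- continuous. The condition is then closed for uniform convergence, and it suffices to check it
  -- on trigonometric monomials; the constant one is killed.
  let κ : C(UnitAddCircle, ℝ) →L[ℝ] Lp ℝ 2 μ := ContinuousMap.toLp 2 μ ℝ ∘L
    (ContinuousLinearMap.id ℝ _ -
      (integralUnitAddCircle ℝ).smulRight (1 : C(UnitAddCircle, ℝ)))
  have hκ0 : ∀ g, integralUnitAddCircle ℝ g = 0 → κ g = ContinuousMap.toLp 2 μ ℝ g := fun g hg => by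
    simp [κ, hg]
  have hκ1 : κ 1 = 0 := by
    have : integralUnitAddCircle ℝ 1 = 1 := by simp [integralUnitAddCircle_apply]
    simp [κ, this]
  let re : C(UnitAddCircle, ℂ) →L[ℝ] C(UnitAddCircle, ℝ) :=
    Complex.reCLM.compLeftContinuous ℝ UnitAddCircle
  let im : C(UnitAddCircle, ℂ) →L[ℝ] C(UnitAddCircle, ℝ) :=
    Complex.imCLM.compLeftContinuous ℝ UnitAddCircle
  have hT : IsClosed (tangentL2 μ : Set (Lp ℝ 2 μ)) := Submodule.isClosed_topologicalClosure _
  have hclosed : IsClosed {f : C(UnitAddCircle, ℂ) | κ (re f) ∈ tangentL2 μ ∧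
      κ (im f) ∈ tangentL2 μ} :=
    (hT.preimage (κ.continuous.comp re.continuous)).inter
      (hT.preimage (κ.continuous.comp im.continuous))
  have hspan : ∀ f ∈ Submodule.span ℂ (Set.range (fourier (T := 1))),
      κ (re f) ∈ tangentL2 μ ∧ κ (im f) ∈ tangentL2 μ := fun f hf => by
    induction hf using Submodule.span_induction with
    | mem f hf =>
      obtain ⟨n, rfl⟩ := hf
      rcases eq_or_ne n 0 with rfl | hn
      · have h1 : re (fourier 0) = 1 := by ext x; simp [re]
        have h2 : im (fourier 0) = 0 := by ext x; simp [im]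
        rw [h1, h2, hκ1, map_zero]
        exact ⟨zero_mem _, zero_mem _⟩
      · have h1 : IsSmoothGradient (re (fourier n)) := isSmoothGradient_re_fourier hn
        have h2 : IsSmoothGradient (im (fourier n)) := isSmoothGradient_im_fourier hn
        rw [hκ0 _ (integral_eq_zero_of_isSmoothGradient h1),
          hκ0 _ (integral_eq_zero_of_isSmoothGradient h2)]
        exact ⟨toLp_mem_tangentL2_of_isSmoothGradient h1, toLp_mem_tangentL2_of_isSmoothGradient h2⟩
    | zero => simp
    | add f g _ _ hf hg =>
      simp only [map_add]
      exact ⟨add_mem hf.1 hg.1, add_mem hf.2 hg.2⟩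
    -- Complex scalars mix real and imaginary parts, which is why both are carried through the
    -- induction.
    | smul z f _ hf =>
      have h1 : re (z • f) = z.re • re f - z.im • im f := by ext x; simp [re, im]
      have h2 : im (z • f) = z.re • im f + z.im • re f := by ext x; simp [re, im]
      rw [h1, h2]
      simp only [map_add, map_sub, map_smul]
      exact ⟨sub_mem (Submodule.smul_mem _ _ hf.1) (Submodule.smul_mem _ _ hf.2),
        add_mem (Submodule.smul_mem _ _ hf.2) (Submodule.smul_mem _ _ hf.1)⟩
  have hall : ∀ f : C(UnitAddCircle, ℂ), κ (re f) ∈ tangentL2 μ := fun f => by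
    have h1 : f ∈ (Submodule.span ℂ (Set.range (fourier (T := 1)))).topologicalClosure := by
      rw [span_fourier_closure_eq_top]; trivial
    exact (closure_minimal hspan hclosed h1).1
  have h2 := hall (Complex.ofRealCLM.compLeftContinuous ℝ UnitAddCircle w)
  have h3 : re (Complex.ofRealCLM.compLeftContinuous ℝ UnitAddCircle w) = w := by
    ext x; simp [re]
  rwa [h3, hκ0 _ hw] at h2

theorem exists_eq_toLp_of_isSmoothGradient {w : Lp ℝ 2 μ} {g : UnitAddCircle → ℝ}
    (hg : IsSmoothGradient g) (hw : w =ᵐ[μ] g) :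
    ∃ c : C(UnitAddCircle, ℝ), IsSmoothGradient c ∧ ContinuousMap.toLp 2 μ ℝ c = w := by
  have hg' := hg
  obtain ⟨f, hf, hper, hfg⟩ := hg
  obtain ⟨c, hc⟩ := exists_continuousMap_of_periodic hper.deriv (hf.continuous_deriv (by simp))
  have hcg : ⇑c = g := funext fun x => by
    obtain ⟨z, rfl⟩ := QuotientAddGroup.mk_surjective x
    exact (hc z).trans (hfg z).symm
  refine ⟨c, hcg ▸ hg', Lp.ext ((ContinuousMap.coeFn_toLp μ c).trans ?_)⟩
  rw [hcg]
  exact hw.symm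

/-- Tangent vectors are determined by their inner products with gradients. -/
theorem tangentL2_ext {v w : tangentL2 μ}
    (h : ∀ c : C(UnitAddCircle, ℝ), IsSmoothGradient c →
      inner ℝ (v : Lp ℝ 2 μ) (ContinuousMap.toLp 2 μ ℝ c) =
        inner ℝ (w : Lp ℝ 2 μ) (ContinuousMap.toLp 2 μ ℝ c)) : v = w := by
  -- `v - w` is orthogonal to gradients, hence to the whole tangent space, which contains it.
  have h1 : tangentL2 μ ≤ (Submodule.span ℝ {((v - w : tangentL2 μ) : Lp ℝ 2 μ)})ᗮ := by
    refine Submodule.topologicalClosure_minimal _ (Submodule.span_le.2 ?_)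
      (Submodule.isClosed_orthogonal _)
    rintro x ⟨g, hg, hx⟩
    obtain ⟨c, hc, rfl⟩ := exists_eq_toLp_of_isSmoothGradient hg hx
    rw [SetLike.mem_coe, Submodule.mem_orthogonal_singleton_iff_inner_right, Submodule.coe_sub,
      inner_sub_left, h c hc, sub_self]
  have h2 := Submodule.mem_orthogonal_singleton_iff_inner_right.1 (h1 (v - w).2)
  rw [inner_self_eq_zero] at h2
  exact sub_eq_zero.1 (Subtype.ext h2)

theorem IsSmoothGradient.add {f g : UnitAddCircle → ℝ} (hf : IsSmoothGradient f)
    (hg : IsSmoothGradient g) : IsSmoothGradient (f + g) := by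
  obtain ⟨a, ha, hap, hfa⟩ := hf
  obtain ⟨b, hb, hbp, hgb⟩ := hg
  refine ⟨a + b, ha.add hb, hap.add hbp, fun x => ?_⟩
  rw [Pi.add_apply, hfa, hgb,
    deriv_add (ha.differentiable (by simp) x) (hb.differentiable (by simp) x)]

theorem IsSmoothGradient.const_smul {f : UnitAddCircle → ℝ} (hf : IsSmoothGradient f) (r : ℝ) :
    IsSmoothGradient (r • f) := by
  obtain ⟨a, ha, hap, hfa⟩ := hf
  refine ⟨fun x => r * a x, contDiff_const.mul ha, fun x => by simp only [hap x], fun x => ?_⟩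
  rw [deriv_const_mul _ (ha.differentiable (by simp) x), Pi.smul_apply, hfa, smul_eq_mul]

/-- Gradients are dense in the tangent space. -/
theorem exists_isSmoothGradient_norm_sub_lt (v : tangentL2 μ) {ε : ℝ} (hε : 0 < ε) :
    ∃ c : C(UnitAddCircle, ℝ), IsSmoothGradient c ∧
      ‖(v : Lp ℝ 2 μ) - ContinuousMap.toLp 2 μ ℝ c‖ < ε := by
  obtain ⟨w, hw, hvw⟩ := Metric.mem_closure_iff.1 v.2 ε hε
  rw [dist_eq_norm] at hvw
  have : ∃ c : C(UnitAddCircle, ℝ), IsSmoothGradient c ∧ ContinuousMap.toLp 2 μ ℝ c = w := by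
    clear hvw
    induction hw using Submodule.span_induction with
    | mem x hx =>
      obtain ⟨g, hg, hx⟩ := hx
      exact exists_eq_toLp_of_isSmoothGradient hg hx
    | zero => exact ⟨0, ⟨fun _ => 0, contDiff_const, fun _ => rfl, by simp⟩, map_zero _⟩
    | add x y _ _ hx hy =>
      obtain ⟨a, ha, rfl⟩ := hx
      obtain ⟨b, hb, rfl⟩ := hy
      exact ⟨a + b, ha.add hb, map_add _ _ _⟩
    | smul r x _ hx =>
      obtain ⟨a, ha, rfl⟩ := hx
      exact ⟨r • a, ha.const_smul r, map_smul _ _ _⟩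
  obtain ⟨c, hc, rfl⟩ := this
  exact ⟨c, hc, hvw⟩

instance completeSpace_tangentL2 : CompleteSpace (tangentL2 μ) :=
  (Submodule.isClosed_topologicalClosure _).completeSpace_coe

end Tangent

/-! ### The candidate derivative as an adjoint -/

section Derivative

variable {μ : Measure UnitAddCircle} [IsFiniteMeasure μ]

/-- The operator `g ↦ a * g ∘ Φ` on `L²(μ)`, where `Φ` preserves `μ`. -/
noncomputable def mulCompL2 (a : C(UnitAddCircle, ℝ)) {Φ : UnitAddCircle → UnitAddCircle}
    (hΦ : MeasurePreserving Φ μ μ) : Lp ℝ 2 μ →L[ℝ] Lp ℝ 2 μ :=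
  (ContinuousLinearMap.mul ℝ ℝ).holderL μ ∞ 2 2 (ContinuousMap.toLp ∞ μ ℝ a) ∘L
    (Lp.compMeasurePreservingₗᵢ ℝ Φ hΦ).toContinuousLinearMap

theorem mulCompL2_toLp (a : C(UnitAddCircle, ℝ)) {Φ : UnitAddCircle → UnitAddCircle}
    (hΦ : MeasurePreserving Φ μ μ) (hc : Continuous Φ) (g : C(UnitAddCircle, ℝ)) :
    mulCompL2 a hΦ (ContinuousMap.toLp 2 μ ℝ g) =
      ContinuousMap.toLp 2 μ ℝ (a * g.comp ⟨Φ, hc⟩) := by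
  refine Lp.ext ?_
  have h1 := ContinuousLinearMap.coeFn_holder (r := 2) (ContinuousLinearMap.mul ℝ ℝ)
    (ContinuousMap.toLp ∞ μ ℝ a) (Lp.compMeasurePreserving Φ hΦ (ContinuousMap.toLp 2 μ ℝ g))
  have h2 := Lp.coeFn_compMeasurePreserving (ContinuousMap.toLp 2 μ ℝ g) hΦ
  have h3 := hΦ.quasiMeasurePreserving.ae_eq_comp (ContinuousMap.coeFn_toLp (𝕜 := ℝ) (p := 2) μ g)
  have h4 := ContinuousMap.coeFn_toLp (𝕜 := ℝ) (p := ∞) μ a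
  have h5 := ContinuousMap.coeFn_toLp (𝕜 := ℝ) (p := 2) μ (a * g.comp ⟨Φ, hc⟩)
  filter_upwards [h1, h2, h3, h4, h5] with x h1 h2 h3 h4 h5
  rw [h5]
  refine h1.trans ?_
  rw [h2, h3, h4]
  rfl

/-- The operator on the tangent space that is dual to `g ↦ a * g ∘ Φ`. -/
noncomputable def tangentDual (a : C(UnitAddCircle, ℝ)) {Φ : UnitAddCircle → UnitAddCircle}
    (hΦ : MeasurePreserving Φ μ μ) : tangentL2 μ →L[ℝ] tangentL2 μ :=
  (tangentL2 μ).orthogonalProjectionOnto ∘L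
    ContinuousLinearMap.adjoint (mulCompL2 a hΦ) ∘L (tangentL2 μ).subtypeL

/-- The orthogonal projection in the definition is invisible when pairing with tangent vectors. -/
theorem inner_tangentDual (a : C(UnitAddCircle, ℝ)) {Φ : UnitAddCircle → UnitAddCircle}
    (hΦ : MeasurePreserving Φ μ μ) (v : tangentL2 μ) {g : Lp ℝ 2 μ} (hg : g ∈ tangentL2 μ) :
    inner ℝ (tangentDual a hΦ v : Lp ℝ 2 μ) g = inner ℝ (v : Lp ℝ 2 μ) (mulCompL2 a hΦ g) := by
  have h1 := Submodule.inner_orthogonalProjectionOnto_eq_of_mem_left (K := tangentL2 μ) ⟨g, hg⟩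
    (ContinuousLinearMap.adjoint (mulCompL2 a hΦ) v)
  rw [ContinuousLinearMap.adjoint_inner_right, real_inner_comm] at h1
  rw [real_inner_comm (mulCompL2 a hΦ g)]
  exact h1

theorem inner_toLp_withDensity {ρ : C(UnitAddCircle, ℝ)} (hρ : ∀ x, 0 < ρ x)
    (hμ : μ = volume.withDensity fun x => ENNReal.ofReal (ρ x)) (f g : C(UnitAddCircle, ℝ)) :
    inner ℝ (ContinuousMap.toLp 2 μ ℝ f) (ContinuousMap.toLp 2 μ ℝ g) =
      ∫ x in (0 : ℝ)..1, f (x : UnitAddCircle) * g (x : UnitAddCircle) * ρ (x : UnitAddCircle) := by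
  rw [ContinuousMap.inner_toLp, ← integral_withDensity_unitAddCircle hρ fun x => f x * g x, ← hμ]
  simp [mul_comm]

/-- Both sides are paired with a gradient `c`. In the change of variables the Jacobian weight `s /
F'` cancels the factor `a = F'` up to `s`, and the constant `b` contributes `b ∫ c = 0`. -/
theorem tangentDual_toLp {F G : ℝ → ℝ} {s : ℝ} {N : ℕ} (h : IsCoveringLift F G s N)
    {Φ : UnitAddCircle → UnitAddCircle}
    (hΦl : ∀ x : ℝ, Φ (x : UnitAddCircle) = (F x : UnitAddCircle)) (hΦ : MeasurePreserving Φ μ μ)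
    {ρ a : C(UnitAddCircle, ℝ)} (hρ : ∀ x, 0 < ρ x)
    (hμ : μ = volume.withDensity fun x => ENNReal.ofReal (ρ x))
    (ha : ∀ x : ℝ, a (x : UnitAddCircle) = deriv F x) {u w : C(UnitAddCircle, ℝ)} {b : ℝ}
    (hu : integralUnitAddCircle ℝ u = 0) (hw : integralUnitAddCircle ℝ w = 0)
    (huw : ∀ x : ℝ, w (x : UnitAddCircle) * ρ (x : UnitAddCircle) = s * branchSum G N
      (fun y => ρ (y : UnitAddCircle) * u (y : UnitAddCircle)) x - b) :
    tangentDual a hΦ ⟨ContinuousMap.toLp 2 μ ℝ u, toLp_mem_tangentL2 hu⟩ =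
      ⟨ContinuousMap.toLp 2 μ ℝ w, toLp_mem_tangentL2 hw⟩ := by
  refine tangentL2_ext fun c hc => ?_
  rw [inner_tangentDual a hΦ _ (toLp_mem_tangentL2_of_isSmoothGradient hc),
    mulCompL2_toLp a hΦ (h.continuous_of_lift hΦl)]
  simp only
  rw [inner_toLp_withDensity hρ hμ, inner_toLp_withDensity hρ hμ]
  have hcoe : Continuous fun x : ℝ => (x : UnitAddCircle) := AddCircle.continuous_mk' 1
  have hc' : Continuous fun x : ℝ => c (x : UnitAddCircle) := c.continuous.comp hcoe
  have hu' : Continuous fun x : ℝ => u (x : UnitAddCircle) := u.continuous.comp hcoe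
  have hρ' : Continuous fun x : ℝ => ρ (x : UnitAddCircle) := ρ.continuous.comp hcoe
  have ha' : Continuous fun x : ℝ => a (x : UnitAddCircle) := a.continuous.comp hcoe
  have e1 := h.integral_comp_mul (φ := fun x => c (x : UnitAddCircle))
    (g := fun x => u (x : UnitAddCircle) * a (x : UnitAddCircle) * ρ (x : UnitAddCircle))
    (periodic_comp_coe _) hc' (periodic_comp_coe fun x => u x * a x * ρ x)
    ((hu'.mul ha').mul hρ')
  have e2 : ∀ x : ℝ, u (x : UnitAddCircle) * (a * c.comp ⟨Φ, h.continuous_of_lift hΦl⟩)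
      (x : UnitAddCircle) * ρ (x : UnitAddCircle) = c (F x : UnitAddCircle) *
        (u (x : UnitAddCircle) * a (x : UnitAddCircle) * ρ (x : UnitAddCircle)) := fun x => by
    simp only [ContinuousMap.mul_apply, ContinuousMap.comp_apply, ContinuousMap.coe_mk, hΦl]
    ring
  simp only [e2]
  rw [e1]
  have e3 : ∀ x : ℝ, w (x : UnitAddCircle) * c (x : UnitAddCircle) * ρ (x : UnitAddCircle) =
      c (x : UnitAddCircle) * branchSum G N (fun y => u (y : UnitAddCircle) *
        a (y : UnitAddCircle) * ρ (y : UnitAddCircle) * (s / deriv F y)) x -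
      b * c (x : UnitAddCircle) := fun x => by
    rw [mul_right_comm, huw, sub_mul, mul_comm _ (c (x : UnitAddCircle))]
    congr 2
    simp only [branchSum, Finset.mul_sum]
    refine Finset.sum_congr rfl fun k _ => ?_
    rw [ha]
    field_simp [h.deriv_ne (G (x + k))]
  simp only [e3]
  have hb : Continuous (branchSum G N fun y => u (y : UnitAddCircle) *
        a (y : UnitAddCircle) * ρ (y : UnitAddCircle) * (s / deriv F y)) :=
    h.branchSum_continuous (((hu'.mul ha').mul hρ').mul h.continuous_weight)
  have i1 : IntervalIntegrable (fun x : ℝ => c (x : UnitAddCircle) *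
      branchSum G N (fun y => u (y : UnitAddCircle) *
        a (y : UnitAddCircle) * ρ (y : UnitAddCircle) * (s / deriv F y)) x) volume 0 1 :=
    (hc'.mul hb).intervalIntegrable _ _
  rw [intervalIntegral.integral_sub i1 ((hc'.intervalIntegrable _ _).const_mul b),
    intervalIntegral.integral_const_mul, ← integralUnitAddCircle_apply c,
    integral_eq_zero_of_isSmoothGradient hc, mul_zero, sub_zero]

end Derivative

/-! ### Wasserstein estimates and uniqueness of the derivative -/

theorem abs_sub_sub_mul_le {f f' : ℝ → ℝ} {C : ℝ} (hf : ∀ x, HasDerivAt f (f' x) x)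
    (hf' : ∀ x y, |f' x - f' y| ≤ C * |x - y|) (x y : ℝ) :
    |f y - f x - f' x * (y - x)| ≤ C * |y - x| ^ 2 := by
  have hC : 0 ≤ C := by simpa using (abs_nonneg _).trans (hf' 1 0)
  have hd : ∀ z, HasDerivAt (fun z => f z - f' x * z) (f' z - f' x * 1) z := fun z =>
    (hf z).sub ((hasDerivAt_id z).const_mul _)
  have := Convex.norm_image_sub_le_of_norm_deriv_le (s := Set.uIcc x y) (x := x) (y := y)
    (C := C * |y - x|) (fun z _ => (hd z).differentiableAt) (fun z hz => by
      rw [(hd z).deriv, mul_one]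
      refine (hf' z x).trans (mul_le_mul_of_nonneg_left ?_ hC)
      exact Set.abs_sub_left_of_mem_uIcc hz) (convex_uIcc x y)
      Set.left_mem_uIcc Set.right_mem_uIcc
  rw [Real.norm_eq_abs, Real.norm_eq_abs] at this
  calc |f y - f x - f' x * (y - x)| = |f y - f' x * y - (f x - f' x * x)| := by ring_nf
    _ ≤ C * |y - x| * |y - x| := this
    _ = C * |y - x| ^ 2 := by ring

theorem edist_unitAddCircle_le_one (x y : UnitAddCircle) : edist x y ≤ 1 := by
  rw [edist_dist, dist_eq_norm]
  refine ENNReal.ofReal_le_one.2 ?_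
  have := AddCircle.norm_le_half_period 1 one_ne_zero (x := x - y)
  norm_num at this
  linarith

/-- Two maps defined on a common probability space give a transport plan. -/
theorem wasserstein_map_le {μ : Measure UnitAddCircle} {X Y : UnitAddCircle → UnitAddCircle}
    (hX : AEMeasurable X μ) (hY : AEMeasurable Y μ) {c : ℝ} (hc : 0 ≤ c)
    (h : eLpNorm (fun x => dist (X x) (Y x)) 2 μ ≤ ENNReal.ofReal c) :
    wasserstein (μ.map X) (μ.map Y) ≤ c := by
  refine ENNReal.toReal_le_of_le_ofReal hc (le_trans ?_ h)
  rw [eLpNorm_eq_lintegral_rpow_enorm_toReal (by simp) (by simp)]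
  refine ENNReal.rpow_le_rpow ?_ (by simp)
  refine (iInf₂_le (μ.map fun x => (X x, Y x)) (And.intro ?_ ?_)).trans ?_
  · rw [AEMeasurable.map_map_of_aemeasurable measurable_fst.aemeasurable (hX.prodMk hY)]
    rfl
  · rw [AEMeasurable.map_map_of_aemeasurable measurable_snd.aemeasurable (hX.prodMk hY)]
    rfl
  · rw [lintegral_map' (f := fun p : UnitAddCircle × UnitAddCircle => edist p.1 p.2 ^ 2)
      (by fun_prop) (hX.prodMk hY)]
    refine lintegral_mono fun x => le_of_eq ?_
    simp only [edist_dist, ENNReal.toReal_ofNat, ENNReal.rpow_ofNat]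
    rw [Real.enorm_of_nonneg dist_nonneg]

/-- For every plan the difference is at most `K ∫ dist`, and the `L¹` norm of the distance is at
most its `L²` norm on a probability space. -/
theorem abs_integral_sub_integral_le_wasserstein {α β : Measure UnitAddCircle}
    [IsProbabilityMeasure α] [IsProbabilityMeasure β] {φ : C(UnitAddCircle, ℝ)} {K : ℝ}
    (hK : 0 < K) (hφ : ∀ x y, |φ x - φ y| ≤ K * dist x y) :
    |(∫ x, φ x ∂α) - ∫ x, φ x ∂β| ≤ K * wasserstein α β := by
  set D := (∫ x, φ x ∂α) - ∫ x, φ x ∂β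
  set I := ⨅ (π : Measure (UnitAddCircle × UnitAddCircle))
      (_ : π.map Prod.fst = α ∧ π.map Prod.snd = β), ∫⁻ p, edist p.1 p.2 ^ 2 ∂π with hI
  -- Without finiteness the `toReal` in `wasserstein` would return `0`; the product plan costs at
  -- most one.
  have hI1 : I ≠ ⊤ := by
    refine ne_top_of_le_ne_top ENNReal.one_ne_top ((iInf₂_le (α.prod β) (by simp)).trans ?_)
    calc ∫⁻ p, edist p.1 p.2 ^ 2 ∂(α.prod β) ≤ ∫⁻ _, 1 ∂(α.prod β) :=
          lintegral_mono fun p => pow_le_one₀ zero_le (edist_unitAddCircle_le_one _ _)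
      _ = 1 := by simp
  have hD : ENNReal.ofReal (|D| / K) ^ 2 ≤ I := by
    refine le_iInf₂ fun π hπ => ?_
    have hπ1 : IsProbabilityMeasure π := ⟨by
      rw [← measure_univ (μ := α), ← hπ.1, Measure.map_apply measurable_fst .univ,
        Set.preimage_univ]⟩
    have hi : ∀ f : UnitAddCircle × UnitAddCircle → ℝ, Continuous f → Integrable f π := fun f hf =>
      hf.integrable_of_hasCompactSupport (HasCompactSupport.of_compactSpace _)
    have e1 : D = ∫ p, (φ p.1 - φ p.2) ∂π := by
      rw [integral_sub (hi (fun p => φ p.1) (by fun_prop)) (hi (fun p => φ p.2) (by fun_prop))]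
      simp only [D]
      congr 1
      · rw [← hπ.1, integral_map measurable_fst.aemeasurable φ.continuous.aestronglyMeasurable]
      · rw [← hπ.2, integral_map measurable_snd.aemeasurable φ.continuous.aestronglyMeasurable]
    have e2 : |D| / K ≤ ∫ p, dist p.1 p.2 ∂π := by
      rw [div_le_iff₀ hK, mul_comm, ← integral_const_mul, e1, ← Real.norm_eq_abs]
      refine norm_integral_le_of_norm_le ?_ (Eventually.of_forall fun p => hφ p.1 p.2)
      exact (hi (fun p => dist p.1 p.2) (by fun_prop)).const_mul K
    have e3 : ENNReal.ofReal (|D| / K) ≤ eLpNorm (fun p => dist p.1 p.2) 1 π := by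
      refine (ENNReal.ofReal_le_ofReal e2).trans ?_
      rw [ofReal_integral_eq_lintegral_ofReal (hi (fun p => dist p.1 p.2) (by fun_prop))
        (Eventually.of_forall fun p => dist_nonneg), eLpNorm_one_eq_lintegral_enorm]
      refine lintegral_mono fun p => le_of_eq ?_
      exact (Real.enorm_of_nonneg dist_nonneg).symm
    have e4 : eLpNorm (fun p : UnitAddCircle × UnitAddCircle => dist p.1 p.2) 1 π ≤
        eLpNorm (fun p => dist p.1 p.2) 2 π :=
      eLpNorm_le_eLpNorm_of_exponent_le (by norm_num) (by fun_prop)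
    have e5 : eLpNorm (fun p : UnitAddCircle × UnitAddCircle => dist p.1 p.2) 2 π ^ 2 =
        ∫⁻ p, edist p.1 p.2 ^ 2 ∂π := by
      rw [eLpNorm_eq_lintegral_rpow_enorm_toReal (by simp) (by simp), ← ENNReal.rpow_natCast,
        ← ENNReal.rpow_mul]
      simp only [edist_dist, ENNReal.toReal_ofNat, ENNReal.rpow_ofNat]
      norm_num
      exact lintegral_congr fun p => by rw [Real.enorm_of_nonneg dist_nonneg]
    rw [← e5]
    exact pow_le_pow_left' (e3.trans e4) 2
  have h1 : ENNReal.ofReal (|D| / K) ≤ I ^ (1 / 2 : ℝ) := by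
    rw [one_div, ENNReal.le_rpow_inv_iff (by norm_num)]
    simpa using hD
  have h2 : |D| / K ≤ wasserstein α β :=
    (ENNReal.ofReal_le_iff_le_toReal (ENNReal.rpow_ne_top_of_nonneg (by norm_num) hI1)).1 h1
  rwa [div_le_iff₀ hK, mul_comm] at h2

section Uniqueness

variable {μ : Measure UnitAddCircle}

theorem aemeasurable_add_smul (v : Lp ℝ 2 μ) (t : ℝ) :
    AEMeasurable (fun x => x + ((t * v x : ℝ) : UnitAddCircle)) μ := by
  have h1 : AEMeasurable (fun x => t * v x) μ := (Lp.aestronglyMeasurable v).aemeasurable.const_mul t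
  exact aemeasurable_id.add (AddCircle.measurable_mk'.comp_aemeasurable h1)

variable [IsProbabilityMeasure μ]

instance isProbabilityMeasure_pushAlong (v : Lp ℝ 2 μ) (t : ℝ) :
    IsProbabilityMeasure (pushAlong μ t v) :=
  Measure.isProbabilityMeasure_map (aemeasurable_add_smul v t)

/-- Taylor's formula for `f`, integrated: the remainder is at most a constant times `t² ∫ a²`,
finite as `a` is in `L²`. -/
theorem exists_abs_integral_pushAlong_sub_le {f : ℝ → ℝ} (hf : ContDiff ℝ ∞ f)
    (hper : Function.Periodic f 1) {φ c : C(UnitAddCircle, ℝ)}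
    (hφ : ∀ x : ℝ, φ (x : UnitAddCircle) = f x)
    (hc : ∀ x : ℝ, c (x : UnitAddCircle) = deriv f x) (a : Lp ℝ 2 μ) :
    ∃ C, ∀ t, |(∫ x, φ x ∂(pushAlong μ t a)) - (∫ x, φ x ∂μ) -
      t * inner ℝ a (ContinuousMap.toLp 2 μ ℝ c)| ≤ C * t ^ 2 := by
  have hf' : ContDiff ℝ ∞ (deriv f) := ((contDiff_infty_iff_deriv).1 hf).2
  obtain ⟨C, hC0, hC⟩ := hper.deriv.deriv.exists_norm_le (hf'.continuous_deriv (by simp))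
  have hlip : ∀ x y, |deriv f x - deriv f y| ≤ C * |x - y| := fun x y =>
    Convex.norm_image_sub_le_of_norm_deriv_le (s := Set.univ) (x := y) (y := x)
      (fun z _ => hf'.differentiable (by simp) z) (fun z _ => hC z) convex_univ trivial trivial
  have hta := abs_sub_sub_mul_le (fun x => (hf.differentiable (by simp) x).hasDerivAt) hlip
  have ha : MemLp a 2 μ := Lp.memLp a
  have ha2 : Integrable (fun x => a x ^ 2) μ := ha.integrable_sq
  have ha1 : Integrable a μ := ha.integrable (by norm_num)
  have hi : ∀ g : C(UnitAddCircle, ℝ), Integrable g μ := fun g =>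
    g.continuous.integrable_of_hasCompactSupport (HasCompactSupport.of_compactSpace _)
  refine ⟨C * ∫ x, a x ^ 2 ∂μ, fun t => ?_⟩
  have e1 : inner ℝ a (ContinuousMap.toLp 2 μ ℝ c) = ∫ x, c x * a x ∂μ := by
    rw [L2.inner_def]
    refine integral_congr_ae ?_
    filter_upwards [ContinuousMap.coeFn_toLp (𝕜 := ℝ) (p := 2) μ c] with x hx
    rw [hx]
    simp
  have hm := aemeasurable_add_smul a t
  have e2 : ∫ x, φ x ∂(pushAlong μ t a) = ∫ x, φ (x + ((t * a x : ℝ) : UnitAddCircle)) ∂μ :=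
    integral_map hm φ.continuous.aestronglyMeasurable
  have i1 : Integrable (fun x => φ (x + ((t * a x : ℝ) : UnitAddCircle))) μ :=
    Integrable.of_bound (φ.continuous.measurable.comp_aemeasurable hm).aestronglyMeasurable ‖φ‖
      (Eventually.of_forall fun x => φ.norm_coe_le_norm _)
  have i2 : Integrable (fun x => c x * a x) μ :=
    ha1.bdd_mul c.continuous.aestronglyMeasurable
      (Eventually.of_forall fun x => c.norm_coe_le_norm x)
  have i3 : Integrable (fun x => φ (x + ((t * a x : ℝ) : UnitAddCircle)) - φ x) μ := i1.sub (hi φ)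
  rw [e1, e2, ← integral_const_mul, ← integral_sub i1 (hi φ), ← integral_sub i3 (i2.const_mul t),
    mul_right_comm, ← integral_const_mul, ← Real.norm_eq_abs]
  refine norm_integral_le_of_norm_le (ha2.const_mul _) (Eventually.of_forall fun x => ?_)
  obtain ⟨z, rfl⟩ := QuotientAddGroup.mk_surjective x
  set r := a (z : UnitAddCircle)
  have h1 := hta z (z + t * r)
  rw [← hφ, ← hφ, ← hc, add_sub_cancel_left, AddCircle.coe_add, abs_mul, mul_pow, sq_abs,
    sq_abs] at h1
  rw [Real.norm_eq_abs]
  calc _ = |φ (↑z + ((t * r : ℝ) : UnitAddCircle)) - φ (z : UnitAddCircle) -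
        c (z : UnitAddCircle) * (t * r)| := by congr 1; change _ - t * (_ * r) = _; ring
    _ ≤ C * (t ^ 2 * r ^ 2) := h1
    _ = C * t ^ 2 * r ^ 2 := by ring

/-- Both `ν + t L v` and `ν + t L' v` are `o(t)`-close to the same measure, so the first-order terms
of the integrals of any smooth `φ` coincide. These are the inner products with the gradient of `φ`.
-/
theorem HasGateauxDeriv.unique {μ ν : Measure UnitAddCircle} [IsProbabilityMeasure ν]
    {f : Measure UnitAddCircle → Measure UnitAddCircle}
    {L L' : tangentL2 μ →L[ℝ] tangentL2 ν} (hL : HasGateauxDeriv f μ ν L)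
    (hL' : HasGateauxDeriv f μ ν L')
    (hf : ∀ (v : tangentL2 μ) (t : ℝ),
      IsProbabilityMeasure (f (pushAlong μ t (v : Lp ℝ 2 μ)))) : L' = L := by
  ext1 v
  refine tangentL2_ext fun c hc => ?_
  obtain ⟨g, hg, hper, hgc⟩ := hc
  obtain ⟨φ, hφ⟩ := exists_continuousMap_of_periodic hper hg.continuous
  obtain ⟨K, hK0, hK⟩ := hper.deriv.exists_norm_le (hg.continuous_deriv (by simp))
  have hglip : ∀ x y, |g x - g y| ≤ K * |x - y| := fun x y =>
    Convex.norm_image_sub_le_of_norm_deriv_le (s := Set.univ) (x := y) (y := x)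
      (fun z _ => hg.differentiable (by simp) z) (fun z _ => hK z) convex_univ trivial trivial
  have hφlip : ∀ x y, |φ x - φ y| ≤ K * dist x y := fun x y => by
    obtain ⟨x, rfl⟩ := QuotientAddGroup.mk_surjective x
    obtain ⟨y, rfl⟩ := QuotientAddGroup.mk_surjective y
    -- The representative of `x` nearest to `y` turns the circle distance into a distance on the
    -- line.
    obtain ⟨z, hz, hzd⟩ : ∃ z : ℝ, (z : UnitAddCircle) = x ∧
        dist (x : UnitAddCircle) y = |z - y| := by
      refine ⟨x - round (x - y), ?_, ?_⟩
      · rw [AddCircle.coe_sub, sub_eq_self, AddCircle.coe_eq_zero_iff]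
        exact ⟨round (x - y), by simp⟩
      · rw [dist_eq_norm, ← AddCircle.coe_sub, AddCircle.norm_eq]
        simp only [inv_one, one_mul, mul_one]
        congr 1
        ring
    change |φ (x : UnitAddCircle) - φ (y : UnitAddCircle)| ≤ K * dist (x : UnitAddCircle) y
    rw [hzd, ← hz, hφ, hφ]
    exact hglip z y
  obtain ⟨C, hC⟩ := exists_abs_integral_pushAlong_sub_le hg hper hφ hgc (L v : Lp ℝ 2 ν)
  obtain ⟨C', hC'⟩ := exists_abs_integral_pushAlong_sub_le hg hper hφ hgc (L' v : Lp ℝ 2 ν)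
  set p := inner ℝ (L v : Lp ℝ 2 ν) (ContinuousMap.toLp 2 ν ℝ c)
  set p' := inner ℝ (L' v : Lp ℝ 2 ν) (ContinuousMap.toLp 2 ν ℝ c)
  have hbound : ∀ t, |t * (p' - p)| ≤
      K * ‖wasserstein (f (pushAlong μ t (v : Lp ℝ 2 μ))) (pushAlong ν t (L v : Lp ℝ 2 ν))‖ +
      K * ‖wasserstein (f (pushAlong μ t (v : Lp ℝ 2 μ))) (pushAlong ν t (L' v : Lp ℝ 2 ν))‖ +
      (C + C') * t ^ 2 := fun t => by
    have := hf v t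
    have h1 := abs_integral_sub_integral_le_wasserstein
      (α := f (pushAlong μ t (v : Lp ℝ 2 μ))) (β := pushAlong ν t (L v : Lp ℝ 2 ν)) hK0 hφlip
    have h2 := abs_integral_sub_integral_le_wasserstein
      (α := f (pushAlong μ t (v : Lp ℝ 2 μ))) (β := pushAlong ν t (L' v : Lp ℝ 2 ν)) hK0 hφlip
    have h3 := mul_le_mul_of_nonneg_left (Real.le_norm_self
      (wasserstein (f (pushAlong μ t (v : Lp ℝ 2 μ))) (pushAlong ν t (L v : Lp ℝ 2 ν)))) hK0.le
    have h4 := mul_le_mul_of_nonneg_left (Real.le_norm_self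
      (wasserstein (f (pushAlong μ t (v : Lp ℝ 2 μ))) (pushAlong ν t (L' v : Lp ℝ 2 ν)))) hK0.le
    have h5 := hC t
    have h6 := hC' t
    have h7 := h1.trans h3
    have h8 := h2.trans h4
    rw [abs_le] at h5 h6 h7 h8 ⊢
    constructor <;> linarith [h5.1, h5.2, h6.1, h6.2, h7.1, h7.2, h8.1, h8.2]
  have hsq : (fun t : ℝ => t ^ 2) =o[𝓝 0] fun t : ℝ => t := by
    simpa using isLittleO_pow_pow (𝕜 := ℝ) (m := 1) (n := 2) (by norm_num)
  have hlo : (fun t : ℝ => t * (p' - p)) =o[𝓝 0] fun t : ℝ => t := by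
    refine IsBigO.trans_isLittleO (IsBigO.of_bound 1 (Eventually.of_forall fun t => ?_))
      ((((hL.isLittleO v).norm_left.const_mul_left K).add
        ((hL'.isLittleO v).norm_left.const_mul_left K)).add (hsq.const_mul_left (C + C')))
    rw [one_mul]
    exact (hbound t).trans (Real.le_norm_self _)
  by_contra hne
  have hpos : 0 < |p' - p| := abs_pos.2 (sub_ne_zero.2 hne)
  have hev := hlo.bound (half_pos hpos)
  obtain ⟨t, ht, ht0⟩ := ((hev.filter_mono nhdsWithin_le_nhds).and
    (self_mem_nhdsWithin : ∀ᶠ t in 𝓝[≠] (0 : ℝ), t ∈ ({0}ᶜ : Set ℝ))).exists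
  have ht0' : 0 < |t| := abs_pos.2 ht0
  rw [norm_mul, Real.norm_eq_abs, Real.norm_eq_abs] at ht
  nlinarith

end Uniqueness

/-! ### Monotone rearrangement and its first-order expansion -/

namespace IsCoveringLift

variable {F G : ℝ → ℝ} {s : ℝ} {N : ℕ}

/-- If `M` is a distribution function of a measure, the signed branch sum is one for its image by
the covering. -/
theorem hasDerivAt_branchSum (h : IsCoveringLift F G s N) {M ρ : ℝ → ℝ}
    (hM : ∀ x, HasDerivAt M (ρ x) x) (x : ℝ) :
    HasDerivAt (fun x => s * branchSum G N M x) (transfer F G s N ρ x) x := by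
  have h1 : HasDerivAt (branchSum G N M)
      (∑ k ∈ Finset.range N, ρ (G (x + k)) * (deriv F (G (x + k)))⁻¹) x := by
    refine HasDerivAt.fun_sum fun k _ => ?_
    exact (hM _).comp x ((h.hasDerivAt_inv (x + k)).comp_add_const x k)
  have h2 : s * ∑ k ∈ Finset.range N, ρ (G (x + k)) * (deriv F (G (x + k)))⁻¹ =
      transfer F G s N ρ x := by
    simp only [transfer, branchSum, Finset.mul_sum]
    exact Finset.sum_congr rfl fun k _ => by ring
  rw [← h2]
  exact h1.const_mul s

theorem branchSum_add_one (h : IsCoveringLift F G s N) {M : ℝ → ℝ} (hM : ∀ x, M (x + 1) = M x + 1)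
    (x : ℝ) : s * branchSum G N M (x + 1) = s * branchSum G N M x + 1 := by
  have hMs : ∀ x, M (x + s) = M x + s := fun x => by
    rcases h.sign with rfl | rfl
    · exact hM x
    · have := hM (x + -1)
      rw [neg_add_cancel_right] at this
      linarith
  have h1 := Finset.sum_range_succ' (fun k : ℕ => M (G (x + k))) N
  rw [Finset.sum_range_succ, h.inv_add, hMs, Nat.cast_zero, add_zero] at h1
  have h2 : branchSum G N M (x + 1) = ∑ k ∈ Finset.range N, M (G (x + (k + 1 : ℕ))) :=
    Finset.sum_congr rfl fun k _ => by
      push_cast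
      congr 2
      ring
  have h3 : branchSum G N M (x + 1) = branchSum G N M x + s := by
    rw [h2, branchSum]
    linarith
  rw [h3, mul_add, h.sign_sq]

theorem integral_comp_mul_deriv_of_degree_one (h : IsCoveringLift F G 1 1) {φ : ℝ → ℝ}
    (hφ : Function.Periodic φ 1) (hφc : Continuous φ) :
    ∫ y in (0 : ℝ)..1, φ (F y) * deriv F y = ∫ x in (0 : ℝ)..1, φ x := by
  rw [h.integral_comp_mul hφ hφc h.deriv_periodic h.continuous_deriv]
  have : ∀ x, branchSum G 1 (fun y => deriv F y * (1 / deriv F y)) x = 1 := fun x => by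
    rw [branchSum, Finset.sum_range_one, mul_one_div_cancel (h.deriv_ne _)]
  simp only [this, mul_one]

theorem coe_comp_periodic_of_degree_one {f : ℝ → ℝ} (hf : ∀ x, f (x + 1) = f x + 1) :
    Function.Periodic (fun x => (f x : UnitAddCircle)) 1 := fun x => by
  have : ((1 : ℝ) : UnitAddCircle) = 0 := AddCircle.coe_period 1
  simp only [hf, AddCircle.coe_add, this, add_zero]

/-- The monotone rearrangement of the image of `μ` by a covering into `μ`, where `M` is the
distribution function of `μ`. -/
theorem exists_measurePreserving_rearrangement (h : IsCoveringLift F G s N) (hN : 0 < N)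
    {μ : Measure UnitAddCircle} [IsProbabilityMeasure μ] {ρ : C(UnitAddCircle, ℝ)}
    (hρ : ∀ x, 0 < ρ x) (hμ : μ = volume.withDensity fun x => ENNReal.ofReal (ρ x))
    {M Q : ℝ → ℝ} (hMQ : IsCoveringLift M Q 1 1)
    (hM : ∀ x : ℝ, HasDerivAt M (ρ (x : UnitAddCircle)) x) (β : ℝ) :
    ∃ Θ : UnitAddCircle → UnitAddCircle, MeasurePreserving Θ μ μ ∧
      ∀ x : ℝ, Θ (x : UnitAddCircle) = (Q (s * branchSum G N M (F x) + β) : UnitAddCircle) := by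
  have hcoe : Continuous fun x : ℝ => (x : UnitAddCircle) := AddCircle.continuous_mk' 1
  have hρc : Continuous fun x : ℝ => ρ (x : UnitAddCircle) := ρ.continuous.comp hcoe
  -- A distribution function of the image measure; on the circle its base point is free, hence the
  -- arbitrary `β`.
  set H : ℝ → ℝ := fun x => s * branchSum G N M x + β with hH
  have hM1 : ∀ x, M (x + 1) = M x + 1 := fun x => by simpa using hMQ.map_add x
  have hQ1 : ∀ x, Q (x + 1) = Q x + 1 := fun x => by simpa using hMQ.inv_add x
  have hH1 : ∀ x, H (x + 1) = H x + 1 := fun x => by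
    simp only [hH, h.branchSum_add_one hM1]
    ring
  have hHd : ∀ x, HasDerivAt H (transfer F G s N (fun y => ρ (y : UnitAddCircle)) x) x := fun x =>
    (h.hasDerivAt_branchSum hM x).add_const β
  have htc := h.transfer_continuous hρc
  have hderiv : deriv H = transfer F G s N fun y => ρ (y : UnitAddCircle) :=
    funext fun x => (hHd x).deriv
  obtain ⟨K, hHK⟩ : ∃ K, IsCoveringLift H K 1 1 := by
    refine exists_isCoveringLift one_pos (contDiff_one_of_hasDerivAt hHd htc) (Or.inl rfl)
      (fun x => ?_) (fun x => by simpa using hH1 x)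
    rw [hderiv, one_mul, transfer, branchSum]
    exact Finset.sum_pos (fun k _ => mul_pos (hρ _) (h.weight_pos _))
      (Finset.nonempty_range_iff.2 hN.ne')
  have hQper := coe_comp_periodic_of_degree_one hQ1
  have hQc : Continuous fun x => (Q x : UnitAddCircle) := hcoe.comp hMQ.continuous_inv
  have hQH := hHK.periodic_comp hQper
  have hQHc : Continuous fun x => (Q (H x) : UnitAddCircle) := hQc.comp hHK.contDiff.continuous
  obtain ⟨Θ, hΘ⟩ := exists_continuousMap_of_periodic (h.periodic_comp hQH)
    (hQHc.comp h.contDiff.continuous)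
  refine ⟨Θ, ⟨Θ.continuous.measurable, ?_⟩, hΘ⟩
  have : IsProbabilityMeasure (μ.map Θ) :=
    Measure.isProbabilityMeasure_map Θ.continuous.aemeasurable
  refine ext_of_forall_integral_eq_of_IsFiniteMeasure fun φ => ?_
  have hφQ : Function.Periodic (fun x => φ (Q x : UnitAddCircle)) 1 := fun x =>
    congrArg φ (hQper x)
  have hφQc : Continuous fun x => φ (Q x : UnitAddCircle) := φ.continuous.comp hQc
  -- `F` carries the density `ρ` to `H'`, `H` carries `H'` to the uniform density, and `M` carries
  -- `ρ` to it too: both integrals equal `∫ φ ∘ Q`.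
  have e1 : ∫ x, φ x ∂(μ.map Θ) = ∫ x in (0 : ℝ)..1, φ (Q x : UnitAddCircle) := by
    rw [integral_map Θ.continuous.aemeasurable φ.continuous.aestronglyMeasurable, hμ,
      integral_withDensity_unitAddCircle hρ]
    simp only [hΘ]
    have := h.integral_comp_mul (φ := fun x => φ (Q (H x) : UnitAddCircle))
      (g := fun x => ρ (x : UnitAddCircle)) (fun x => congrArg φ (hQH x))
      (φ.continuous.comp hQHc) (periodic_comp_coe _) hρc
    rw [this, ← hHK.integral_comp_mul_deriv_of_degree_one hφQ hφQc, hderiv]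
    rfl
  rw [e1, hμ, integral_withDensity_unitAddCircle hρ,
    ← hMQ.integral_comp_mul_deriv_of_degree_one hφQ hφQc]
  simp only [hMQ.left_inv, (hM _).deriv]

/-- The first-order expansion of the monotone rearrangement of the image of `μ + t u`. -/
theorem eventually_abs_rearrangement_sub_le (h : IsCoveringLift F G s N)
    {ρ u w M Q : ℝ → ℝ} {b β : ℝ} (hMQ : IsCoveringLift M Q 1 1)
    (hM : ∀ x, HasDerivAt M (ρ x) x) (hρper : Function.Periodic ρ 1) (hρpos : ∀ x, 0 < ρ x)
    {Cρ : ℝ} (hρlip : ∀ x y, |ρ x - ρ y| ≤ Cρ * |x - y|)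
    (hu : Function.Periodic u 1) {ℓ : ℝ} (hulip : ∀ x y, |u x - u y| ≤ ℓ * |x - y|)
    (hw : Function.Periodic w 1) (hwc : Continuous w)
    (huw : ∀ x, w x * ρ x = s * branchSum G N (fun y => ρ y * u y) x - b)
    (hβ : ∀ x, s * branchSum G N M x + β = M x) {ε : ℝ} (hε : 0 < ε) :
    ∀ᶠ t in 𝓝 (0 : ℝ), ∀ Gt, IsCoveringLift (fun x => F (x + t * u x)) Gt s N → ∀ x,
      |Q (s * branchSum Gt N M x + (β + t * b)) +
        t * w (Q (s * branchSum Gt N M x + (β + t * b))) - x| ≤ ε * |t| := by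
  have hℓ0 : 0 ≤ ℓ := by simpa using (abs_nonneg _).trans (hulip 1 0)
  have hCρ0 : 0 ≤ Cρ := by simpa using (abs_nonneg _).trans (hρlip 1 0)
  have huc : Continuous u :=
    (LipschitzWith.of_dist_le_mul (K := ⟨ℓ, hℓ0⟩) fun x y => hulip x y).continuous
  have hρc : Continuous ρ :=
    (LipschitzWith.of_dist_le_mul (K := ⟨Cρ, hCρ0⟩) fun x y => hρlip x y).continuous
  obtain ⟨B, hB0, hB⟩ := hu.exists_norm_le huc
  obtain ⟨R, hR0, hR⟩ := hρper.exists_norm_le hρc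
  obtain ⟨W, hW0, hW⟩ := hw.exists_norm_le hwc
  obtain ⟨c, hc0, hc⟩ := hρper.exists_pos_le hρc hρpos
  have hQlip : ∀ x y, |Q x - Q y| ≤ |x - y| / c := hMQ.abs_inv_sub_le hc0 fun x => by
    rw [(hM x).deriv]
    exact (hc x).trans (le_abs_self _)
  have htaylor := abs_sub_sub_mul_le hM hρlip
  set C₁ := N * (Cρ * B ^ 2 + R * (ℓ * B)) with hC₁
  set C₃ := (C₁ + R * W) / c with hC₃
  set C₄ := (C₁ + Cρ * C₃ ^ 2) / c with hC₄
  have hC₁0 : 0 ≤ C₁ := by positivity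
  have hC₃0 : 0 ≤ C₃ := by positivity
  have hC₄0 : 0 ≤ C₄ := by positivity
  obtain ⟨δ, hδ0, hδ⟩ := Metric.uniformContinuous_iff.1 (uniformContinuous_of_periodic hw hwc)
    (ε / 2) (half_pos hε)
  have ht1 : ∀ᶠ t in 𝓝 (0 : ℝ), |t| < 1 ∧ C₃ * |t| < δ ∧ C₄ * |t| < ε / 2 := by
    have ha : Continuous fun t : ℝ => |t| := continuous_abs
    refine (ha.tendsto' 0 0 (by simp)).eventually_lt_const one_pos |>.and ?_
    refine ((ha.const_mul C₃).tendsto' 0 0 (by simp)).eventually_lt_const hδ0 |>.and ?_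
    exact ((ha.const_mul C₄).tendsto' 0 0 (by simp)).eventually_lt_const (half_pos hε)
  filter_upwards [ht1] with t ⟨ht1, ht3, ht4⟩ Gt hGt x
  -- An exact relation between the two inverses; with `u` Lipschitz it gives `Gt = G - t u ∘ G +
  -- O(t²)`.
  have hz : ∀ x, Gt x + t * u (Gt x) = G x := fun x => by
    rw [← h.left_inv (Gt x + t * u (Gt x))]
    exact congrArg G (hGt.right_inv x)
  have d1 : ∀ x, |Gt x - G x| ≤ B * |t| := fun x => by
    have : Gt x - G x = -(t * u (Gt x)) := by rw [← hz]; ring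
    rw [this, abs_neg, abs_mul, mul_comm]
    exact mul_le_mul_of_nonneg_right (hB _) (abs_nonneg t)
  have d2 : ∀ x, |Gt x - G x + t * u (G x)| ≤ ℓ * B * t ^ 2 := fun x => by
    have : Gt x - G x + t * u (G x) = t * (u (G x) - u (Gt x)) := by rw [← hz]; ring
    rw [this, abs_mul]
    calc |t| * |u (G x) - u (Gt x)| ≤ |t| * (ℓ * (B * |t|)) := by
          refine mul_le_mul_of_nonneg_left ((hulip _ _).trans ?_) (abs_nonneg t)
          rw [abs_sub_comm]
          exact mul_le_mul_of_nonneg_left (d1 x) hℓ0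
      _ = ℓ * B * t ^ 2 := by rw [← sq_abs t]; ring
  have d3 : ∀ x, |M (Gt x) - M (G x) + t * (ρ (G x) * u (G x))| ≤
      (Cρ * B ^ 2 + R * (ℓ * B)) * t ^ 2 := fun x => by
    have e1 := htaylor (G x) (Gt x)
    have e2 : |Gt x - G x| ^ 2 ≤ B ^ 2 * t ^ 2 := by
      rw [← sq_abs t, ← mul_pow]
      exact pow_le_pow_left₀ (abs_nonneg _) (d1 x) 2
    have e3 : |ρ (G x) * (Gt x - G x + t * u (G x))| ≤ R * (ℓ * B * t ^ 2) := by
      rw [abs_mul]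
      exact mul_le_mul (hR _) (d2 x) (abs_nonneg _) hR0.le
    have e4 := mul_le_mul_of_nonneg_left e2 hCρ0
    calc _ = |(M (Gt x) - M (G x) - ρ (G x) * (Gt x - G x)) +
          ρ (G x) * (Gt x - G x + t * u (G x))| := by ring_nf
      _ ≤ _ := (abs_add_le _ _).trans (add_le_add (e1.trans e4) e3)
      _ = _ := by ring
  set θ := Q (s * branchSum Gt N M x + (β + t * b))
  have hMθ : M θ = s * branchSum Gt N M x + (β + t * b) := hMQ.right_inv _
  -- The branch expansions are summed. Invariance (`hβ`) identifies the terms of order zero, and the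
  -- shift `t * b` of the base point accounts for the constant in `w ρ`.
  have d4 : |M θ - M x + t * (ρ x * w x)| ≤ C₁ * t ^ 2 := by
    have e1 : M θ - M x + t * (ρ x * w x) = s * ∑ k ∈ Finset.range N,
        (M (Gt (x + k)) - M (G (x + k)) + t * (ρ (G (x + k)) * u (G (x + k)))) := by
      rw [Finset.sum_add_distrib, Finset.sum_sub_distrib, ← Finset.mul_sum, hMθ, ← hβ x,
        mul_comm (ρ x), huw]
      simp only [branchSum]
      ring
    have hs : |s| = 1 := by rcases h.sign with rfl | rfl <;> simp
    rw [e1, abs_mul, hs, one_mul]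
    refine (Finset.abs_sum_le_sum_abs _ _).trans ((Finset.sum_le_sum
      (g := fun _ => (Cρ * B ^ 2 + R * (ℓ * B)) * t ^ 2) fun (k : ℕ) _ => d3 (x + (k : ℝ))).trans ?_)
    rw [Finset.sum_const, Finset.card_range, nsmul_eq_mul, hC₁, mul_assoc]
  have d5 : |θ - x| ≤ C₃ * |t| := by
    have e1 : |M θ - M x| ≤ (C₁ + R * W) * |t| := by
      have e2 : |t * (ρ x * w x)| ≤ |t| * (R * W) := by
        rw [abs_mul, abs_mul]
        exact mul_le_mul_of_nonneg_left (mul_le_mul (hR x) (hW x) (abs_nonneg _) hR0.le)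
          (abs_nonneg t)
      have e3 : C₁ * t ^ 2 ≤ C₁ * |t| := by
        rw [← sq_abs]
        exact mul_le_mul_of_nonneg_left (by nlinarith [abs_nonneg t]) hC₁0
      calc |M θ - M x| = |(M θ - M x + t * (ρ x * w x)) - t * (ρ x * w x)| := by ring_nf
        _ ≤ C₁ * |t| + |t| * (R * W) := (abs_sub _ _).trans (add_le_add (d4.trans e3) e2)
        _ = _ := by ring
    have e4 := hQlip (M θ) (M x)
    rw [hMQ.left_inv, hMQ.left_inv] at e4
    refine e4.trans ?_
    rw [hC₃, div_mul_eq_mul_div]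
    exact div_le_div_of_nonneg_right e1 hc0.le
  have d6 : |θ - x + t * w x| ≤ C₄ * t ^ 2 := by
    have e1 := htaylor x θ
    have e2 : |θ - x| ^ 2 ≤ C₃ ^ 2 * t ^ 2 := by
      rw [← sq_abs t, ← mul_pow]
      exact pow_le_pow_left₀ (abs_nonneg _) d5 2
    have e3 : |ρ x * (θ - x + t * w x)| ≤ (C₁ + Cρ * C₃ ^ 2) * t ^ 2 := by
      calc _ = |(M θ - M x + t * (ρ x * w x)) - (M θ - M x - ρ x * (θ - x))| := by ring_nf
        _ ≤ C₁ * t ^ 2 + Cρ * (C₃ ^ 2 * t ^ 2) := (abs_sub _ _).trans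
          (add_le_add d4 (e1.trans (mul_le_mul_of_nonneg_left e2 hCρ0)))
        _ = _ := by ring
    rw [abs_mul, abs_of_pos (hρpos x)] at e3
    rw [hC₄, div_mul_eq_mul_div, le_div_iff₀ hc0, mul_comm]
    exact (mul_le_mul_of_nonneg_right (hc x) (abs_nonneg _)).trans e3
  -- Since `w` is merely continuous, the error from evaluating it at `θ` is only `o(t)`.
  have d7 : |w θ - w x| ≤ ε / 2 := (hδ (d5.trans_lt ht3)).le
  calc |θ + t * w θ - x| = |(θ - x + t * w x) + t * (w θ - w x)| := by ring_nf
    _ ≤ C₄ * t ^ 2 + |t| * (ε / 2) := (abs_add_le _ _).trans (add_le_add d6 (by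
        rw [abs_mul]
        exact mul_le_mul_of_nonneg_left d7 (abs_nonneg t)))
    _ = C₄ * |t| * |t| + |t| * (ε / 2) := by rw [← sq_abs t]; ring
    _ ≤ ε / 2 * |t| + |t| * (ε / 2) := by
        gcongr
    _ = ε * |t| := by ring

end IsCoveringLift

namespace IsCoveringLift

variable {F G : ℝ → ℝ} {s : ℝ} {N : ℕ}

theorem exists_abs_sub_le (h : IsCoveringLift F G s N) :
    ∃ K, 0 < K ∧ ∀ x y, |F x - F y| ≤ K * |x - y| := by
  obtain ⟨K, hK0, hK⟩ := h.deriv_periodic.exists_norm_le h.continuous_deriv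
  exact ⟨K, hK0, fun x y => Convex.norm_image_sub_le_of_norm_deriv_le (s := Set.univ) (x := y)
    (y := x) (fun z _ => (h.hasDerivAt z).differentiableAt) (fun z _ => hK z) convex_univ trivial
    trivial⟩

/-- A small perturbation of a covering lift is a covering lift. -/
theorem exists_isCoveringLift_comp_add_smul (h : IsCoveringLift F G s N) (hN : 0 < N) {u : ℝ → ℝ}
    (hu : ContDiff ℝ 1 u) (hper : Function.Periodic u 1) :
    ∀ᶠ t in 𝓝 (0 : ℝ), ∃ Gt, IsCoveringLift (fun x => F (x + t * u x)) Gt s N := by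
  obtain ⟨ℓ, hℓ0, hℓ⟩ := hper.deriv.exists_norm_le (hu.continuous_deriv le_rfl)
  have ht : ∀ᶠ t in 𝓝 (0 : ℝ), |t| * ℓ < 1 :=
    ((continuous_abs.mul_const ℓ).tendsto' 0 0 (by simp)).eventually_lt_const one_pos
  filter_upwards [ht] with t ht
  have hd : ∀ x, HasDerivAt (fun x => F (x + t * u x))
      (deriv F (x + t * u x) * (1 + t * deriv u x)) x := fun x =>
    (h.hasDerivAt _).comp x
      ((hasDerivAt_id x).add ((hu.differentiable one_ne_zero x).hasDerivAt.const_mul t))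
  refine exists_isCoveringLift hN
    (h.contDiff.comp (contDiff_id.add (contDiff_const.mul hu))) h.sign (fun x => ?_) fun x => ?_
  · rw [(hd x).deriv, ← mul_assoc]
    refine mul_pos (h.pos _) ?_
    have h1 : |t * deriv u x| < 1 := by
      rw [abs_mul]
      exact (mul_le_mul_of_nonneg_left (hℓ x) (abs_nonneg t)).trans_lt ht
    linarith [neg_abs_le (t * deriv u x)]
  · rw [hper.comp_add_eq_of_sign h.sign, add_right_comm, h.map_add]

end IsCoveringLift

/-! ### Existence of the Gâteaux derivative -/

theorem exists_isCoveringLift_integral {ρ : C(UnitAddCircle, ℝ)} (hρ : ∀ x, 0 < ρ x)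
    (hρ1 : integralUnitAddCircle ℝ ρ = 1) :
    ∃ M Q, IsCoveringLift M Q 1 1 ∧ ∀ x : ℝ, HasDerivAt M (ρ (x : UnitAddCircle)) x := by
  have hρc : Continuous fun x : ℝ => ρ (x : UnitAddCircle) :=
    ρ.continuous.comp (AddCircle.continuous_mk' 1)
  have hd : ∀ x : ℝ, HasDerivAt (fun x => ∫ y in (0 : ℝ)..x, ρ (y : UnitAddCircle))
      (ρ (x : UnitAddCircle)) x := fun x => (hρc.integral_hasStrictDerivAt 0 x).hasDerivAt
  obtain ⟨Q, hQ⟩ := exists_isCoveringLift (N := 1) one_pos (contDiff_one_of_hasDerivAt hd hρc)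
    (Or.inl rfl) (fun x => by rw [(hd x).deriv, one_mul]; exact hρ _) fun x => by
      have h1 := (periodic_comp_coe ρ).intervalIntegral_add_eq x 0
      rw [zero_add, ← integralUnitAddCircle_apply, hρ1] at h1
      rw [← intervalIntegral.integral_add_adjacent_intervals (b := x)
        (hρc.intervalIntegrable _ _) (hρc.intervalIntegrable _ _), h1, Nat.cast_one]
  exact ⟨_, Q, hQ, hd⟩

section Existence

variable {μ : Measure UnitAddCircle} [IsProbabilityMeasure μ]

/-- For a smooth gradient `u`, the first order image `w` of `u` is realized by measure preserving
maps. -/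
theorem eventually_exists_measurePreserving {F G : ℝ → ℝ} {s : ℝ} {N : ℕ}
    (h : IsCoveringLift F G s N) (hN : 0 < N) {ρ u w : C(UnitAddCircle, ℝ)} (hρ : ∀ x, 0 < ρ x)
    (hρ1 : integralUnitAddCircle ℝ ρ = 1)
    (hμ : μ = volume.withDensity fun x => ENNReal.ofReal (ρ x)) {Cρ : ℝ}
    (hρlip : ∀ x y : ℝ, |ρ (x : UnitAddCircle) - ρ (y : UnitAddCircle)| ≤ Cρ * |x - y|)
    (hinv : transfer F G s N (fun x => ρ (x : UnitAddCircle)) = fun x : ℝ => ρ (x : UnitAddCircle))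
    (hu : ContDiff ℝ 1 fun x : ℝ => u (x : UnitAddCircle)) {b : ℝ}
    (huw : ∀ x : ℝ, w (x : UnitAddCircle) * ρ (x : UnitAddCircle) = s * branchSum G N
      (fun y => ρ (y : UnitAddCircle) * u (y : UnitAddCircle)) x - b) {ε : ℝ} (hε : 0 < ε) :
    ∀ᶠ t in 𝓝 (0 : ℝ), ∃ Θ : UnitAddCircle → UnitAddCircle, MeasurePreserving Θ μ μ ∧ ∀ x : ℝ,
      dist (Θ (x : UnitAddCircle) + ((t * w (Θ (x : UnitAddCircle)) : ℝ) : UnitAddCircle))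
        (F (x + t * u (x : UnitAddCircle)) : UnitAddCircle) ≤ ε * |t| := by
  obtain ⟨M, Q, hMQ, hM⟩ := exists_isCoveringLift_integral hρ hρ1
  -- The two distribution functions have derivatives `ρ` and the transfer of `ρ`, which are equal.
  have hβ : ∃ β, ∀ x, s * branchSum G N M x + β = M x := by
    have hd : ∀ x, HasDerivAt (fun x => M x - s * branchSum G N M x) 0 x := fun x => by
      have := (hM x).sub (h.hasDerivAt_branchSum hM x)
      rwa [hinv, sub_self] at this
    refine ⟨M 0 - s * branchSum G N M 0, fun x => ?_⟩
    have := is_const_of_deriv_eq_zero (fun x => (hd x).differentiableAt) (fun x => (hd x).deriv) x 0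
    linarith
  obtain ⟨β, hβ⟩ := hβ
  have huper := periodic_comp_coe u
  obtain ⟨ℓ, -, hℓ⟩ := huper.deriv.exists_norm_le (hu.continuous_deriv le_rfl)
  have hulip : ∀ x y : ℝ, |u (x : UnitAddCircle) - u (y : UnitAddCircle)| ≤ ℓ * |x - y| := fun x y =>
    Convex.norm_image_sub_le_of_norm_deriv_le (f := fun x : ℝ => u (x : UnitAddCircle))
      (s := Set.univ) (x := y) (y := x)
      (fun z _ => hu.differentiable one_ne_zero z) (fun z _ => hℓ z) convex_univ trivial trivial
  filter_upwards [h.exists_isCoveringLift_comp_add_smul hN hu huper,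
    h.eventually_abs_rearrangement_sub_le hMQ hM (periodic_comp_coe ρ) (fun x => hρ _) hρlip huper
      hulip (periodic_comp_coe w) (w.continuous.comp (AddCircle.continuous_mk' 1)) huw hβ hε]
    with t ⟨Gt, hGt⟩ ht
  obtain ⟨Θ, hΘ, hΘl⟩ := hGt.exists_measurePreserving_rearrangement hN hρ hμ hMQ hM (β + t * b)
  refine ⟨Θ, hΘ, fun x => ?_⟩
  rw [hΘl, ← AddCircle.coe_add]
  exact (dist_coe_unitAddCircle_le _ _).trans (ht Gt hGt _)

theorem exists_continuousMap_transfer {𝕜 : Type*} [RCLike 𝕜] {F G : ℝ → ℝ} {s : ℝ} {N : ℕ}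
    (h : IsCoveringLift F G s N) {ρ : C(UnitAddCircle, ℝ)} (hρ : ∀ x, 0 < ρ x)
    (u : C(UnitAddCircle, 𝕜)) : ∃ w : C(UnitAddCircle, 𝕜), ∀ x : ℝ,
      w (x : UnitAddCircle) = ((s / ρ (x : UnitAddCircle) : ℝ) : 𝕜) * branchSum G N
        (fun y => ((ρ (y : UnitAddCircle) : ℝ) : 𝕜) * u (y : UnitAddCircle)) x := by
  have hcoe : Continuous fun x : ℝ => (x : UnitAddCircle) := AddCircle.continuous_mk' 1
  have hρc : Continuous fun x : ℝ => ρ (x : UnitAddCircle) := ρ.continuous.comp hcoe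
  have huc : Continuous fun x : ℝ => u (x : UnitAddCircle) := u.continuous.comp hcoe
  refine exists_continuousMap_of_periodic (Function.Periodic.mul
    (periodic_comp_coe fun x => ((s / ρ x : ℝ) : 𝕜))
    (h.branchSum_periodic (periodic_comp_coe fun x => ((ρ x : ℝ) : 𝕜) * u x))) ?_
  exact (RCLike.continuous_ofReal.comp (continuous_const.div hρc fun x => (hρ _).ne')).mul
    (h.branchSum_continuous ((RCLike.continuous_ofReal.comp hρc).mul huc))

/-- The first order image of a vector field, corrected to zero mean. -/
theorem exists_integral_eq_zero_transfer {F G : ℝ → ℝ} {s : ℝ} {N : ℕ}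
    (h : IsCoveringLift F G s N) {ρ : C(UnitAddCircle, ℝ)} (hρ : ∀ x, 0 < ρ x)
    (u : C(UnitAddCircle, ℝ)) : ∃ (w : C(UnitAddCircle, ℝ)) (b : ℝ),
      integralUnitAddCircle ℝ w = 0 ∧ ∀ x : ℝ,
      w (x : UnitAddCircle) * ρ (x : UnitAddCircle) = s * branchSum G N
        (fun y => ρ (y : UnitAddCircle) * u (y : UnitAddCircle)) x - b := by
  obtain ⟨w₀, hw₀⟩ := exists_continuousMap_transfer h hρ u
  -- Subtracting a multiple of `1 / ρ` changes `w ρ` by a constant only, and `1 / ρ` has positive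
  -- mean.
  let r : C(UnitAddCircle, ℝ) := ⟨fun x => (ρ x)⁻¹, ρ.continuous.inv₀ fun x => (hρ x).ne'⟩
  have hr : 0 < integralUnitAddCircle ℝ r := by
    rw [integralUnitAddCircle_apply]
    exact intervalIntegral.intervalIntegral_pos_of_pos
      ((r.continuous.comp (AddCircle.continuous_mk' 1)).intervalIntegrable _ _)
      (fun x => inv_pos.2 (hρ _)) one_pos
  refine ⟨w₀ - (integralUnitAddCircle ℝ w₀ / integralUnitAddCircle ℝ r) • r,
    integralUnitAddCircle ℝ w₀ / integralUnitAddCircle ℝ r, ?_, fun x => ?_⟩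
  · rw [map_sub, map_smul, smul_eq_mul, div_mul_cancel₀ _ hr.ne', sub_self]
  · have := (hρ (x : UnitAddCircle)).ne'
    simp only [ContinuousMap.sub_apply, ContinuousMap.smul_apply, hw₀, smul_eq_mul,
      ContinuousMap.coe_mk, r, RCLike.ofReal_real_eq_id, id_eq]
    field_simp

/-- Minkowski's inequality; since `Θ` preserves `μ`, `D₂ ∘ Θ` has the norm of `D₂`. -/
theorem eLpNorm_le_of_ae_norm_le {D₁ D₂ : Lp ℝ 2 μ} {Θ : UnitAddCircle → UnitAddCircle}
    (hΘ : MeasurePreserving Θ μ μ) {a b c : ℝ} (ha : 0 ≤ a) (hb : 0 ≤ b) (hc : 0 ≤ c)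
    {f : UnitAddCircle → ℝ} (hf : ∀ᵐ y ∂μ, ‖f y‖ ≤ a * ‖D₁ y‖ + b + c * ‖D₂ (Θ y)‖) :
    eLpNorm f 2 μ ≤ ENNReal.ofReal (a * ‖D₁‖ + b + c * ‖D₂‖) := by
  have hn : ∀ D : Lp ℝ 2 μ, eLpNorm D 2 μ = ENNReal.ofReal ‖D‖ := fun D => by
    rw [← Lp.enorm_def, ofReal_norm]
  let g₁ : UnitAddCircle → ℝ := a • fun y => ‖D₁ y‖
  let g₂ : UnitAddCircle → ℝ := fun _ => b
  let g₃ : UnitAddCircle → ℝ := c • fun y => ‖D₂ (Θ y)‖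
  have hD₂ : AEStronglyMeasurable D₂ μ := Lp.aestronglyMeasurable _
  have m1 : AEStronglyMeasurable g₁ μ := (Lp.aestronglyMeasurable D₁).norm.const_smul a
  have m2 : AEStronglyMeasurable g₂ μ := aestronglyMeasurable_const
  have m3 : AEStronglyMeasurable g₃ μ := (hD₂.comp_measurePreserving hΘ).norm.const_smul c
  have n1 : eLpNorm g₁ 2 μ = ENNReal.ofReal (a * ‖D₁‖) := by
    rw [eLpNorm_const_smul, eLpNorm_norm, hn, Real.enorm_of_nonneg ha, ← ENNReal.ofReal_mul ha]
  have n2 : eLpNorm g₂ 2 μ = ENNReal.ofReal b := by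
    rw [eLpNorm_const _ (by simp) (NeZero.ne μ), Real.enorm_of_nonneg hb]
    simp
  have n3 : eLpNorm g₃ 2 μ = ENNReal.ofReal (c * ‖D₂‖) := by
    have := eLpNorm_comp_measurePreserving (p := 2) hD₂ hΘ
    rw [eLpNorm_const_smul, eLpNorm_norm, show (fun y => D₂ (Θ y)) = D₂ ∘ Θ from rfl, this, hn,
      Real.enorm_of_nonneg hc, ← ENNReal.ofReal_mul hc]
  calc eLpNorm f 2 μ ≤ eLpNorm (g₁ + g₂ + g₃) 2 μ := eLpNorm_mono_ae_real hf
    _ ≤ eLpNorm (g₁ + g₂) 2 μ + eLpNorm g₃ 2 μ := eLpNorm_add_le (m1.add m2) m3 (by norm_num)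
    _ ≤ eLpNorm g₁ 2 μ + eLpNorm g₂ 2 μ + eLpNorm g₃ 2 μ := by
      gcongr
      exact eLpNorm_add_le m1 m2 (by norm_num)
    _ = _ := by
      rw [n1, n2, n3, ← ENNReal.ofReal_add (by positivity) hb,
        ← ENNReal.ofReal_add (by positivity) (by positivity)]

/-- The action of a covering on measures has a Gâteaux derivative at an invariant measure of
Lipschitz density. -/
theorem hasGateauxDeriv_tangentDual {F G : ℝ → ℝ} {s : ℝ} {N : ℕ}
    (h : IsCoveringLift F G s N) (hN : 0 < N) {Φ : UnitAddCircle → UnitAddCircle}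
    (hΦl : ∀ x : ℝ, Φ (x : UnitAddCircle) = (F x : UnitAddCircle)) (hΦ : MeasurePreserving Φ μ μ)
    {ρ a : C(UnitAddCircle, ℝ)} (hρ : ∀ x, 0 < ρ x) (hρ1 : integralUnitAddCircle ℝ ρ = 1)
    (hμ : μ = volume.withDensity fun x => ENNReal.ofReal (ρ x)) {Cρ : ℝ}
    (hρlip : ∀ x y : ℝ, |ρ (x : UnitAddCircle) - ρ (y : UnitAddCircle)| ≤ Cρ * |x - y|)
    (hinv : transfer F G s N (fun x => ρ (x : UnitAddCircle)) = fun x : ℝ => ρ (x : UnitAddCircle))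
    (ha : ∀ x : ℝ, a (x : UnitAddCircle) = deriv F x) :
    HasGateauxDeriv (fun ν => ν.map Φ) μ μ (tangentDual a hΦ) := by
  have hΦc := h.continuous_of_lift hΦl
  refine ⟨hΦ.map_eq, fun x => ?_, fun v => isLittleO_iff.2 fun η hη => ?_⟩
  · rw [hμ]
    exact withDensity_absolutelyContinuous _ _ (volume_singleton_unitAddCircle x)
  obtain ⟨K, hK0, hK⟩ := h.exists_abs_sub_le
  set L := tangentDual a hΦ
  -- Approximating `v` costs `K |t| ε` on the source side and `‖L‖ |t| ε` on the target side,
  -- together `η / 2 * |t|`; the rearrangement takes the other half.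
  set ε := η / (2 * (K + ‖L‖)) with hε
  have hKL : 0 < K + ‖L‖ := by positivity
  have hε0 : 0 < ε := by positivity
  obtain ⟨u, hu, hvu⟩ := exists_isSmoothGradient_norm_sub_lt v hε0
  have hu0 := integral_eq_zero_of_isSmoothGradient hu
  have huC : ContDiff ℝ 1 fun x : ℝ => u (x : UnitAddCircle) := by
    obtain ⟨f, hf, -, hfu⟩ := hu
    rw [show (fun x : ℝ => u (x : UnitAddCircle)) = deriv f from funext hfu]
    exact ((contDiff_infty_iff_deriv.1 hf).2).of_le (by exact_mod_cast le_top)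
  obtain ⟨w, b, hw0, huw⟩ := exists_integral_eq_zero_transfer h hρ u
  have hLu := tangentDual_toLp h hΦl hΦ hρ hμ ha hu0 hw0 huw
  set U : tangentL2 μ := ⟨ContinuousMap.toLp 2 μ ℝ u, toLp_mem_tangentL2 hu0⟩ with hU
  have hLvw : ‖ContinuousMap.toLp 2 μ ℝ w - (L v : Lp ℝ 2 μ)‖ ≤ ‖L‖ * ε := by
    have h1 : ContinuousMap.toLp 2 μ ℝ w - (L v : Lp ℝ 2 μ) = ((L (U - v) : tangentL2 μ) : Lp ℝ 2 μ) := by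
      rw [map_sub, Submodule.coe_sub, hLu]
    rw [h1, ← Submodule.coe_norm]
    refine (L.le_opNorm _).trans (mul_le_mul_of_nonneg_left ?_ L.opNorm_nonneg)
    rw [norm_sub_rev]
    exact hvu.le
  filter_upwards [eventually_exists_measurePreserving (μ := μ) h hN hρ hρ1 hμ hρlip hinv huC huw
    (half_pos hη)] with t ⟨Θ, hΘ, hΘd⟩
  -- `X` and `Y`, both defined on the circle with `μ`, are the coupling: `Y` has law `μ + t L v`
  -- because `Θ` preserves `μ`.
  set X : UnitAddCircle → UnitAddCircle := fun y =>
    Φ (y + ((t * (v : Lp ℝ 2 μ) y : ℝ) : UnitAddCircle))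
  set Y : UnitAddCircle → UnitAddCircle := fun y =>
    Θ y + ((t * (L v : Lp ℝ 2 μ) (Θ y) : ℝ) : UnitAddCircle)
  have hX : AEMeasurable X μ := hΦc.measurable.comp_aemeasurable (aemeasurable_add_smul _ t)
  have hY : AEMeasurable Y μ := AEMeasurable.comp_quasiMeasurePreserving
    (aemeasurable_add_smul (L v : Lp ℝ 2 μ) t) hΘ.quasiMeasurePreserving
  have hmX : (pushAlong μ t (v : Lp ℝ 2 μ)).map Φ = μ.map X :=
    AEMeasurable.map_map_of_aemeasurable hΦc.measurable.aemeasurable (aemeasurable_add_smul _ t)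
  have hmY : pushAlong μ t (L v : Lp ℝ 2 μ) = μ.map Y := by
    have := AEMeasurable.map_map_of_aemeasurable
      (g := fun x => x + ((t * (L v : Lp ℝ 2 μ) x : ℝ) : UnitAddCircle)) (f := Θ) (μ := μ)
      (by rw [hΘ.map_eq]; exact aemeasurable_add_smul _ t) hΘ.measurable.aemeasurable
    rw [hΘ.map_eq] at this
    exact this
  set D₁ : Lp ℝ 2 μ := (v : Lp ℝ 2 μ) - ContinuousMap.toLp 2 μ ℝ u
  set D₂ : Lp ℝ 2 μ := ContinuousMap.toLp 2 μ ℝ w - (L v : Lp ℝ 2 μ)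
  have hD₁ : D₁ =ᵐ[μ] fun y => (v : Lp ℝ 2 μ) y - u y := by
    filter_upwards [Lp.coeFn_sub (v : Lp ℝ 2 μ) (ContinuousMap.toLp 2 μ ℝ u),
      ContinuousMap.coeFn_toLp (𝕜 := ℝ) (p := 2) μ u] with y h1 h2
    rw [h1, Pi.sub_apply, h2]
  have hD₂ : D₂ =ᵐ[μ] fun y => w y - (L v : Lp ℝ 2 μ) y := by
    filter_upwards [Lp.coeFn_sub (ContinuousMap.toLp 2 μ ℝ w) (L v : Lp ℝ 2 μ),
      ContinuousMap.coeFn_toLp (𝕜 := ℝ) (p := 2) μ w] with y h1 h2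
    rw [h1, Pi.sub_apply, h2]
  have hpt : ∀ᵐ y ∂μ, ‖dist (X y) (Y y)‖ ≤
      K * |t| * ‖D₁ y‖ + η / 2 * |t| + |t| * ‖D₂ (Θ y)‖ := by
    filter_upwards [hD₁, hΘ.quasiMeasurePreserving.ae_eq_comp hD₂] with y h1 h2
    obtain ⟨z, rfl⟩ := QuotientAddGroup.mk_surjective y
    simp only [Function.comp_apply] at h2
    rw [h1, h2, Real.norm_of_nonneg dist_nonneg, Real.norm_eq_abs, Real.norm_eq_abs]
    set vz := (v : Lp ℝ 2 μ) (z : UnitAddCircle)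
    have e1 : dist (X (z : UnitAddCircle)) (F (z + t * u (z : UnitAddCircle)) : UnitAddCircle) ≤
        K * |t| * |vz - u (z : UnitAddCircle)| := by
      have : X (z : UnitAddCircle) = (F (z + t * vz) : UnitAddCircle) := by
        rw [← hΦl, AddCircle.coe_add]
      rw [this]
      refine (dist_coe_unitAddCircle_le _ _).trans ((hK _ _).trans (le_of_eq ?_))
      rw [mul_assoc, ← abs_mul]
      congr 2
      ring
    have e2 := hΘd z
    rw [dist_comm] at e2
    have e3 : dist (Θ (z : UnitAddCircle) +
        ((t * w (Θ (z : UnitAddCircle)) : ℝ) : UnitAddCircle)) (Y (z : UnitAddCircle)) ≤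
        |t| * |w (Θ (z : UnitAddCircle)) - (L v : Lp ℝ 2 μ) (Θ (z : UnitAddCircle))| := by
      rw [dist_add_left]
      refine (dist_coe_unitAddCircle_le _ _).trans (le_of_eq ?_)
      rw [← mul_sub, abs_mul]
    exact (dist_triangle _ _ _).trans (add_le_add ((dist_triangle _ _ _).trans
      (add_le_add e1 e2)) e3)
  have hbound : eLpNorm (fun y => dist (X y) (Y y)) 2 μ ≤ ENNReal.ofReal (η * |t|) := by
    refine (eLpNorm_le_of_ae_norm_le hΘ (by positivity) (by positivity) (by positivity) hpt).trans
      (ENNReal.ofReal_le_ofReal ?_)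
    have e1 : (K + ‖L‖) * ε = η / 2 := by rw [hε]; field_simp
    have e2 := mul_le_mul_of_nonneg_left hvu.le (show 0 ≤ K * |t| by positivity)
    have e3 := mul_le_mul_of_nonneg_left hLvw (abs_nonneg t)
    calc K * |t| * ‖D₁‖ + η / 2 * |t| + |t| * ‖D₂‖
        ≤ K * |t| * ε + η / 2 * |t| + |t| * (‖L‖ * ε) := by linarith
      _ = η * |t| := by linear_combination |t| * e1
  rw [hmX, hmY, Real.norm_eq_abs, Real.norm_eq_abs,
    abs_of_nonneg (show 0 ≤ wasserstein _ _ from ENNReal.toReal_nonneg)]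
  exact wasserstein_map_le hX hY (by positivity) hbound

end Existence

/-! ### The growth rate of the weighted transfer operator -/

/-- The growth rate of the iterates of a positive homogeneous operator, applied to the constant
function `1`. -/
theorem exists_tendsto_isLUB_iterate {X : Type*} [Nonempty X] {T : (X → ℝ) → X → ℝ}
    (hmono : Monotone T) (hsmul : ∀ (c : ℝ) f, T (fun x => c * f x) = fun x => c * T f x) {m D : ℝ}
    (hm1 : 1 ≤ m) (hm : ∀ x, m ≤ T (fun _ => 1) x) (hD : ∀ x, T (fun _ => 1) x ≤ D) :
    ∃ (R : ℝ) (σ : ℕ → ℝ), (∀ n, IsLUB (Set.range (T^[n] fun _ => 1)) (σ n)) ∧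
      Tendsto (fun n : ℕ => σ n ^ (1 / (n : ℝ))) atTop (𝓝 R) ∧ m ≤ R := by
  have hconst : ∀ c : ℝ, T (fun _ => c) = fun x => c * T (fun _ => 1) x := fun c => by
    rw [← hsmul]
    simp
  have hiter : ∀ (n : ℕ) (c : ℝ) f, T^[n] (fun x => c * f x) = fun x => c * T^[n] f x := by
    intro n c f
    induction n with
    | zero => rfl
    | succ n ih => rw [Function.iterate_succ_apply', ih, hsmul, Function.iterate_succ_apply']
  have hm0 : 0 < m := by linarith
  have hD0 : 0 ≤ D := by
    obtain ⟨x⟩ := ‹Nonempty X›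
    linarith [hm x, hD x]
  have hlow : ∀ n x, m ^ n ≤ T^[n] (fun _ => 1) x := fun n => by
    induction n with
    | zero => simp
    | succ n ih =>
      intro x
      rw [Function.iterate_succ_apply']
      refine le_trans ?_ (hmono ih x)
      rw [hconst, pow_succ]
      exact mul_le_mul_of_nonneg_left (hm x) (by positivity)
  have hup : ∀ n x, T^[n] (fun _ => 1) x ≤ D ^ n := fun n => by
    induction n with
    | zero => simp
    | succ n ih =>
      intro x
      rw [Function.iterate_succ_apply']
      refine (hmono ih x).trans ?_
      rw [hconst, pow_succ]
      exact mul_le_mul_of_nonneg_left (hD x) (by positivity)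
  set σ : ℕ → ℝ := fun n => sSup (Set.range (T^[n] fun _ => 1))
  have hσ : ∀ n, IsLUB (Set.range (T^[n] fun _ => 1)) (σ n) := fun n =>
    isLUB_csSup (Set.range_nonempty _) ⟨D ^ n, by rintro _ ⟨x, rfl⟩; exact hup n x⟩
  have hσlow : ∀ n, m ^ n ≤ σ n := fun n => by
    obtain ⟨x⟩ := ‹Nonempty X›
    exact (hlow n x).trans ((hσ n).1 ⟨x, rfl⟩)
  have hσpos : ∀ n, 0 < σ n := fun n => (pow_pos hm0 n).trans_le (hσlow n)
  -- Positivity and homogeneity make the suprema submultiplicative, so Fekete's lemma applies to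
  -- their logarithms.
  have hsub : Subadditive fun n => Real.log (σ n) := fun n k => by
    rw [← Real.log_mul (hσpos n).ne' (hσpos k).ne']
    refine Real.log_le_log (hσpos _) ((hσ (n + k)).2 ?_)
    rintro _ ⟨x, rfl⟩
    rw [Function.iterate_add_apply]
    have h1 : T^[k] (fun _ => 1) ≤ fun _ => σ k * 1 := fun x => by
      rw [mul_one]
      exact (hσ k).1 ⟨x, rfl⟩
    refine (hmono.iterate n h1 x).trans ?_
    rw [hiter n (σ k) fun _ => 1, mul_comm (σ n)]
    exact mul_le_mul_of_nonneg_left ((hσ n).1 ⟨x, rfl⟩) (hσpos k).le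
  have hbdd : BddBelow (Set.range fun n : ℕ => Real.log (σ n) / n) := ⟨0, by
    rintro _ ⟨n, rfl⟩
    exact div_nonneg (Real.log_nonneg ((one_le_pow₀ hm1).trans (hσlow n))) (Nat.cast_nonneg n)⟩
  have hlim : Tendsto (fun n : ℕ => σ n ^ (1 / (n : ℝ))) atTop (𝓝 (Real.exp hsub.lim)) := by
    have := (Real.continuous_exp.tendsto _).comp (hsub.tendsto_lim hbdd)
    refine this.congr fun n => ?_
    rw [Real.rpow_def_of_pos (hσpos n), Function.comp_apply, mul_one_div]
  refine ⟨_, σ, hσ, hlim, ge_of_tendsto hlim ?_⟩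
  filter_upwards [eventually_ge_atTop 1] with n hn
  calc m = (m ^ n) ^ (1 / (n : ℝ)) := by
        rw [one_div, Real.pow_rpow_inv_natCast hm0.le (by omega)]
    _ ≤ σ n ^ (1 / (n : ℝ)) :=
        Real.rpow_le_rpow (by positivity) (hσlow n) (by positivity)

theorem exists_isTransferRadius {F G : ℝ → ℝ} {s : ℝ} {N : ℕ}
    (h : IsCoveringLift F G s N) (hN : 0 < N) {Φ : UnitAddCircle → UnitAddCircle}
    (hΦl : ∀ x : ℝ, Φ (x : UnitAddCircle) = (F x : UnitAddCircle))
    {ρ : C(UnitAddCircle, ℝ)} (hρ : ∀ x, 0 < ρ x)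
    (hinv : transfer F G s N (fun x => ρ (x : UnitAddCircle)) = fun x : ℝ => ρ (x : UnitAddCircle))
    {m : ℝ} (hm : 1 ≤ m) (hFm : ∀ x, m ≤ |deriv F x|) :
    ∃ R, IsTransferRadius Φ ρ R ∧ m ≤ R := by
  have hT : ∀ f (x : ℝ), transferOp Φ ρ f (x : UnitAddCircle) = branchSum G N (fun y =>
      ρ (y : UnitAddCircle) / ρ (x : UnitAddCircle) * f (y : UnitAddCircle)) x := fun f x =>
    h.finsum_fiber hN hΦl (fun y => ρ y / ρ (x : UnitAddCircle) * f y) x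
  obtain ⟨R₀, hR₀0, hR₀⟩ := (periodic_comp_coe ρ).exists_norm_le
    (ρ.continuous.comp (AddCircle.continuous_mk' 1))
  obtain ⟨c, hc0, hc⟩ := (periodic_comp_coe ρ).exists_pos_le
    (ρ.continuous.comp (AddCircle.continuous_mk' 1)) fun x => hρ _
  have hext : ∀ {p : UnitAddCircle → Prop}, (∀ z : ℝ, p (z : UnitAddCircle)) → ∀ x, p x :=
    fun hp x => by
      obtain ⟨z, rfl⟩ := QuotientAddGroup.mk_surjective x
      exact hp z
  have hmono : Monotone (transferOp Φ ρ) := fun f g hfg => hext fun z => by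
    rw [hT, hT]
    exact Finset.sum_le_sum fun k _ => mul_le_mul_of_nonneg_left (hfg _) (div_pos (hρ _) (hρ _)).le
  have hsmul : ∀ (a : ℝ) f, transferOp Φ ρ (fun x => a * f x) = fun x => a * transferOp Φ ρ f x :=
    fun a f => funext <| hext fun z => by
      rw [hT, hT, branchSum, branchSum, Finset.mul_sum]
      exact Finset.sum_congr rfl fun k _ => by ring
  have hlow : ∀ x, m ≤ transferOp Φ ρ (fun _ => 1) x := hext fun z => by
    -- The weights `1 / |F'| ≤ 1 / m` sum against `ρ` to `ρ`; dropping them gains a factor `m`.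
    have h4 : ∑ k ∈ Finset.range N, ρ (G (z + k) : UnitAddCircle) * (s / deriv F (G (z + k))) =
        ρ (z : UnitAddCircle) := congrFun hinv z
    have h5 : m * ρ (z : UnitAddCircle) ≤ ∑ k ∈ Finset.range N, ρ (G (z + k) : UnitAddCircle) := by
      rw [← h4, Finset.mul_sum]
      refine Finset.sum_le_sum fun k _ => ?_
      rw [mul_left_comm, h.weight_eq]
      refine mul_le_of_le_one_right (hρ _).le ?_
      rw [mul_inv_le_iff₀ (abs_pos.2 (h.deriv_ne _)), one_mul]
      exact hFm _
    rw [hT, branchSum]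
    simp only [mul_one]
    rw [← Finset.sum_div, le_div_iff₀ (hρ _)]
    exact h5
  have hup : ∀ x, transferOp Φ ρ (fun _ => 1) x ≤ N * (R₀ / c) := hext fun z => by
    rw [hT, branchSum]
    refine (Finset.sum_le_sum (g := fun _ => R₀ / c) fun k _ => ?_).trans (by simp)
    rw [mul_one]
    exact div_le_div₀ hR₀0.le ((le_abs_self _).trans (hR₀ _)) hc0 (hc _)
  obtain ⟨R, σ, h1, h2, h3⟩ := exists_tendsto_isLUB_iterate hmono hsmul hm hlow hup
  exact ⟨R, ⟨σ, h1, h2⟩, h3⟩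

/-! ### Eigenfunctions of infinite multiplicity -/

open Polynomial in
/-- A hyperplane contains an infinite linearly independent family of every infinite-dimensional
space. -/
theorem exists_linearIndependent_mem_range {𝕜 V : Type*} [Field 𝕜] [AddCommGroup V] [Module 𝕜 V]
    (ι : 𝕜[X] →ₗ[𝕜] V) (hι : Function.Injective ι) (f : V →ₗ[𝕜] 𝕜) :
    ∃ v : ℕ → V, LinearIndependent 𝕜 v ∧ ∀ i, v i ∈ LinearMap.range ι ∧ f (v i) = 0 := by
  set K := LinearMap.ker (f ∘ₗ ι)
  -- A finite-dimensional kernel of a functional would make the polynomial ring finite-dimensional.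
  have hK : ¬ Module.Finite 𝕜 K := fun hfin => by
    refine Polynomial.not_finite (R := 𝕜) ⟨Submodule.fg_of_fg_map_of_fg_inf_ker (f ∘ₗ ι) ?_ ?_⟩
    · exact IsNoetherian.noetherian _
    · rw [top_inf_eq]
      exact Module.Finite.iff_fg.1 hfin
  let b := Module.Basis.ofVectorSpace 𝕜 K
  have hinf : Infinite (Module.Basis.ofVectorSpaceIndex 𝕜 K) := by
    by_contra hfin
    have := not_infinite_iff_finite.1 hfin
    exact hK (Module.Finite.of_basis b)
  let e := Infinite.natEmbedding (Module.Basis.ofVectorSpaceIndex 𝕜 K)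
  refine ⟨fun i => ι (b (e i)), ?_, fun i => ⟨⟨_, rfl⟩, (b (e i)).2⟩⟩
  have h1 : LinearIndependent 𝕜 fun i => b (e i) := b.linearIndependent.comp e e.injective
  have h2 := h1.map' (ι ∘ₗ K.subtype) (LinearMap.ker_eq_bot.2 (hι.comp K.injective_subtype))
  exact h2

open Polynomial in
/-- The kernel of the transfer operator is infinite-dimensional. -/
theorem exists_injective_branchSum_eq_zero (𝕜 : Type*) [RCLike 𝕜] {F G : ℝ → ℝ} {s : ℝ} {N : ℕ}
    (h : IsCoveringLift F G s N) (hN : 2 ≤ N) {ρ : C(UnitAddCircle, ℝ)} (hρ : ∀ x, 0 < ρ x) :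
    ∃ ι : 𝕜[X] →ₗ[𝕜] C(UnitAddCircle, 𝕜), Function.Injective ι ∧ ∀ p x, branchSum G N
      (fun y => ((ρ (y : UnitAddCircle) : ℝ) : 𝕜) * ι p (y : UnitAddCircle)) x = 0 := by
  have hN0 : (0 : ℝ) < N := by positivity
  have hρc : Continuous fun x : ℝ => ρ (x : UnitAddCircle) :=
    ρ.continuous.comp (AddCircle.continuous_mk' 1)
  -- `χ₀` has period `N`: the difference `χ₀ (F y) - χ₀ (F y + 1)` is well defined on the circle and
  -- telescopes to zero over each fibre.
  let χ₀ : ℝ → ℝ := fun x => Real.cos (2 * Real.pi * x / N)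
  have hχ₀N : ∀ x, χ₀ (x + N) = χ₀ x := fun x => by
    simp only [χ₀]
    rw [mul_add, add_div, mul_div_cancel_right₀ _ hN0.ne', Real.cos_add_two_pi]
  have hχ₀ : ∀ x, χ₀ (x + s * N) = χ₀ x := fun x => by
    rcases h.sign with rfl | rfl
    · simpa using hχ₀N x
    · have := hχ₀N (x + -1 * N)
      rw [← this]
      congr 1
      ring
  have hχ₀c : Continuous χ₀ := by fun_prop
  have hFc := h.contDiff.continuous
  obtain ⟨g, hg⟩ : ∃ g : C(UnitAddCircle, 𝕜), ∀ y : ℝ, g (y : UnitAddCircle) =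
      (((χ₀ (F y) - χ₀ (F y + 1)) / ρ (y : UnitAddCircle) : ℝ) : 𝕜) := by
    refine exists_continuousMap_of_periodic (fun y => ?_) (RCLike.continuous_ofReal.comp ?_)
    · rw [h.map_add_one, add_right_comm, hχ₀, hχ₀]
      simp
    · exact ((hχ₀c.comp hFc).sub (hχ₀c.comp (hFc.add continuous_const))).div hρc
        fun y => (hρ _).ne'
  have hsin : Function.Periodic (fun x => ((Real.sin (2 * Real.pi * x) : ℝ) : 𝕜)) 1 := fun x => by
    simp only [mul_add, mul_one, Real.sin_add_two_pi]
  -- `τ` is constant on fibres, so multiplying by polynomials in `τ` stays in the kernel.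
  obtain ⟨τ, hτ⟩ := exists_continuousMap_of_periodic (h.periodic_comp hsin)
    (RCLike.continuous_ofReal.comp (Real.continuous_sin.comp (continuous_const.mul hFc)))
  let ι : 𝕜[X] →ₗ[𝕜] C(UnitAddCircle, 𝕜) :=
    LinearMap.mulLeft 𝕜 g ∘ₗ (aeval τ : 𝕜[X] →ₐ[𝕜] C(UnitAddCircle, 𝕜)).toLinearMap
  have hι : ∀ p (y : ℝ), ι p (y : UnitAddCircle) =
      (((χ₀ (F y) - χ₀ (F y + 1)) / ρ (y : UnitAddCircle) : ℝ) : 𝕜) *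
        p.eval ((Real.sin (2 * Real.pi * F y) : ℝ) : 𝕜) := fun p y => by
    change g (y : UnitAddCircle) * (aeval τ p) (y : UnitAddCircle) = _
    rw [aeval_continuousMap_apply, hg, hτ]
  refine ⟨ι, (injective_iff_map_eq_zero ι).2 fun p hp => ?_, fun p x => ?_⟩
  -- Near `z = 0` the telescoping factor does not vanish, as `cos (2π / N) < 1` for `N ≥ 2`. A
  -- polynomial sent to zero then has all small real `z` as roots.
  · have hne : ∀ᶠ z in 𝓝 (0 : ℝ), χ₀ (Real.arcsin z / (2 * Real.pi)) -
        χ₀ (Real.arcsin z / (2 * Real.pi) + 1) ≠ 0 := by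
      have hc : Continuous fun z => χ₀ (Real.arcsin z / (2 * Real.pi)) -
          χ₀ (Real.arcsin z / (2 * Real.pi) + 1) :=
        (hχ₀c.comp (Real.continuous_arcsin.div_const _)).sub
          (hχ₀c.comp ((Real.continuous_arcsin.div_const _).add continuous_const))
      refine hc.continuousAt.eventually_ne ?_
      have hlt : Real.cos (2 * Real.pi / N) < Real.cos 0 := by
        refine Real.cos_lt_cos_of_nonneg_of_le_pi le_rfl ?_ (by positivity)
        rw [div_le_iff₀ hN0, mul_comm]
        exact mul_le_mul_of_nonneg_left (by exact_mod_cast hN) Real.pi_pos.le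
      simp only [χ₀, Real.arcsin_zero, zero_div, mul_zero, zero_add, mul_one]
      exact (sub_pos.2 hlt).ne'
    have hz : ∀ᶠ z in 𝓝 (0 : ℝ), p.IsRoot ((z : ℝ) : 𝕜) := by
      filter_upwards [hne, Icc_mem_nhds (show (-1 : ℝ) < 0 by norm_num) one_pos] with z hz hz1
      have h1 := hι p (G (Real.arcsin z / (2 * Real.pi)))
      rw [hp, h.right_inv, mul_div_cancel₀ _ (by positivity : 2 * Real.pi ≠ 0),
        Real.sin_arcsin hz1.1 hz1.2, ContinuousMap.zero_apply, eq_comm, mul_eq_zero,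
        RCLike.ofReal_eq_zero] at h1
      exact h1.resolve_left (div_ne_zero hz (hρ _).ne')
    refine eq_zero_of_infinite_isRoot p
      (((infinite_of_mem_nhds 0 hz).image (RCLike.ofReal_injective (K := 𝕜)).injOn).mono ?_)
    rintro _ ⟨z, hz, rfl⟩
    exact hz
  · have h1 : (fun y : ℝ => ((ρ (y : UnitAddCircle) : ℝ) : 𝕜) * ι p (y : UnitAddCircle)) =
        fun y => (fun x => p.eval ((Real.sin (2 * Real.pi * x) : ℝ) : 𝕜)) (F y) *
          ((χ₀ (F y) - χ₀ (F y + 1) : ℝ) : 𝕜) := funext fun y => by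
      rw [hι, mul_comm (p.eval _), ← mul_assoc, ← RCLike.ofReal_mul,
        mul_div_cancel₀ _ (hρ _).ne']
    have h2 := Finset.sum_range_sub' (fun k : ℕ => χ₀ (x + k)) N
    have hper : Function.Periodic (fun x => p.eval ((Real.sin (2 * Real.pi * x) : ℝ) : 𝕜)) 1 :=
      fun x => congrArg (fun z => p.eval z) (hsin x)
    rw [h1, h.branchSum_comp_mul hper]
    simp only [branchSum, h.right_inv]
    rw [← RCLike.ofReal_sum]
    have h3 : ∑ k ∈ Finset.range N, (χ₀ (x + k) - χ₀ (x + k + 1)) = 0 := by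
      simp only [Nat.cast_add, Nat.cast_one, Nat.cast_zero, add_zero, hχ₀N, sub_self,
        ← add_assoc] at h2
      exact h2
    rw [h3, RCLike.ofReal_zero, mul_zero]

/-- Every number of modulus less than the minimal expansion is an eigenvalue of infinite
multiplicity of the transfer operator on continuous functions of zero mean. -/
theorem exists_linearIndependent_eigenfunctions {𝕜 : Type*} [RCLike 𝕜] {F G : ℝ → ℝ} {s : ℝ} {N : ℕ}
    (h : IsCoveringLift F G s N) (hN : 2 ≤ N) {Φ : UnitAddCircle → UnitAddCircle}
    (hΦl : ∀ x : ℝ, Φ (x : UnitAddCircle) = (F x : UnitAddCircle))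
    {ρ : C(UnitAddCircle, ℝ)} (hρ : ∀ x, 0 < ρ x)
    (hinv : transfer F G s N (fun x => ρ (x : UnitAddCircle)) = fun x : ℝ => ρ (x : UnitAddCircle))
    {m : ℝ} (hm : 0 < m) (hFm : ∀ x, m ≤ |deriv F x|) {α : 𝕜} (hα : ‖α‖ < m) :
    ∃ v : ℕ → C(UnitAddCircle, 𝕜), LinearIndependent 𝕜 v ∧ ∀ i,
      integralUnitAddCircle 𝕜 (v i) = 0 ∧ ∀ x : ℝ, (α * v i (x : UnitAddCircle)) *
        ((ρ (x : UnitAddCircle) : ℝ) : 𝕜) = (s : 𝕜) * branchSum G N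
          (fun y => ((ρ (y : UnitAddCircle) : ℝ) : 𝕜) * v i (y : UnitAddCircle)) x := by
  have hcoe : Continuous fun x : ℝ => (x : UnitAddCircle) := AddCircle.continuous_mk' 1
  have hext : ∀ {f g : C(UnitAddCircle, 𝕜)}, (∀ z : ℝ, f (z : UnitAddCircle) =
      g (z : UnitAddCircle)) → f = g := fun hfg => by
    ext x
    obtain ⟨z, rfl⟩ := QuotientAddGroup.mk_surjective x
    exact hfg z
  have hρ𝕜 : ∀ x, ((ρ x : ℝ) : 𝕜) ≠ 0 := fun x => RCLike.ofReal_ne_zero.2 (hρ x).ne'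
  choose A₀ hA₀ using exists_continuousMap_transfer (𝕜 := 𝕜) h hρ
  let A : C(UnitAddCircle, 𝕜) →ₗ[𝕜] C(UnitAddCircle, 𝕜) :=
    { toFun := A₀
      map_add' := fun f g => hext fun z => by
        simp only [ContinuousMap.add_apply, hA₀, branchSum, mul_add, Finset.sum_add_distrib]
      map_smul' := fun c f => hext fun z => by
        simp only [ContinuousMap.smul_apply, hA₀, branchSum, smul_eq_mul, RingHom.id_apply,
          Finset.mul_sum]
        exact Finset.sum_congr rfl fun k _ => by ring }
  have hA : ∀ (u : C(UnitAddCircle, 𝕜)) (x : ℝ), A u (x : UnitAddCircle) =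
      ((s / ρ (x : UnitAddCircle) : ℝ) : 𝕜) * branchSum G N
        (fun y => ((ρ (y : UnitAddCircle) : ℝ) : 𝕜) * u (y : UnitAddCircle)) x := hA₀
  obtain ⟨r, hr⟩ : ∃ r : C(UnitAddCircle, 𝕜), ∀ y : ℝ,
      r (y : UnitAddCircle) = (((deriv F y)⁻¹ : ℝ) : 𝕜) :=
    exists_continuousMap_of_periodic (fun y => by rw [h.deriv_periodic])
      (RCLike.continuous_ofReal.comp (h.continuous_deriv.inv₀ h.deriv_ne))
  have hΦc := h.continuous_of_lift hΦl
  have hrm : ∀ x, ‖r x‖ ≤ m⁻¹ := fun x => by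
    obtain ⟨z, rfl⟩ := QuotientAddGroup.mk_surjective x
    rw [hr, RCLike.norm_ofReal, abs_inv]
    exact inv_anti₀ hm (hFm z)
  -- `B` is a right inverse of `A` of norm at most `1 / m`.
  let B : C(UnitAddCircle, 𝕜) →L[𝕜] C(UnitAddCircle, 𝕜) := LinearMap.mkContinuous
    { toFun := fun f => r * f.comp ⟨Φ, hΦc⟩
      map_add' := fun f g => by ext x; simp [mul_add]
      map_smul' := fun c f => by ext x; simp } m⁻¹ fun f => by
    refine (ContinuousMap.norm_le _ (by positivity)).2 fun x => ?_
    simp only [LinearMap.coe_mk, AddHom.coe_mk, ContinuousMap.mul_apply, norm_mul]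
    exact mul_le_mul (hrm x) (f.norm_coe_le_norm _) (norm_nonneg _) (by positivity)
  have hB : ∀ f (y : ℝ), B f (y : UnitAddCircle) =
      f (F y : UnitAddCircle) * (((deriv F y)⁻¹ : ℝ) : 𝕜) := fun f y => by
    change r (y : UnitAddCircle) * f (Φ (y : UnitAddCircle)) = _
    rw [hr, hΦl, mul_comm]
  have hAB : ∀ f, A (B f) = f := fun f => hext fun x => by
    have h1 : (fun y : ℝ => ((ρ (y : UnitAddCircle) : ℝ) : 𝕜) * B f (y : UnitAddCircle)) =
        fun y : ℝ => (fun x : ℝ => f (x : UnitAddCircle)) (F y) *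
          ((ρ (y : UnitAddCircle) * (deriv F y)⁻¹ : ℝ) : 𝕜) := funext fun y => by
      rw [hB, RCLike.ofReal_mul]
      ring
    rw [hA, h1, h.branchSum_comp_mul (periodic_comp_coe f)]
    simp only [branchSum]
    rw [← RCLike.ofReal_sum, mul_left_comm, ← RCLike.ofReal_mul]
    have h2 : ∑ k ∈ Finset.range N, ρ (G (x + k) : UnitAddCircle) * (s / deriv F (G (x + k))) =
        ρ (x : UnitAddCircle) := congrFun hinv x
    have h3 : s / ρ (x : UnitAddCircle) * ∑ k ∈ Finset.range N,
        ρ (G (x + k) : UnitAddCircle) * (deriv F (G (x + k)))⁻¹ = 1 := by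
      rw [div_mul_eq_mul_div, div_eq_one_iff_eq (hρ _).ne', ← h2, Finset.mul_sum]
      exact Finset.sum_congr rfl fun k _ => by ring
    rw [h3, RCLike.ofReal_one, mul_one]
  have hαB : ‖α • B‖ < 1 := by
    refine (ContinuousLinearMap.opNorm_smul_le α B).trans_lt ?_
    have h1 : ‖B‖ ≤ m⁻¹ := LinearMap.mkContinuous_norm_le _ (by positivity) _
    calc ‖α‖ * ‖B‖ ≤ ‖α‖ * m⁻¹ := mul_le_mul_of_nonneg_left h1 (norm_nonneg _)
      _ < m * m⁻¹ := mul_lt_mul_of_pos_right hα (by positivity)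
      _ = 1 := mul_inv_cancel₀ hm.ne'
  -- Neumann series: `v = S⁻¹ f` solves `v = f + α B v`, and applying `A` with `A f = 0` gives `A v
  -- = α v`.
  let S := Units.oneSub (α • B) hαB
  have hS : ∀ f, (↑S⁻¹ : C(UnitAddCircle, 𝕜) →L[𝕜] C(UnitAddCircle, 𝕜)) f =
      f + α • B ((↑S⁻¹ : C(UnitAddCircle, 𝕜) →L[𝕜] C(UnitAddCircle, 𝕜)) f) := fun f => by
    have h1 := congrArg (fun T : C(UnitAddCircle, 𝕜) →L[𝕜] C(UnitAddCircle, 𝕜) => T f) S.mul_inv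
    have h2 : (1 - α • B) ((↑S⁻¹ : C(UnitAddCircle, 𝕜) →L[𝕜] C(UnitAddCircle, 𝕜)) f) = f := h1
    rw [sub_apply] at h2
    exact sub_eq_iff_eq_add.1 h2
  have hSinj : Function.Injective (↑S⁻¹ : C(UnitAddCircle, 𝕜) →L[𝕜] C(UnitAddCircle, 𝕜)) := by
    intro f g hfg
    have h1 := hS f
    have h2 := hS g
    rw [hfg] at h1
    exact add_right_cancel (h1.symm.trans h2)
  obtain ⟨ι, hιinj, hι⟩ := exists_injective_branchSum_eq_zero 𝕜 h hN hρ
  obtain ⟨v, hv, hvr⟩ := exists_linearIndependent_mem_range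
    ((↑S⁻¹ : C(UnitAddCircle, 𝕜) →L[𝕜] C(UnitAddCircle, 𝕜)).toLinearMap ∘ₗ ι)
    (hSinj.comp hιinj) (integralUnitAddCircle 𝕜).toLinearMap
  refine ⟨v, hv, fun i => ⟨(hvr i).2, fun x => ?_⟩⟩
  obtain ⟨p, hp⟩ := (hvr i).1
  have h1 : A (ι p) = 0 := hext fun z => by rw [hA, hι, mul_zero, ContinuousMap.zero_apply]
  have h2 : A (v i) = α • v i := by
    have h3 : v i = ι p + α • B (v i) := by
      rw [← hp]
      exact hS (ι p)
    conv_lhs => rw [h3]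
    rw [map_add, map_smul, h1, hAB, zero_add]
  have h4 := hA (v i) x
  rw [h2, ContinuousMap.smul_apply, smul_eq_mul] at h4
  rw [h4, RCLike.ofReal_div, mul_right_comm, div_mul_cancel₀ _ (hρ𝕜 _)]

/-! ### Expanding maps are coverings of degree at least two in absolute value -/

/-- `F'` never vanishes, so it has a constant sign; `F (x + 1) - F x` is continuous and
integer-valued, so constant. By the mean value theorem this integer is a value of `F'`, hence of
absolute value above one. -/
theorem exists_isCoveringLift_of_one_lt_abs_deriv {Φ : UnitAddCircle → UnitAddCircle} {F : ℝ → ℝ}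
    (hF : ContDiff ℝ 1 F) (hΦl : ∀ x : ℝ, Φ (x : UnitAddCircle) = (F x : UnitAddCircle))
    (hexp : ∀ x : ℝ, 1 < |deriv F x|) :
    ∃ (G : ℝ → ℝ) (s : ℝ) (N : ℕ), 2 ≤ N ∧ IsCoveringLift F G s N := by
  have hne : ∀ x, deriv F x ≠ 0 := fun x h0 => by
    have := hexp x
    rw [h0, abs_zero] at this
    linarith
  have hdc : Continuous (deriv F) := hF.continuous_deriv le_rfl
  obtain ⟨s, hs, hpos⟩ : ∃ s : ℝ, (s = 1 ∨ s = -1) ∧ ∀ x, 0 < s * deriv F x := by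
    rcases (hne 0).lt_or_gt with h0 | h0
    · refine ⟨-1, Or.inr rfl, fun x => ?_⟩
      by_contra! hx
      obtain ⟨y, hy⟩ := mem_range_of_exists_le_of_exists_ge hdc (c := 0) ⟨0, h0.le⟩
        ⟨x, by linarith⟩
      exact hne y hy
    · refine ⟨1, Or.inl rfl, fun x => ?_⟩
      by_contra! hx
      obtain ⟨y, hy⟩ := mem_range_of_exists_le_of_exists_ge hdc (c := 0) ⟨x, by linarith⟩
        ⟨0, h0.le⟩
      exact hne y hy
  have hint : ∀ x, ∃ n : ℤ, F (x + 1) - F x = n := fun x => by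
    have h1 : ((F (x + 1) - F x : ℝ) : UnitAddCircle) = 0 := by
      rw [AddCircle.coe_sub, ← hΦl, ← hΦl, AddCircle.coe_add, AddCircle.coe_period, add_zero,
        sub_self]
    obtain ⟨n, hn⟩ := AddCircle.coe_eq_zero_iff 1 |>.1 h1
    exact ⟨n, by rw [← hn]; simp⟩
  choose n hn using hint
  have hnc : Continuous n := by
    refine Int.isClosedEmbedding_coe_real.isInducing.continuous_iff.2 ?_
    rw [show ((↑) : ℤ → ℝ) ∘ n = fun x => F (x + 1) - F x from funext fun x => (hn x).symm]
    have := hF.continuous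
    fun_prop
  have hn0 : ∀ x, F (x + 1) = F x + n 0 := fun x => by
    rw [← PreconnectedSpace.constant inferInstance hnc (x := x) (y := 0), ← hn x]
    ring
  obtain ⟨c, -, hc⟩ := exists_deriv_eq_slope F one_pos hF.continuous.continuousOn
    (hF.differentiable one_ne_zero).differentiableOn
  have hcn : deriv F c = n 0 := by
    have := hn0 0
    rw [zero_add] at this
    rw [hc, this]
    ring
  have hsN : s * n 0 = (n 0).natAbs := by
    have h1 := hpos c
    rw [hcn] at h1
    rw [Nat.cast_natAbs, Int.cast_abs]
    rcases hs with rfl | rfl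
    · rw [abs_of_pos (by linarith), one_mul]
    · rw [abs_of_neg (by linarith), neg_one_mul]
  have hN : 2 ≤ (n 0).natAbs := by
    have h1 := hexp c
    rw [hcn] at h1
    rwa [← Int.cast_abs, ← Nat.cast_natAbs, Nat.one_lt_cast] at h1
  have hadd : ∀ x, F (x + s) = F x + ((n 0).natAbs : ℝ) := fun x => by
    rw [← hsN]
    rcases hs with rfl | rfl
    · rw [hn0, one_mul]
    · have := hn0 (x + -1)
      rw [neg_add_cancel_right] at this
      linarith
  obtain ⟨G, hG⟩ := exists_isCoveringLift (by omega) hF hs hpos hadd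
  exact ⟨G, s, _, hN, hG⟩

/-! ### Eigenvectors in the tangent space -/

section Eigenvectors

variable {μ : Measure UnitAddCircle} [IsFiniteMeasure μ]

/-- For a measure of full support, a continuous function is determined by its class in `L²`. -/
theorem linearIndependent_toLp [μ.IsOpenPosMeasure] {v : ℕ → C(UnitAddCircle, ℝ)}
    (hv : LinearIndependent ℝ v) (hv0 : ∀ i, integralUnitAddCircle ℝ (v i) = 0) :
    LinearIndependent ℝ fun i =>
      (⟨ContinuousMap.toLp 2 μ ℝ (v i), toLp_mem_tangentL2 (hv0 i)⟩ : tangentL2 μ) := by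
  refine LinearIndependent.of_comp (tangentL2 μ).subtype ?_
  exact hv.map' (ContinuousMap.toLp 2 μ ℝ).toLinearMap
    (LinearMap.ker_eq_bot.2 (ContinuousMap.toLp_injective μ))

theorem exists_linearIndependent_tangentDual_eq_smul [μ.IsOpenPosMeasure] {F G : ℝ → ℝ} {s : ℝ}
    {N : ℕ} (h : IsCoveringLift F G s N) (hN : 2 ≤ N) {Φ : UnitAddCircle → UnitAddCircle}
    (hΦl : ∀ x : ℝ, Φ (x : UnitAddCircle) = (F x : UnitAddCircle)) (hΦ : MeasurePreserving Φ μ μ)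
    {ρ a : C(UnitAddCircle, ℝ)} (hρ : ∀ x, 0 < ρ x)
    (hμ : μ = volume.withDensity fun x => ENNReal.ofReal (ρ x))
    (hinv : transfer F G s N (fun x => ρ (x : UnitAddCircle)) = fun x : ℝ => ρ (x : UnitAddCircle))
    (ha : ∀ x : ℝ, a (x : UnitAddCircle) = deriv F x)
    {m : ℝ} (hm : 0 < m) (hFm : ∀ x, m ≤ |deriv F x|) {α : ℝ} (hα : |α| < m) :
    ∃ v : ℕ → tangentL2 μ, LinearIndependent ℝ v ∧
      ∀ i, (∃ c : C(UnitAddCircle, ℝ), (v i : Lp ℝ 2 μ) =ᵐ[μ] c) ∧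
        tangentDual a hΦ (v i) = α • v i := by
  obtain ⟨v, hv, hvi⟩ :=
    exists_linearIndependent_eigenfunctions (𝕜 := ℝ) h hN hΦl hρ hinv hm hFm hα
  refine ⟨_, linearIndependent_toLp hv fun i => (hvi i).1,
    fun i => ⟨⟨v i, ContinuousMap.coeFn_toLp μ _⟩, ?_⟩⟩
  have hw : integralUnitAddCircle ℝ (α • v i) = 0 := by rw [map_smul, (hvi i).1, smul_zero]
  rw [tangentDual_toLp h hΦl hΦ hρ hμ ha (w := α • v i) (b := 0) (hvi i).1 hw fun x => by
    rw [sub_zero]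
    exact (hvi i).2 x]
  exact Subtype.ext (map_smul _ _ _)

theorem exists_linearIndependent_tangentDual_complex {F G : ℝ → ℝ} {s : ℝ}
    {N : ℕ} (h : IsCoveringLift F G s N) (hN : 2 ≤ N) {Φ : UnitAddCircle → UnitAddCircle}
    (hΦl : ∀ x : ℝ, Φ (x : UnitAddCircle) = (F x : UnitAddCircle)) (hΦ : MeasurePreserving Φ μ μ)
    {ρ a : C(UnitAddCircle, ℝ)} (hρ : ∀ x, 0 < ρ x)
    (hμ : μ = volume.withDensity fun x => ENNReal.ofReal (ρ x))
    (hinv : transfer F G s N (fun x => ρ (x : UnitAddCircle)) = fun x : ℝ => ρ (x : UnitAddCircle))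
    (ha : ∀ x : ℝ, a (x : UnitAddCircle) = deriv F x)
    {m : ℝ} (hm : 0 < m) (hFm : ∀ x, m ≤ |deriv F x|) {z : ℂ} (hz : ‖z‖ < m) :
    ∃ c : ℕ → C(UnitAddCircle, ℂ), LinearIndependent ℂ c ∧
      ∀ i, ∃ u v : tangentL2 μ,
        ((u : Lp ℝ 2 μ) =ᵐ[μ] fun x => (c i x).re) ∧
        ((v : Lp ℝ 2 μ) =ᵐ[μ] fun x => (c i x).im) ∧
        tangentDual a hΦ u = z.re • u - z.im • v ∧
        tangentDual a hΦ v = z.im • u + z.re • v := by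
  obtain ⟨c, hc, hci⟩ :=
    exists_linearIndependent_eigenfunctions (𝕜 := ℂ) h hN hΦl hρ hinv hm hFm hz
  refine ⟨c, hc, fun i => ?_⟩
  obtain ⟨h0, h1⟩ := hci i
  let u : C(UnitAddCircle, ℝ) := ⟨fun x => (c i x).re, by fun_prop⟩
  let v : C(UnitAddCircle, ℝ) := ⟨fun x => (c i x).im, by fun_prop⟩
  have hint : Integrable (c i) volume :=
    (c i).continuous.integrable_of_hasCompactSupport (HasCompactSupport.of_compactSpace _)
  have hu : integralUnitAddCircle ℝ u = 0 := by
    have := Complex.reCLM.integral_comp_comm hint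
    exact this.trans (congrArg Complex.re h0)
  have hv : integralUnitAddCircle ℝ v = 0 := by
    have := Complex.imCLM.integral_comp_comm hint
    exact this.trans (congrArg Complex.im h0)
  have hwu : integralUnitAddCircle ℝ (z.re • u - z.im • v) = 0 := by
    rw [map_sub, map_smul, map_smul, hu, hv, smul_zero, smul_zero, sub_zero]
  have hwv : integralUnitAddCircle ℝ (z.im • u + z.re • v) = 0 := by
    rw [map_add, map_smul, map_smul, hu, hv, smul_zero, smul_zero, add_zero]
  -- The weights are real, so the fibre sum commutes with real and imaginary parts.
  have hsum : ∀ x, (s : ℂ) * branchSum G N (fun y => ((ρ (y : UnitAddCircle) : ℝ) : ℂ) *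
      c i (y : UnitAddCircle)) x =
      ⟨s * branchSum G N (fun y => ρ (y : UnitAddCircle) * u (y : UnitAddCircle)) x,
        s * branchSum G N (fun y => ρ (y : UnitAddCircle) * v (y : UnitAddCircle)) x⟩ :=
    fun x => by
      apply Complex.ext <;> simp [branchSum, Complex.re_sum, Complex.im_sum, u, v]
  refine ⟨⟨ContinuousMap.toLp 2 μ ℝ u, toLp_mem_tangentL2 hu⟩,
    ⟨ContinuousMap.toLp 2 μ ℝ v, toLp_mem_tangentL2 hv⟩, ContinuousMap.coeFn_toLp μ u,
    ContinuousMap.coeFn_toLp μ v, ?_, ?_⟩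
  · rw [tangentDual_toLp h hΦl hΦ hρ hμ ha (b := 0) hu hwu fun x => ?_]
    · refine Subtype.ext ?_
      simp only [map_sub, map_smul]
      rfl
    · rw [sub_zero]
      have h2 := congrArg Complex.re ((h1 x).trans (hsum x))
      refine Eq.trans ?_ h2
      simp [u, v]
  · rw [tangentDual_toLp h hΦl hΦ hρ hμ ha (b := 0) hv hwv fun x => ?_]
    · refine Subtype.ext ?_
      simp only [map_add, map_smul]
      rfl
    · rw [sub_zero]
      have h2 := congrArg Complex.im ((h1 x).trans (hsum x))
      refine Eq.trans ?_ h2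
      simp [u, v, add_comm]

end Eigenvectors

/-! ### The main theorem -/

theorem mainTheorem5
    -- a `C²` expanding circle map `Φ`, given with a `C²` lift `F` to the line
    (Φ : UnitAddCircle → UnitAddCircle) (F : ℝ → ℝ)
    (hF : ContDiff ℝ 2 F)
    (hlift : ∀ x : ℝ, Φ (x : UnitAddCircle) = (F x : UnitAddCircle))
    (hexp : ∀ x : ℝ, 1 < |deriv F x|)
    -- its absolutely continuous invariant probability measure
    (μ : Measure UnitAddCircle) [IsProbabilityMeasure μ]
    (hac : μ ≪ (volume : Measure UnitAddCircle))
    (hinv : μ.map Φ = μ) :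
    ∃ (m : ℝ) (ρ : C(UnitAddCircle, ℝ)) (R : ℝ) (L : tangentL2 μ →L[ℝ] tangentL2 μ),
      -- `m = min |Φ'|`
      IsLeast (Set.range fun x : ℝ => |deriv F x|) m ∧
      -- `ρ` is the continuous positive density of `μ`
      (∀ x, 0 < ρ x) ∧
      μ = (volume : Measure UnitAddCircle).withDensity (fun x => ENNReal.ofReal (ρ x)) ∧
      -- `R ≥ m > 1`
      IsTransferRadius Φ ρ R ∧ m ≤ R ∧ 1 < m ∧
      -- `L` is the Gateaux derivative at `μ` of the action of `Φ` on measures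
      HasGateauxDeriv (fun ν => ν.map Φ) μ μ L ∧
      (∀ L' : tangentL2 μ →L[ℝ] tangentL2 μ,
        HasGateauxDeriv (fun ν => ν.map Φ) μ μ L' → L' = L) ∧
      -- an infinite linearly independent family of continuous fixed vectors
      (∃ v : ℕ → tangentL2 μ, LinearIndependent ℝ v ∧
        ∀ i, (∃ c : C(UnitAddCircle, ℝ), (v i : Lp ℝ 2 μ) =ᵐ[μ] c) ∧ L (v i) = v i) ∧
      -- the same for every real number of absolute value below `m`
      (∀ α : ℝ, |α| < m →
        ∃ v : ℕ → tangentL2 μ, LinearIndependent ℝ v ∧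
          ∀ i, (∃ c : C(UnitAddCircle, ℝ), (v i : Lp ℝ 2 μ) =ᵐ[μ] c) ∧ L (v i) = α • v i) ∧
      -- the same for every complex number of modulus below `m` and the complexification of `L`:
      -- `c i = a + b * I` with `L a + (L b) * I = z * (a + b * I)`
      (∀ z : ℂ, ‖z‖ < m →
        ∃ c : ℕ → C(UnitAddCircle, ℂ), LinearIndependent ℂ c ∧
          ∀ i, ∃ a b : tangentL2 μ,
            ((a : Lp ℝ 2 μ) =ᵐ[μ] fun x => (c i x).re) ∧
            ((b : Lp ℝ 2 μ) =ᵐ[μ] fun x => (c i x).im) ∧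
            L a = z.re • a - z.im • b ∧ L b = z.im • a + z.re • b) := by

  have hF1 : ContDiff ℝ 1 F := hF.of_le one_le_two
  obtain ⟨G, s, N, hN, h⟩ := exists_isCoveringLift_of_one_lt_abs_deriv hF1 hlift hexp
  have hN0 : 0 < N := by omega
  obtain ⟨z, -, hz⟩ := isCompact_Icc.exists_isMinOn (s := Set.Icc (0 : ℝ) 1) ⟨0, by simp⟩
    h.continuous_deriv.abs.continuousOn
  have hFm : ∀ x, |deriv F z| ≤ |deriv F x| := fun x => by
    obtain ⟨y, hy, hxy⟩ := h.deriv_periodic.exists_mem_Ico₀ one_pos x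
    rw [hxy]
    exact hz ⟨hy.1, hy.2.le⟩
  have hm := hexp z
  obtain ⟨K, ρ₀, hK, hρ₀, hρ₁, hρinv, hconv⟩ := h.exists_invariant_density hN0 hm hFm hF
  obtain ⟨ρ, hρ⟩ := exists_continuousMap_of_periodic hρ₀.periodic (hρ₀.continuous hK)
  obtain rfl : ρ₀ = fun x : ℝ => ρ (x : UnitAddCircle) := (funext hρ).symm
  have hρpos : ∀ x, 0 < ρ x := fun x => by
    obtain ⟨y, rfl⟩ := QuotientAddGroup.mk_surjective x
    exact hρ₀.pos y
  have hμ := h.eq_withDensity_of_invariant hlift hρpos hρ₁ hconv hac hinv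
  have hΦm : Measurable Φ := (h.continuous_of_lift hlift).measurable
  have hΦ : MeasurePreserving Φ μ μ := ⟨hΦm, hinv⟩
  obtain ⟨a, ha⟩ := exists_continuousMap_of_periodic h.deriv_periodic h.continuous_deriv
  obtain ⟨R, hR, hmR⟩ := exists_isTransferRadius h hN0 hlift hρpos hρinv hm.le hFm
  obtain ⟨C, -, hC⟩ := hρ₀.exists_abs_sub_le hK
  -- Positivity of `ρ` makes Lebesgue measure absolutely continuous with respect to `μ`, whence full
  -- support.
  have hopen : μ.IsOpenPosMeasure := by
    have hvol : (volume : Measure UnitAddCircle) ≪ μ := by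
      rw [hμ]
      exact withDensity_absolutelyContinuous' ρ.continuous.measurable.ennreal_ofReal.aemeasurable
        (Eventually.of_forall fun x => (ENNReal.ofReal_pos.2 (hρpos x)).ne')
    exact hvol.isOpenPosMeasure
  have hL := hasGateauxDeriv_tangentDual h hN0 hlift hΦ hρpos
    ((integralUnitAddCircle_apply ρ).trans hρ₁) hμ hC hρinv ha
  have hreal := fun {α : ℝ} (hα : |α| < |deriv F z|) =>
    exists_linearIndependent_tangentDual_eq_smul h hN hlift hΦ hρpos hμ hρinv ha
      (one_pos.trans hm) hFm hα
  refine ⟨|deriv F z|, ρ, R, tangentDual a hΦ, ⟨⟨z, rfl⟩, ?_⟩, hρpos, hμ, hR, hmR, hm, hL,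
    fun L' hL' => hL.unique hL' fun v t => ?_, ?_, fun α hα => hreal hα, fun w hw =>
    exists_linearIndependent_tangentDual_complex h hN hlift hΦ hρpos hμ hρinv ha
      (one_pos.trans hm) hFm hw⟩
  · rintro _ ⟨x, rfl⟩
    exact hFm x
  · exact Measure.isProbabilityMeasure_map hΦm.aemeasurable
  -- Fixed vectors are the case `α = 1`, allowed since `1 < m`.
  · simpa only [one_smul] using hreal (α := 1) (by rwa [abs_one])
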